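/- Let $d\in\mathbb{N}$, let $\Sigma\subset\mathbb{R}^d$ be a compact set of zero $d$-dimensional Lebesgue measure, put $N:=\mathbb{R}^d\setminus\Sigma$, and let $0<\alpha\le 2$. Let $L^2(\mathbb{R}^d)$ denote the space of real-valued square integrable functions, let $C_0^\infty(N)$ be the space of smooth functions with compact support contained in $N$, and let $(-\Delta)^{\alpha/2}f=(|\xi|^\alpha\hat f)^\vee$, with $\hat{}$ the Fourier transform for which $-\Delta f=(|\xi|^2\hat f)^\vee$. Then the fractional Laplacian $((-\Delta)^{\alpha/2},C_0^\infty(N))$ is Markov unique if and only if $\operatorname{cap}_{\alpha/2,2}(\Sigma)=0$. Here Markov unique means that $(-(-\Delta)^{\alpha/2},C_0^\infty(N))$ has exactly one self-adjoint extension in $L^2(\mathbb{R}^d)$ that is the infinitesimal generator of a Markov semigroup, that is, of a strongly continuous contraction semigroup $(P_t)_{t\ge 0}$ of symmetric operators on $L^2(\mathbb{R}^d)$ such that $0\le u\le 1$ a.e. implies $0\le P_tu\le 1$ a.e. For $s>0$ and $E\subset\mathbb{R}^d$, $$\operatorname{cap}_{s,2}(E)=\inf\left\{\|f\|_{L^2(\mathbb{R}^d)}^2:\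 f\in L^2(\mathbb{R}^d),\ f\ge 0,\ (\gamma_s*f)(x)\ge 1\text{ for all }x\in E\right\},\qquad \inf\emptyset=+\infty,$$ where $\gamma_s=((1+|\xi|^2)^{-s/2})^\vee\ge 0$ is the Bessel kernel of order $s$, normalized so that $\int\gamma_s\,dx=1$. -/

import Mathlib

open MeasureTheory Filter Topology FourierTransform
open scoped ENNReal ContDiff

noncomputable section

namespace MarkovUniqueness

/-! ### The Hilbert space `L²(ℝᵈ)` of real-valued functions and the fractional Laplacian -/

/-- Euclidean space `ℝᵈ`. -/
abbrev Space (d : ℕ) : Type := EuclideanSpace ℝ (Fin d)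

/-- `L²(ℝᵈ)`, real-valued. -/
abbrev L2 (d : ℕ) : Type := Lp ℝ 2 (volume : Measure (Space d))

/-- `L²(ℝᵈ; ℂ)`, on which the Fourier transform acts. -/
abbrev L2C (d : ℕ) : Type := Lp ℂ 2 (volume : Measure (Space d))

/-- The inclusion of real-valued into complex-valued square integrable functions. -/
def complexify (d : ℕ) : L2 d →L[ℝ] L2C d := Complex.ofRealCLM.compLpL 2 volume

/-- The pointwise real part of a complex-valued square integrable function. -/
def realPart (d : ℕ) : L2C d →L[ℝ] L2 d := Complex.reCLM.compLpL 2 volume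

/-- The function `ξ ↦ |ξ|^α û(ξ)`. Mathlib's Fourier transform has the kernel `exp (-2πi⟨x, ξ⟩)`,
so the angular frequency is `2πξ` and the symbol of `-Δ` is `(2π|ξ|)²`. -/
def fracSymbolMul (d : ℕ) (α : ℝ) (u : L2 d) (ξ : Space d) : ℂ :=
  (((2 * Real.pi * ‖ξ‖) ^ α : ℝ) : ℂ) * (𝓕 (complexify d u) : L2C d) ξ

theorem fracSymbolMul_add_ae (d : ℕ) (α : ℝ) (u v : L2 d) :
    fracSymbolMul d α (u + v) =ᵐ[volume] fracSymbolMul d α u + fracSymbolMul d α v := by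
  have h : (𝓕 (complexify d (u + v)) : L2C d) = 𝓕 (complexify d u) + 𝓕 (complexify d v) := by
    rw [map_add, FourierTransform.fourier_add]
  filter_upwards [Lp.coeFn_add (𝓕 (complexify d u) : L2C d) (𝓕 (complexify d v))] with ξ hξ
  simp only [fracSymbolMul, h, hξ, Pi.add_apply, mul_add]

theorem fracSymbolMul_smul_ae (d : ℕ) (α : ℝ) (c : ℝ) (u : L2 d) :
    fracSymbolMul d α (c • u) =ᵐ[volume] (c : ℂ) • fracSymbolMul d α u := by
  have h : (𝓕 (complexify d (c • u)) : L2C d) = (c : ℂ) • 𝓕 (complexify d u) := by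
    rw [map_smul, ← FourierTransform.fourier_smul]
    rfl
  filter_upwards [Lp.coeFn_smul (c : ℂ) (𝓕 (complexify d u) : L2C d)] with ξ hξ
  simp only [fracSymbolMul, h, hξ, Pi.smul_apply, smul_eq_mul]
  ring

/-- The fractional Laplacian `(-Δ)^{α/2} u = (|ξ|^α û)^∨` in `L²(ℝᵈ)`, on its natural domain
`{u ∈ L² : |ξ|^α û ∈ L²} = H^α(ℝᵈ)`. The inverse Fourier transform in question is real-valued
(see `complexify_fracLaplacian`); `realPart` only turns it into an element of the real `L²`. -/
def fracLaplacian (d : ℕ) (α : ℝ) : L2 d →ₗ.[ℝ] L2 d where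
  domain :=
    { carrier := {u | MemLp (fracSymbolMul d α u) 2 volume}
      add_mem' := fun {u v} hu hv =>
        (memLp_congr_ae (fracSymbolMul_add_ae d α u v)).mpr (MemLp.add hu hv)
      zero_mem' := by
        have h := fracSymbolMul_smul_ae d α 0 0
        rw [zero_smul] at h
        refine (memLp_congr_ae h).mpr ?_
        simp
      smul_mem' := fun c u hu =>
        (memLp_congr_ae (fracSymbolMul_smul_ae d α c u)).mpr (MemLp.const_smul hu (c : ℂ)) }
  toFun :=
    { toFun := fun u => realPart d (𝓕⁻ (MemLp.toLp (fracSymbolMul d α u) u.2 : L2C d))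
      map_add' := fun u v => by
        rw [← map_add, ← fourierInv_add, ← MemLp.toLp_add]
        congr 2
        exact MemLp.toLp_congr _ _ (fracSymbolMul_add_ae d α u v)
      map_smul' := fun c u => by
        rw [RingHom.id_apply, ← map_smul]
        have : c • (𝓕⁻ (MemLp.toLp (fracSymbolMul d α u) u.2 : L2C d)) =
            (c : ℂ) • (𝓕⁻ (MemLp.toLp (fracSymbolMul d α u) u.2 : L2C d)) := rfl
        rw [this, ← fourierInv_smul, ← MemLp.toLp_const_smul]
        congr 2
        exact MemLp.toLp_congr _ _ (fracSymbolMul_smul_ae d α c u) }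

/-- The real part in the definition of `fracLaplacian` loses nothing: as a complex-valued function,
`(-Δ)^{α/2} u` is the inverse Fourier transform of `|ξ|^α û`. -/
theorem complexify_fracLaplacian (d : ℕ) (α : ℝ) (u : (fracLaplacian d α).domain) :
    complexify d (fracLaplacian d α u) =
      (𝓕⁻ (MemLp.toLp (fracSymbolMul d α u) u.2 : L2C d) : L2C d) := by
  set g : L2C d := MemLp.toLp (fracSymbolMul d α u) u.2 with hg
  have mp : MeasurePreserving (fun x : Space d => -x) volume volume :=
    Measure.measurePreserving_neg _
  -- reflection and conjugation commute with the Fourier transform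
  let R : L2C d → L2C d := Lp.compMeasurePreserving (fun x : Space d => -x) mp
  let C : L2C d →L[ℝ] L2C d := (Complex.conjCLE : ℂ →L[ℝ] ℂ).compLpL 2 volume
  have hR : ∀ f : L2C d, R f =ᵐ[volume] fun x => f (-x) := fun f =>
    Lp.coeFn_compMeasurePreserving f mp
  have hC : ∀ f : L2C d, C f =ᵐ[volume] fun x => (starRingEnd ℂ) (f x) := fun f =>
    ContinuousLinearMap.coeFn_compLpL _ f
  have key : ∀ f : L2C d, (𝓕 (C f) : L2C d) = R (C (𝓕 f)) := by
    intro f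
    have hRc : Continuous R := (Lp.isometry_compMeasurePreserving mp).continuous
    have hFc : Continuous (fun f : L2C d => (𝓕 f : L2C d)) :=
      (Lp.fourierTransformₗᵢ (Space d) ℂ).continuous
    refine (SchwartzMap.denseRange_toLpCLM (E := Space d) (F := ℂ) (p := 2) (μ := volume)
      ENNReal.ofNat_ne_top).induction_on
      (p := fun f : L2C d => (𝓕 (C f) : L2C d) = R (C (𝓕 f))) f ?_ ?_
    · exact isClosed_eq (hFc.comp C.continuous) (hRc.comp (C.continuous.comp hFc))
    · intro ψ
      let ψ' := ψ.postcompCLM (Complex.conjCLE : ℂ →L[ℝ] ℂ)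
      have h1 : C (ψ.toLp 2) = ψ'.toLp 2 := by
        apply Lp.ext
        filter_upwards [hC (ψ.toLp 2), ψ.coeFn_toLp 2 volume, ψ'.coeFn_toLp 2 volume]
          with x h1 h2 h3
        rw [h1, h2, h3]
        rfl
      rw [SchwartzMap.toLpCLM_apply, h1, SchwartzMap.toLp_fourier_eq, SchwartzMap.toLp_fourier_eq]
      apply Lp.ext
      have e1 := hC ((𝓕 ψ).toLp 2)
      have e2 := (𝓕 ψ).coeFn_toLp 2 volume
      filter_upwards [hR (C ((𝓕 ψ).toLp 2)), mp.quasiMeasurePreserving.ae e1,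
        mp.quasiMeasurePreserving.ae e2, (𝓕 ψ').coeFn_toLp 2 volume] with x h1 h2 h3 h4
      rw [h1, h2, h3, h4, SchwartzMap.fourier_coe, SchwartzMap.fourier_coe, Real.fourier_eq',
        Real.fourier_eq', ← integral_conj]
      congr 1
      ext v
      have : ψ' v = (starRingEnd ℂ) (ψ v) := rfl
      rw [this, smul_eq_mul, smul_eq_mul, map_mul, ← Complex.exp_conj]
      congr 2
      simp only [Complex.ofReal_neg, Complex.ofReal_mul, Complex.ofReal_ofNat, map_mul, map_neg,
        map_ofNat, Complex.conj_ofReal, Complex.conj_I, inner_neg_right]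
      ring
  have hCu : C (complexify d u) = complexify d u := by
    apply Lp.ext
    filter_upwards [hC (complexify d u),
      ContinuousLinearMap.coeFn_compLpL (p := 2) (μ := volume) Complex.ofRealCLM (u : L2 d)]
      with x h1 h2
    have h2' : (complexify d u) x = ((u : L2 d) x : ℂ) := h2
    rw [h1, h2', Complex.conj_ofReal]
  have hg' : g =ᵐ[volume] fracSymbolMul d α u := MemLp.coeFn_toLp u.2
  have hRCg : R (C g) = g := by
    have k := key (complexify d u)
    rw [hCu] at k
    have e1 := hC (𝓕 (complexify d u) : L2C d)
    apply Lp.ext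
    have e0 := hR (C (𝓕 (complexify d u) : L2C d))
    rw [← k] at e0
    filter_upwards [hR (C g), mp.quasiMeasurePreserving.ae (hC g),
      mp.quasiMeasurePreserving.ae hg', hg', e0, mp.quasiMeasurePreserving.ae e1]
      with x h1 h2 h3 h4 h5 h6
    rw [h1, h2, h3, h4, fracSymbolMul, fracSymbolMul, h5, h6, map_mul, Complex.conj_ofReal,
      norm_neg]
  have hw : C (𝓕⁻ g : L2C d) = (𝓕⁻ g : L2C d) := by
    have k := key (𝓕⁻ g : L2C d)
    rw [fourier_fourierInv_eq, hRCg] at k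
    exact (fourierInv_fourier_eq (C (𝓕⁻ g : L2C d))).symm.trans (congrArg _ k)
  apply Lp.ext
  have e : (fracLaplacian d α u) = realPart d (𝓕⁻ g : L2C d) := rfl
  have e1 := hC (𝓕⁻ g : L2C d)
  rw [hw] at e1
  rw [e]
  filter_upwards [ContinuousLinearMap.coeFn_compLpL (p := 2) (μ := volume) Complex.ofRealCLM
      (realPart d (𝓕⁻ g : L2C d)),
    ContinuousLinearMap.coeFn_compLpL (p := 2) (μ := volume) Complex.reCLM (𝓕⁻ g : L2C d), e1]
    with x h1 h2 h3
  have h1' : (complexify d (realPart d (𝓕⁻ g : L2C d))) x = ((realPart d (𝓕⁻ g : L2C d)) x : ℂ) := h1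
  have h2' : (realPart d (𝓕⁻ g : L2C d)) x = ((𝓕⁻ g : L2C d) x).re := h2
  rw [h1', h2']
  exact Complex.conj_eq_iff_re.mp h3.symm

/-- `C₀^∞(N)`, as a subspace of `L²(ℝᵈ)`: the classes of the smooth functions whose support is
compact and contained in `N`. -/
def testFunctions (d : ℕ) (N : Set (Space d)) : Submodule ℝ (L2 d) where
  carrier := {u | ∃ φ : Space d → ℝ, ContDiff ℝ ∞ φ ∧ HasCompactSupport φ ∧ tsupport φ ⊆ N ∧
    u =ᵐ[volume] φ}
  add_mem' := by
    rintro u v ⟨φ, hφ, hφc, hφN, hu⟩ ⟨ψ, hψ, hψc, hψN, hv⟩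
    refine ⟨φ + ψ, hφ.add hψ, hφc.add hψc,
      (tsupport_add φ ψ).trans (Set.union_subset hφN hψN), ?_⟩
    exact (Lp.coeFn_add u v).trans (hu.add hv)
  zero_mem' := ⟨0, contDiff_const, HasCompactSupport.zero, by simp [tsupport], Lp.coeFn_zero _ _ _⟩
  smul_mem' := by
    rintro c u ⟨φ, hφ, hφc, hφN, hu⟩
    refine ⟨c • φ, contDiff_const.smul hφ, hφc.smul_left (f := fun _ => c),
      (closure_mono (Function.support_const_smul_subset c φ)).trans hφN, ?_⟩
    exact (Lp.coeFn_smul c u).trans (hu.const_smul c)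

/-- The operator `((-Δ)^{α/2}, C₀^∞(N))` in `L²(ℝᵈ)`. -/
def fracLaplacianOn (d : ℕ) (α : ℝ) (N : Set (Space d)) : L2 d →ₗ.[ℝ] L2 d :=
  (fracLaplacian d α).domRestrict (testFunctions d N)

/-- All of `C₀^∞(N)` is the domain of `fracLaplacianOn`. -/
theorem fracLaplacianOn_domain (d : ℕ) (α : ℝ) (hα₀ : 0 < α) (hα₂ : α ≤ 2) (N : Set (Space d)) :
    (fracLaplacianOn d α N).domain = testFunctions d N := by
  rw [fracLaplacianOn, LinearPMap.domRestrict_domain, inf_eq_left]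
  rintro u ⟨φ, hφ, hφc, -, hu⟩
  change MemLp (fracSymbolMul d α u) 2 volume
  let ψ : SchwartzMap (Space d) ℂ := (hφc.comp_left (g := Complex.ofRealCLM)
    (map_zero _)).toSchwartzMap (Complex.ofRealCLM.contDiff.comp hφ)
  have h1 : complexify d u = ψ.toLp 2 := by
    apply Lp.ext
    filter_upwards [ContinuousLinearMap.coeFn_compLpL (p := 2) (μ := volume) Complex.ofRealCLM u,
      ψ.coeFn_toLp 2 volume, hu] with x h1 h2 h3
    have h1' : (complexify d u) x = (u x : ℂ) := h1
    rw [h1', h2, h3]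
    rfl
  have h2 : (𝓕 (complexify d u) : L2C d) = (𝓕 ψ).toLp 2 := by
    rw [h1, SchwartzMap.toLp_fourier_eq]
  have hgr : (fun x : Space d => 1 + (2 * Real.pi) ^ 2 * ‖x‖ ^ 2).HasTemperateGrowth := by
    fun_prop
  let χ := SchwartzMap.smulLeftCLM ℂ (fun x : Space d => 1 + (2 * Real.pi) ^ 2 * ‖x‖ ^ 2) (𝓕 ψ)
  refine MemLp.mono (χ.memLp 2 volume) ?_ ?_
  · refine AEStronglyMeasurable.mul ?_ (Lp.aestronglyMeasurable _)
    exact Measurable.aestronglyMeasurable (by fun_prop)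
  · filter_upwards [(𝓕 ψ).coeFn_toLp 2 volume] with x hx
    rw [fracSymbolMul, h2, hx, SchwartzMap.smulLeftCLM_apply_apply hgr, norm_mul, norm_smul,
      Complex.norm_real]
    gcongr
    have hy : 0 ≤ 2 * Real.pi * ‖x‖ := by positivity
    rw [Real.norm_of_nonneg (by positivity), Real.norm_of_nonneg (by positivity), ← mul_pow]
    rcases le_total (2 * Real.pi * ‖x‖) 1 with h | h
    · have := Real.rpow_le_one hy h hα₀.le
      nlinarith [sq_nonneg (2 * Real.pi * ‖x‖)]
    · have := Real.rpow_le_rpow_of_exponent_le h hα₂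
      rw [Real.rpow_two] at this
      linarith

/-! ### Markov semigroups and Markov uniqueness -/

section Markov

variable {X : Type*} [MeasurableSpace X] {μ : Measure X}

/-- A strongly continuous contraction semigroup of symmetric Markov operators on the real space
`L²(X, μ)`; an operator `P` is Markov if `0 ≤ u ≤ 1` a.e. implies `0 ≤ P u ≤ 1` a.e. -/
structure IsMarkovSemigroup (P : ℝ → Lp ℝ 2 μ →L[ℝ] Lp ℝ 2 μ) : Prop where
  zero : P 0 = ContinuousLinearMap.id ℝ _
  add : ∀ s t : ℝ, 0 ≤ s → 0 ≤ t → P (s + t) = (P s).comp (P t)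
  contraction : ∀ t : ℝ, 0 ≤ t → ‖P t‖ ≤ 1
  continuous : ∀ u, Tendsto (fun t => P t u) (𝓝[>] 0) (𝓝 u)
  symmetric : ∀ t : ℝ, 0 ≤ t → ∀ u v, inner ℝ (P t u) v = inner ℝ u (P t v)
  markov : ∀ t : ℝ, 0 ≤ t → ∀ u : Lp ℝ 2 μ, (∀ᵐ x ∂μ, 0 ≤ u x ∧ u x ≤ 1) →
    ∀ᵐ x ∂μ, 0 ≤ P t u x ∧ P t u x ≤ 1

/-- `A` is the infinitesimal generator of `P`: its domain consists of all `u` for which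
`lim_{t ↓ 0} (P t u - u) / t` exists in `L²`, and `A u` is this limit. -/
def IsGenerator (P : ℝ → Lp ℝ 2 μ →L[ℝ] Lp ℝ 2 μ) (A : Lp ℝ 2 μ →ₗ.[ℝ] Lp ℝ 2 μ) : Prop :=
  ∀ u v : Lp ℝ 2 μ,
    (u, v) ∈ A.graph ↔ Tendsto (fun t : ℝ => t⁻¹ • (P t u - u)) (𝓝[>] 0) (𝓝 v)

/-- An operator `L` in `L²(X, μ)` is Markov unique if it has exactly one self-adjoint extension
that generates a Markov semigroup. -/
def IsMarkovUnique (L : Lp ℝ 2 μ →ₗ.[ℝ] Lp ℝ 2 μ) : Prop :=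
  ∃! A : Lp ℝ 2 μ →ₗ.[ℝ] Lp ℝ 2 μ,
    L ≤ A ∧ IsSelfAdjoint A ∧ ∃ P, IsMarkovSemigroup P ∧ IsGenerator P A

end Markov

/-! ### Bessel kernels and capacities -/

/-- The Gauss kernel `(4πt)^{-d/2} e^{-|x|²/(4t)}`. -/
def gaussKernel (d : ℕ) (t : ℝ) (x : Space d) : ℝ :=
  (4 * Real.pi * t) ^ (-(d : ℝ) / 2) * Real.exp (-‖x‖ ^ 2 / (4 * t))

/-- The weight `t^{s/2-1} e^{-t} / Γ(s/2)`. -/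
def gammaWeight (s t : ℝ) : ℝ :=
  (Real.Gamma (s / 2))⁻¹ * (t ^ (s / 2 - 1) * Real.exp (-t))

/-- The Bessel kernel `γ_s` on `ℝᵈ`, `s > 0`: the inverse Fourier transform of
`(1 + |ξ|²)^{-s/2}`, written as the superposition
`Γ(s/2)⁻¹ ∫₀^∞ t^{s/2-1} e^{-t} (4πt)^{-d/2} e^{-|x|²/(4t)} dt ∈ [0, ∞]` of Gauss kernels, which
gives it a value at every point. See `fourier_besselKernel` for its Fourier transform. -/
def besselKernel (d : ℕ) (s : ℝ) (x : Space d) : ℝ≥0∞ :=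
  ∫⁻ t in Set.Ioi (0 : ℝ), ENNReal.ofReal (gammaWeight s t * gaussKernel d t x)

theorem gaussKernel_nonneg (d : ℕ) {t : ℝ} (ht : 0 < t) (x : Space d) : 0 ≤ gaussKernel d t x := by
  unfold gaussKernel
  positivity

theorem gammaWeight_nonneg {s t : ℝ} (hs : 0 < s) (ht : 0 < t) : 0 ≤ gammaWeight s t := by
  have := Real.Gamma_pos_of_pos (half_pos hs)
  unfold gammaWeight
  positivity

theorem fourier_gaussKernel (d : ℕ) {t : ℝ} (ht : 0 < t) (ξ : Space d) :
    𝓕 (fun x : Space d => (gaussKernel d t x : ℂ)) ξ =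
      (Real.exp (-((2 * Real.pi * ‖ξ‖) ^ 2 * t)) : ℂ) := by
  have hb : 0 < ((1 / (4 * t) : ℝ) : ℂ).re := by
    rw [Complex.ofReal_re]
    positivity
  have h := fourier_gaussian_innerProductSpace (V := Space d) hb ξ
  have e : (fun x : Space d => (gaussKernel d t x : ℂ)) =
      (((4 * Real.pi * t) ^ (-(d : ℝ) / 2) : ℝ) : ℂ) •
        fun v : Space d => Complex.exp (-((1 / (4 * t) : ℝ) : ℂ) * (‖v‖ : ℂ) ^ 2) := by
    ext x
    simp only [gaussKernel, Pi.smul_apply, smul_eq_mul]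
    push_cast
    congr 2
    ring
  rw [Real.fourier_eq] at h ⊢
  have e' := fun x => congrFun e x
  simp only [Pi.smul_apply] at e'
  simp_rw [e']
  simp only [Circle.smul_def, smul_eq_mul] at h ⊢
  have e2 : ∀ v : Space d, ∀ a b c : ℂ, a * (b * c) = b * (a * c) := fun _ a b c => by ring
  simp_rw [fun v : Space d => e2 v (Real.fourierChar (-inner ℝ v ξ) : ℂ)]
  rw [integral_const_mul, h]
  have hp : 0 < 4 * Real.pi * t := by positivity
  have hq : ((Real.pi : ℂ) / ((1 / (4 * t) : ℝ) : ℂ)) ^ ((Module.finrank ℝ (Space d) : ℂ) / 2) =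
      (((4 * Real.pi * t) ^ ((d : ℝ) / 2) : ℝ) : ℂ) := by
    rw [Complex.ofReal_cpow hp.le, finrank_euclideanSpace_fin]
    congr 1
    · push_cast
      field_simp
    · push_cast
      rfl
  rw [hq, ← mul_assoc, ← Complex.ofReal_mul, ← Real.rpow_add hp]
  have : -(d : ℝ) / 2 + (d : ℝ) / 2 = 0 := by ring
  rw [this, Real.rpow_zero, Complex.ofReal_one, one_mul, Complex.ofReal_exp]
  congr 1
  push_cast
  field_simp
  ring

theorem integrable_gaussKernel (d : ℕ) {t : ℝ} (ht : 0 < t) :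
    Integrable (gaussKernel d t) volume := by
  have hb : 0 < ((1 / (4 * t) : ℝ) : ℂ).re := by
    rw [Complex.ofReal_re]
    positivity
  have h := GaussianFourier.integrable_cexp_neg_mul_sq_norm_add (V := Space d) hb 0 0
  have h2 := h.re.const_mul ((4 * Real.pi * t) ^ (-(d : ℝ) / 2))
  refine h2.congr (Eventually.of_forall fun x => ?_)
  have e : (-((1 / (4 * t) : ℝ) : ℂ) * (‖x‖ : ℂ) ^ 2 + 0 * (inner ℝ (0 : Space d) x : ℂ)) =
      ((-‖x‖ ^ 2 / (4 * t) : ℝ) : ℂ) := by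
    push_cast
    ring
  simp only [gaussKernel]
  rw [e, ← Complex.ofReal_exp]
  rfl

theorem integral_gaussKernel (d : ℕ) {t : ℝ} (ht : 0 < t) :
    ∫ x, gaussKernel d t x = 1 := by
  have h := fourier_gaussKernel d ht 0
  rw [Real.fourier_eq] at h
  simp only [inner_zero_right, neg_zero, AddChar.map_zero_eq_one, one_smul, norm_zero, mul_zero,
    ne_eq, OfNat.ofNat_ne_zero, not_false_eq_true, zero_pow, zero_mul, Real.exp_zero] at h
  rw [integral_complex_ofReal] at h
  exact Complex.ofReal_injective h

theorem integral_gammaWeight {s : ℝ} (hs : 0 < s) {r : ℝ} (hr : 0 ≤ r) :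
    ∫ t in Set.Ioi (0 : ℝ), gammaWeight s t * Real.exp (-(r * t)) = (1 + r) ^ (-s / 2) := by
  have h := Real.integral_rpow_mul_exp_neg_mul_Ioi (half_pos hs) (show 0 < 1 + r by linarith)
  have e : ∀ t : ℝ, gammaWeight s t * Real.exp (-(r * t)) =
      (Real.Gamma (s / 2))⁻¹ * (t ^ (s / 2 - 1) * Real.exp (-((1 + r) * t))) := by
    intro t
    have : -((1 + r) * t) = -t + -(r * t) := by ring
    rw [gammaWeight, this, Real.exp_add]
    ring
  simp_rw [e]
  rw [integral_const_mul, h]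
  have hG := (Real.Gamma_pos_of_pos (half_pos hs)).ne'
  rw [one_div, Real.inv_rpow (by linarith), ← Real.rpow_neg (by linarith), neg_div]
  field_simp

theorem integrable_gammaWeight {s : ℝ} (hs : 0 < s) :
    IntegrableOn (gammaWeight s) (Set.Ioi 0) volume := by
  have h := (Real.GammaIntegral_convergent (half_pos hs)).const_mul (Real.Gamma (s / 2))⁻¹
  refine IntegrableOn.congr_fun h (fun t _ => ?_) measurableSet_Ioi
  simp only [gammaWeight]
  ring

theorem measurable_besselIntegrand (d : ℕ) (s : ℝ) :
    Measurable (fun p : Space d × ℝ => gammaWeight s p.2 * gaussKernel d p.2 p.1) := by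
  unfold gammaWeight gaussKernel
  fun_prop

theorem integrable_besselIntegrand (d : ℕ) {s : ℝ} (hs : 0 < s) :
    Integrable (fun p : Space d × ℝ => gammaWeight s p.2 * gaussKernel d p.2 p.1)
      (volume.prod (volume.restrict (Set.Ioi 0))) := by
  rw [integrable_prod_iff' (measurable_besselIntegrand d s).aestronglyMeasurable]
  constructor
  · filter_upwards [ae_restrict_mem measurableSet_Ioi] with t ht
    exact (integrable_gaussKernel d ht).const_mul _
  · refine (integrable_gammaWeight hs).congr ?_
    filter_upwards [ae_restrict_mem measurableSet_Ioi] with t ht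
    have : ∀ x : Space d, ‖gammaWeight s t * gaussKernel d t x‖ =
        gammaWeight s t * gaussKernel d t x := fun x =>
      Real.norm_of_nonneg (mul_nonneg (gammaWeight_nonneg hs ht) (gaussKernel_nonneg d ht x))
    simp_rw [this]
    rw [integral_const_mul, integral_gaussKernel d ht, mul_one]

theorem toReal_besselKernel (d : ℕ) {s : ℝ} (hs : 0 < s) (x : Space d) :
    (besselKernel d s x).toReal =
      ∫ t in Set.Ioi (0 : ℝ), gammaWeight s t * gaussKernel d t x := by
  rw [integral_eq_lintegral_of_nonneg_ae]
  · rfl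
  · filter_upwards [ae_restrict_mem measurableSet_Ioi] with t ht
    exact mul_nonneg (gammaWeight_nonneg hs ht) (gaussKernel_nonneg d ht x)
  · exact ((measurable_besselIntegrand d s).comp
      (measurable_const.prodMk measurable_id : Measurable fun t : ℝ => (x, t))).aestronglyMeasurable

/-- The Bessel kernel has total mass one. -/
theorem lintegral_besselKernel (d : ℕ) {s : ℝ} (hs : 0 < s) :
    ∫⁻ x, besselKernel d s x = 1 := by
  unfold besselKernel
  rw [lintegral_lintegral_swap (measurable_besselIntegrand d s).ennreal_ofReal.aemeasurable]
  have e : ∀ᵐ t : ℝ ∂(volume.restrict (Set.Ioi 0)),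
      ∫⁻ x, ENNReal.ofReal (gammaWeight s t * gaussKernel d t x) =
        ENNReal.ofReal (gammaWeight s t) := by
    filter_upwards [ae_restrict_mem measurableSet_Ioi] with t ht
    rw [← ofReal_integral_eq_lintegral_ofReal ((integrable_gaussKernel d ht).const_mul _)
      (Eventually.of_forall fun x =>
        mul_nonneg (gammaWeight_nonneg hs ht) (gaussKernel_nonneg d ht x)),
      integral_const_mul, integral_gaussKernel d ht, mul_one]
  rw [lintegral_congr_ae e, ← ofReal_integral_eq_lintegral_ofReal (integrable_gammaWeight hs)]
  · have := integral_gammaWeight hs le_rfl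
    simp only [zero_mul, neg_zero, Real.exp_zero, mul_one, add_zero, Real.one_rpow] at this
    rw [this, ENNReal.ofReal_one]
  · filter_upwards [ae_restrict_mem measurableSet_Ioi] with t ht
    exact gammaWeight_nonneg hs ht

/-- The Fourier transform of the Bessel kernel is `(1 + |ξ|²)^{-s/2}`, where the angular frequency
is `2πξ` in Mathlib's normalization. -/
theorem fourier_besselKernel (d : ℕ) {s : ℝ} (hs : 0 < s) (ξ : Space d) :
    𝓕 (fun x : Space d => ((besselKernel d s x).toReal : ℂ)) ξ =
      (((1 + (2 * Real.pi * ‖ξ‖) ^ 2) ^ (-s / 2) : ℝ) : ℂ) := by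
  rw [Real.fourier_eq]
  have e : ∀ x : Space d, Real.fourierChar (-inner ℝ x ξ) • ((besselKernel d s x).toReal : ℂ) =
      ∫ t in Set.Ioi (0 : ℝ), Real.fourierChar (-inner ℝ x ξ) •
        ((gammaWeight s t * gaussKernel d t x : ℝ) : ℂ) := by
    intro x
    rw [toReal_besselKernel d hs, ← integral_complex_ofReal]
    simp only [Circle.smul_def]
    rw [integral_smul]
  simp_rw [e]
  rw [integral_integral_swap]
  · have e2 : ∀ᵐ t : ℝ ∂(volume.restrict (Set.Ioi 0)),
        ∫ x : Space d, Real.fourierChar (-inner ℝ x ξ) •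
          ((gammaWeight s t * gaussKernel d t x : ℝ) : ℂ) =
        ((gammaWeight s t * Real.exp (-((2 * Real.pi * ‖ξ‖) ^ 2 * t)) : ℝ) : ℂ) := by
      filter_upwards [ae_restrict_mem measurableSet_Ioi] with t ht
      have h := fourier_gaussKernel d ht ξ
      rw [Real.fourier_eq] at h
      rw [Complex.ofReal_mul, ← h, ← integral_const_mul]
      congr 1
      ext x
      simp only [Circle.smul_def, smul_eq_mul]
      push_cast
      ring
    rw [integral_congr_ae e2, integral_complex_ofReal, integral_gammaWeight hs (sq_nonneg _)]
  · have hc : Continuous fun p : Space d × ℝ => (Real.fourierChar (-inner ℝ p.1 ξ) : ℂ) := by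
      have := Real.continuous_fourierChar
      fun_prop
    refine (integrable_besselIntegrand d hs).mono ?_ ?_
    · simp only [Function.uncurry_def, Circle.smul_def, smul_eq_mul]
      exact hc.aestronglyMeasurable.mul
        (Complex.measurable_ofReal.comp (measurable_besselIntegrand d s)).aestronglyMeasurable
    · refine Eventually.of_forall fun p => ?_
      simp only [Function.uncurry_def, Circle.norm_smul, Complex.norm_real, le_refl]

/-- The Bessel potential `𝒢_s f = γ_s * f`, for nonnegative `f ∈ L²(ℝᵈ)`, as a `[0, ∞]`-valued
function defined at every point. -/
def besselPotential (d : ℕ) (s : ℝ) (f : L2 d) (x : Space d) : ℝ≥0∞ :=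
  ∫⁻ y, besselKernel d s (x - y) * ENNReal.ofReal (f y)

/-- The `(s, 2)`-capacity of `E`: the infimum of `‖f‖²_{L²}` over all nonnegative `f ∈ L²(ℝᵈ)`
with `𝒢_s f ≥ 1` everywhere on `E` (and `∞` if there is no such `f`). -/
def besselCapacity (d : ℕ) (s : ℝ) (E : Set (Space d)) : ℝ≥0∞ :=
  ⨅ f ∈ {f : L2 d | 0 ≤ f ∧ ∀ x ∈ E, 1 ≤ besselPotential d s f x}, ENNReal.ofReal (‖f‖ ^ 2)

end MarkovUniqueness

end

noncomputable section

namespace MarkovUniqueness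

/-! ### The Fourier transform on real-valued functions and Fourier multipliers -/

/-! Write L = (-Δ)^{α/2} and T = (1 + L)^{-1/2} (`formMap`). T carries L² isometrically onto the
form domain of L with its form norm (`enorm_sq_eq_form`), so a closed form domain inside it is T(M)
for a closed subspace M of L². Testing the form equation against T(M) shows that the associated
resolvent is T P_M T, with P_M the orthogonal projection (`formRes`). The associated operator is 1 -
(T P_M T)⁻¹ (`genOf`). It is self-adjoint, and it generates a Markov semigroup if truncation to [0,
1] maps T(M) into itself (`exists_isMarkovSemigroup_formRes`). The semigroup comes from the Yosida
approximations, whose exponentials are Poisson averages of powers of resolvents and so preserve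
closed convex sets (`IsSymmResolvent.exists_semigroup`).

Two choices of M always give Markov extensions of -L on the test functions off Σ: the whole of L²,
and `minForm`, for which T(M) is the closure of the test functions. If the extension is unique,
these agree and the test functions off Σ are dense in the form domain. A smooth function equal to 1
near Σ is then a limit of functions vanishing near Σ, and the differences equal 1 near Σ and have
small form norm. They are Bessel potentials of functions that are small in L². After a positive part
and a mollification these are admissible for the capacity, which is therefore zero
(`besselCapacity_eq_zero_of_minForm_eq_top`).

Conversely, let the capacity vanish and let A be a Markov extension. For 0 ≤ f ≤ 1 the function u =
(1 - A)⁻¹ f satisfies 0 ≤ u ≤ 1 (`IsMarkovSemigroup.resolvent_mem`) and solves u + Lu = f weakly off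
Σ. Such a bounded solution is global (`hasFracLap_of_weak`). Indeed, zero capacity provides cutoffs
w equal to 1 near Σ with small norm and energy. Testing with uφ², φ = χ(1 - w), χ a cutoff at
infinity, bounds the energy of uφ uniformly, because u is bounded; hence u has finite energy. Then
in g = g(1 - w) + gw, for any test function g, the second term is negligible by the Cauchy–Schwarz
inequality, and the equation holds against every g. Thus (1 - A)⁻¹ = (1 + L)⁻¹ on functions with
values in [0, 1], which span a dense subspace, and A = -L.

The nonlocal estimates rest on writing twice the energy as a limit of averages of ‖u - u(· - y)‖²
over measures in y (`IsLevyApprox`). Truncations and products are then handled by pointwise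
inequalities between increments, for all 0 < α ≤ 2 at once. -/

theorem coeFn_complexify (d : ℕ) (u : L2 d) : complexify d u =ᵐ[volume] fun x => (u x : ℂ) :=
  ContinuousLinearMap.coeFn_compLpL (p := 2) (μ := volume) Complex.ofRealCLM u

theorem coeFn_realPart (d : ℕ) (u : L2C d) : realPart d u =ᵐ[volume] fun x => (u x).re :=
  ContinuousLinearMap.coeFn_compLpL (p := 2) (μ := volume) Complex.reCLM u

theorem norm_complexify (d : ℕ) (u : L2 d) : ‖complexify d u‖ = ‖u‖ := by
  rw [Lp.norm_def, Lp.norm_def]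
  congr 1
  refine eLpNorm_congr_norm_ae ?_
  filter_upwards [coeFn_complexify d u] with x hx
  rw [hx, Complex.norm_real]

theorem measurePreserving_neg_space (d : ℕ) :
    MeasurePreserving (fun x : Space d => -x) volume volume :=
  Measure.measurePreserving_neg _

/-- Pointwise complex conjugation. -/
def conjL (d : ℕ) : L2C d →L[ℝ] L2C d := (Complex.conjCLE : ℂ →L[ℝ] ℂ).compLpL 2 volume

/-- Reflection at the origin. -/
def reflL (d : ℕ) : L2C d → L2C d :=
  Lp.compMeasurePreserving (fun x : Space d => -x) (measurePreserving_neg_space d)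

theorem coeFn_conjL (d : ℕ) (f : L2C d) :
    conjL d f =ᵐ[volume] fun x => (starRingEnd ℂ) (f x) :=
  ContinuousLinearMap.coeFn_compLpL _ f

theorem coeFn_reflL (d : ℕ) (f : L2C d) : reflL d f =ᵐ[volume] fun x => f (-x) :=
  Lp.coeFn_compMeasurePreserving f (measurePreserving_neg_space d)

/-- Conjugating the kernel exp(-2πi⟨v, ξ⟩) replaces ξ by -ξ. This is computed on Schwartz functions
and extended by density, since both sides are continuous in f. -/
theorem fourier_conjL (d : ℕ) (f : L2C d) :
    (𝓕 (conjL d f) : L2C d) = reflL d (conjL d (𝓕 f)) := by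
  have mp := measurePreserving_neg_space d
  have hRc : Continuous (reflL d) := (Lp.isometry_compMeasurePreserving mp).continuous
  have hFc : Continuous (fun f : L2C d => (𝓕 f : L2C d)) :=
    (Lp.fourierTransformₗᵢ (Space d) ℂ).continuous
  refine (SchwartzMap.denseRange_toLpCLM (E := Space d) (F := ℂ) (p := 2) (μ := volume)
    ENNReal.ofNat_ne_top).induction_on
    (p := fun f : L2C d => (𝓕 (conjL d f) : L2C d) = reflL d (conjL d (𝓕 f))) f ?_ ?_
  · exact isClosed_eq (hFc.comp (conjL d).continuous)
      (hRc.comp ((conjL d).continuous.comp hFc))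
  · intro ψ
    let ψ' := ψ.postcompCLM (Complex.conjCLE : ℂ →L[ℝ] ℂ)
    have h1 : conjL d (ψ.toLp 2) = ψ'.toLp 2 := by
      apply Lp.ext
      filter_upwards [coeFn_conjL d (ψ.toLp 2), ψ.coeFn_toLp 2 volume, ψ'.coeFn_toLp 2 volume]
        with x h1 h2 h3
      rw [h1, h2, h3]
      rfl
    rw [SchwartzMap.toLpCLM_apply, h1, SchwartzMap.toLp_fourier_eq, SchwartzMap.toLp_fourier_eq]
    apply Lp.ext
    have e1 := coeFn_conjL d ((𝓕 ψ).toLp 2)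
    have e2 := (𝓕 ψ).coeFn_toLp 2 volume
    filter_upwards [coeFn_reflL d (conjL d ((𝓕 ψ).toLp 2)), mp.quasiMeasurePreserving.ae e1,
      mp.quasiMeasurePreserving.ae e2, (𝓕 ψ').coeFn_toLp 2 volume] with x h1 h2 h3 h4
    rw [h1, h2, h3, h4, SchwartzMap.fourier_coe, SchwartzMap.fourier_coe, Real.fourier_eq',
      Real.fourier_eq', ← integral_conj]
    congr 1
    ext v
    have : ψ' v = (starRingEnd ℂ) (ψ v) := rfl
    rw [this, smul_eq_mul, smul_eq_mul, map_mul, ← Complex.exp_conj]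
    congr 2
    simp only [Complex.ofReal_neg, Complex.ofReal_mul, Complex.ofReal_ofNat, map_mul, map_neg,
      map_ofNat, Complex.conj_ofReal, Complex.conj_I, inner_neg_right]
    ring

/-- The Fourier transform as a real-linear isometry from real-valued to complex-valued
square integrable functions. -/
def hat (d : ℕ) : L2 d →ₗᵢ[ℝ] L2C d where
  toFun u := 𝓕 (complexify d u)
  map_add' u v := by rw [map_add, FourierTransform.fourier_add]
  map_smul' c u := by
    have : complexify d (c • u) = (c : ℂ) • complexify d u := by
      rw [map_smul]
      rfl
    rw [this, FourierTransform.fourier_smul]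
    rfl
  norm_map' u := by
    change ‖(𝓕 (complexify d u) : L2C d)‖ = ‖u‖
    rw [Lp.norm_fourier_eq, norm_complexify]

theorem hat_apply (d : ℕ) (u : L2 d) : hat d u = (𝓕 (complexify d u) : L2C d) := rfl

/-- A real function is fixed by conjugation, so its transform is fixed by conjugation followed by
reflection. Even real symbols preserve this symmetry; this is why multipliers act on the real space.
-/
theorem hat_neg_ae (d : ℕ) (u : L2 d) :
    ∀ᵐ ξ, hat d u (-ξ) = (starRingEnd ℂ) (hat d u ξ) := by
  have mp := measurePreserving_neg_space d
  have hCu : conjL d (complexify d u) = complexify d u := by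
    apply Lp.ext
    filter_upwards [coeFn_conjL d (complexify d u), coeFn_complexify d u] with x h1 h2
    rw [h1, h2, Complex.conj_ofReal]
  have k := fourier_conjL d (complexify d u)
  rw [hCu] at k
  have e0 := coeFn_reflL d (conjL d (hat d u))
  rw [hat_apply, ← k] at e0
  filter_upwards [mp.quasiMeasurePreserving.ae e0,
    coeFn_conjL d (hat d u)] with ξ h1 h2
  rw [hat_apply, h1, neg_neg]
  exact h2

/-- The range of `hat` consists of the hermitian functions. -/
theorem exists_hat_ae_eq (d : ℕ) {g : Space d → ℂ} (hg : MemLp g 2 volume)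
    (h : ∀ᵐ ξ, g (-ξ) = (starRingEnd ℂ) (g ξ)) : ∃ u : L2 d, hat d u =ᵐ[volume] g := by
  have mp := measurePreserving_neg_space d
  set G : L2C d := hg.toLp g
  have hG : G =ᵐ[volume] g := hg.coeFn_toLp
  have hRCg : reflL d (conjL d G) = G := by
    apply Lp.ext
    filter_upwards [coeFn_reflL d (conjL d G), mp.quasiMeasurePreserving.ae (coeFn_conjL d G),
      mp.quasiMeasurePreserving.ae hG, hG, h] with x h1 h2 h3 h4 h5
    rw [h1, h2, h3, h4, h5, Complex.conj_conj]
  have hw : conjL d (𝓕⁻ G : L2C d) = (𝓕⁻ G : L2C d) := by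
    have k := fourier_conjL d (𝓕⁻ G : L2C d)
    rw [fourier_fourierInv_eq, hRCg] at k
    exact (fourierInv_fourier_eq (conjL d (𝓕⁻ G : L2C d))).symm.trans (congrArg _ k)
  refine ⟨realPart d (𝓕⁻ G), ?_⟩
  have : complexify d (realPart d (𝓕⁻ G)) = (𝓕⁻ G : L2C d) := by
    have e1 := coeFn_conjL d (𝓕⁻ G : L2C d)
    rw [hw] at e1
    apply Lp.ext
    filter_upwards [coeFn_complexify d (realPart d (𝓕⁻ G)), coeFn_realPart d (𝓕⁻ G), e1]
      with x h1 h2 h3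
    rw [h1, h2]
    exact Complex.conj_eq_iff_re.mp h3.symm
  rw [hat_apply, this, fourier_fourierInv_eq]
  exact hG

theorem hat_injective (d : ℕ) : Function.Injective (hat d) := (hat d).injective

theorem eq_of_hat_ae_eq {d : ℕ} {u v : L2 d} (h : hat d u =ᵐ[volume] hat d v) : u = v :=
  hat_injective d (Lp.ext h)

theorem hat_add_ae (d : ℕ) (u v : L2 d) :
    hat d (u + v) =ᵐ[volume] fun ξ => hat d u ξ + hat d v ξ := by
  rw [map_add]
  exact Lp.coeFn_add _ _

theorem hat_sub_ae (d : ℕ) (u v : L2 d) :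
    hat d (u - v) =ᵐ[volume] fun ξ => hat d u ξ - hat d v ξ := by
  rw [map_sub]
  exact Lp.coeFn_sub _ _

theorem hat_smul_ae (d : ℕ) (c : ℝ) (u : L2 d) :
    hat d (c • u) =ᵐ[volume] fun ξ => (c : ℂ) * hat d u ξ := by
  rw [map_smul]
  filter_upwards [Lp.coeFn_smul c (hat d u)] with ξ hξ
  rw [hξ]
  rfl

/-- Plancherel's theorem. -/
theorem inner_eq_integral_hat (d : ℕ) (u v : L2 d) :
    inner ℝ u v = ∫ ξ, inner ℝ (hat d u ξ) (hat d v ξ) := by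
  rw [← (hat d).inner_map_map, L2.inner_def]

/-- A bounded measurable even real-valued function on the frequency space. -/
structure Symbol (d : ℕ) where
  toFun : Space d → ℝ
  measurable : Measurable toFun
  even : ∀ ξ, toFun (-ξ) = toFun ξ
  bounded : ∃ C, ∀ ξ, |toFun ξ| ≤ C

instance (d : ℕ) : CoeFun (Symbol d) fun _ => Space d → ℝ := ⟨Symbol.toFun⟩

/-- Only square integrability of the product is required, so the symbol may be unbounded;
`exists_formMap_eq` uses it with √(1 + |ξ|^α). -/
theorem exists_hat_eq_mul {d : ℕ} {m : Space d → ℝ}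
    (he : ∀ ξ, m (-ξ) = m ξ) {u : L2 d} (h : MemLp (fun ξ => (m ξ : ℂ) * hat d u ξ) 2 volume) :
    ∃ v : L2 d, hat d v =ᵐ[volume] fun ξ => (m ξ : ℂ) * hat d u ξ := by
  refine exists_hat_ae_eq d h ?_
  filter_upwards [hat_neg_ae d u] with ξ hξ
  rw [hξ, he, map_mul, Complex.conj_ofReal]

theorem Symbol.exists_mult {d : ℕ} (m : Symbol d) (u : L2 d) :
    ∃ v : L2 d, hat d v =ᵐ[volume] fun ξ => (m ξ : ℂ) * hat d u ξ := by
  obtain ⟨C, hC⟩ := m.bounded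
  refine exists_hat_eq_mul m.even ?_
  refine MemLp.of_le_mul (c := C) (Lp.memLp (hat d u)) ?_ ?_
  · exact (Complex.measurable_ofReal.comp m.measurable).aestronglyMeasurable.mul
      (Lp.aestronglyMeasurable _)
  · refine Eventually.of_forall fun ξ => ?_
    rw [norm_mul, Complex.norm_real]
    exact mul_le_mul_of_nonneg_right (hC ξ) (norm_nonneg _)

theorem norm_le_of_hat {d : ℕ} {u v : L2 d} {C : ℝ}
    (h : ∀ᵐ ξ, ‖hat d v ξ‖ ≤ C * ‖hat d u ξ‖) : ‖v‖ ≤ C * ‖u‖ := by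
  rw [← (hat d).norm_map u, ← (hat d).norm_map v]
  exact Lp.norm_le_mul_norm_of_ae_le_mul h

/-- The Fourier multiplier operator on real-valued functions. -/
def mult {d : ℕ} (m : Symbol d) : L2 d →L[ℝ] L2 d :=
  LinearMap.mkContinuousOfExistsBound
    { toFun := fun u => (m.exists_mult u).choose
      map_add' := fun u v => by
        apply eq_of_hat_ae_eq
        filter_upwards [(m.exists_mult (u + v)).choose_spec, (m.exists_mult u).choose_spec,
          (m.exists_mult v).choose_spec, hat_add_ae d u v,
          hat_add_ae d (m.exists_mult u).choose (m.exists_mult v).choose] with ξ h1 h2 h3 h4 h5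
        rw [h1, h5, h2, h3, h4, mul_add]
      map_smul' := fun c u => by
        apply eq_of_hat_ae_eq
        filter_upwards [(m.exists_mult (c • u)).choose_spec, (m.exists_mult u).choose_spec,
          hat_smul_ae d c u, hat_smul_ae d c (m.exists_mult u).choose] with ξ h1 h2 h3 h4
        rw [RingHom.id_apply, h1, h4, h2, h3]
        ring }
    (by
      obtain ⟨C, hC⟩ := m.bounded
      refine ⟨C, fun u => norm_le_of_hat ?_⟩
      filter_upwards [(m.exists_mult u).choose_spec] with ξ h1
      refine (congrArg norm h1).le.trans ?_
      rw [norm_mul, Complex.norm_real]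
      exact mul_le_mul_of_nonneg_right (hC ξ) (norm_nonneg _))

theorem hat_mult {d : ℕ} (m : Symbol d) (u : L2 d) :
    hat d (mult m u) =ᵐ[volume] fun ξ => (m ξ : ℂ) * hat d u ξ :=
  (m.exists_mult u).choose_spec

theorem mult_eq_of_hat {d : ℕ} (m : Symbol d) {u v : L2 d}
    (h : hat d v =ᵐ[volume] fun ξ => (m ξ : ℂ) * hat d u ξ) : mult m u = v :=
  eq_of_hat_ae_eq ((hat_mult m u).trans h.symm)

theorem inner_mult_left {d : ℕ} (m : Symbol d) (u v : L2 d) :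
    inner ℝ (mult m u) v = inner ℝ u (mult m v) := by
  rw [inner_eq_integral_hat, inner_eq_integral_hat]
  refine integral_congr_ae ?_
  filter_upwards [hat_mult m u, hat_mult m v] with ξ h1 h2
  rw [h1, h2]
  simp only [Complex.inner, map_mul, Complex.conj_ofReal]
  congr 1
  ring

theorem mult_comm {d : ℕ} (m n : Symbol d) (u : L2 d) :
    mult m (mult n u) = mult n (mult m u) := by
  apply eq_of_hat_ae_eq
  filter_upwards [hat_mult m u, hat_mult n u, hat_mult m (mult n u), hat_mult n (mult m u)]
    with ξ h1 h2 h3 h4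
  rw [h3, h4, h1, h2]
  ring

theorem norm_mult_le {d : ℕ} (m : Symbol d) {C : ℝ} (h : ∀ ξ, |m ξ| ≤ C) (u : L2 d) :
    ‖mult m u‖ ≤ C * ‖u‖ := by
  refine norm_le_of_hat ?_
  filter_upwards [hat_mult m u] with ξ h1
  rw [h1, norm_mul, Complex.norm_real]
  exact mul_le_mul_of_nonneg_right (h ξ) (norm_nonneg _)

theorem mult_injective {d : ℕ} (m : Symbol d) (h : ∀ ξ, m ξ ≠ 0) :
    Function.Injective (mult m) := by
  rw [injective_iff_map_eq_zero]
  intro u hu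
  apply eq_of_hat_ae_eq
  have h1 := hat_mult m u
  rw [hu, map_zero] at h1
  rw [map_zero]
  filter_upwards [h1, Lp.coeFn_zero ℂ 2 (volume : Measure (Space d))] with ξ h1 h2
  rw [h2] at h1 ⊢
  simpa [h ξ] using h1.symm

theorem enorm_sq_eq_lintegral {d : ℕ} {F : Type*} [NormedAddCommGroup F]
    (u : Lp F 2 (volume : Measure (Space d))) : ‖u‖ₑ ^ 2 = ∫⁻ x, ‖u x‖ₑ ^ 2 := by
  rw [Lp.enorm_def, eLpNorm_eq_lintegral_rpow_enorm_toReal two_ne_zero ENNReal.ofNat_ne_top]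
  simp only [ENNReal.toReal_ofNat, ENNReal.rpow_ofNat]
  rw [← ENNReal.rpow_natCast, ← ENNReal.rpow_mul]
  norm_num

theorem enorm_sq_eq_lintegral_hat {d : ℕ} (u : L2 d) : ‖u‖ₑ ^ 2 = ∫⁻ ξ, ‖hat d u ξ‖ₑ ^ 2 := by
  rw [← enorm_sq_eq_lintegral, (hat d).enorm_map]

/-- Multipliers whose symbols converge boundedly to `1` converge strongly to the identity. -/
theorem tendsto_mult {d : ℕ} {m : ℕ → Symbol d} (hb : ∀ k ξ, |m k ξ| ≤ 1)
    (hl : ∀ ξ, Tendsto (fun k => m k ξ) atTop (𝓝 1)) (u : L2 d) :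
    Tendsto (fun k => mult (m k) u) atTop (𝓝 u) := by
  rw [tendsto_iff_edist_tendsto_0]
  have key : Tendsto (fun k => ∫⁻ ξ, ‖((m k ξ : ℂ) - 1) * hat d u ξ‖ₑ ^ 2) atTop (𝓝 0) := by
    have hz : (0 : ℝ≥0∞) = ∫⁻ _ : Space d, 0 := by simp
    rw [hz]
    refine tendsto_lintegral_of_dominated_convergence' (fun ξ => 4 * ‖hat d u ξ‖ₑ ^ 2) ?_ ?_ ?_ ?_
    · intro k
      have := (Complex.measurable_ofReal.comp (m k).measurable).aestronglyMeasurable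
        (μ := (volume : Measure (Space d)))
      exact ((this.sub aestronglyMeasurable_const).mul (Lp.aestronglyMeasurable _)).enorm.pow_const 2
    · intro k
      refine Eventually.of_forall fun ξ => ?_
      simp only [enorm_mul, mul_pow]
      gcongr
      have : ‖((m k ξ : ℂ) - 1)‖ₑ ≤ 2 := by
        rw [← ofReal_norm, show (2 : ℝ≥0∞) = ENNReal.ofReal 2 by simp]
        refine ENNReal.ofReal_le_ofReal ((norm_sub_le _ _).trans ?_)
        rw [Complex.norm_real, norm_one]
        have := hb k ξ
        rw [← Real.norm_eq_abs] at this
        linarith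
      calc _ ≤ (2 : ℝ≥0∞) ^ 2 := by gcongr
        _ = 4 := by norm_num
    · rw [lintegral_const_mul' _ _ (by simp), ← enorm_sq_eq_lintegral_hat]
      exact ENNReal.mul_ne_top (by simp) (by simp)
    · refine Eventually.of_forall fun ξ => ?_
      have h1 : Tendsto (fun k => ((m k ξ : ℂ) - 1) * hat d u ξ) atTop (𝓝 0) := by
        have := (((Complex.continuous_ofReal.tendsto 1).comp (hl ξ)).sub_const 1).mul_const
          (hat d u ξ)
        simpa using this
      have := ENNReal.Tendsto.pow (n := 2) h1.enorm
      simpa using this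
  have h2 : ∀ k, edist (mult (m k) u) u ^ 2 = ∫⁻ ξ, ‖((m k ξ : ℂ) - 1) * hat d u ξ‖ₑ ^ 2 := by
    intro k
    rw [edist_eq_enorm_sub, enorm_sq_eq_lintegral_hat]
    refine lintegral_congr_ae ?_
    filter_upwards [hat_sub_ae d (mult (m k) u) u, hat_mult (m k) u] with ξ h1 h2
    rw [h1, h2, sub_mul, one_mul]
  simp_rw [← h2] at key
  have h3 := key.ennrpow_const (1 / 2)
  have h4 : ∀ k, (edist (mult (m k) u) u ^ 2) ^ (1 / 2 : ℝ) = edist (mult (m k) u) u := by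
    intro k
    rw [← ENNReal.rpow_natCast, ← ENNReal.rpow_mul]
    norm_num
  simp_rw [h4] at h3
  simpa using h3

/-! ### Translations and the energy form -/

theorem coeFn_compSub {d : ℕ} {F : Type*} [NormedAddCommGroup F] (y : Space d)
    (f : Lp F 2 (volume : Measure (Space d))) :
    Lp.compMeasurePreserving (fun x : Space d => x - y) (measurePreserving_sub_right volume y) f
      =ᵐ[volume] fun x => f (x - y) :=
  Lp.coeFn_compMeasurePreserving f _

/-- The translation `u ↦ u (· - y)`. -/
def transl {d : ℕ} (y : Space d) : L2 d → L2 d :=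
  Lp.compMeasurePreserving (fun x : Space d => x - y) (measurePreserving_sub_right volume y)

theorem coeFn_transl {d : ℕ} (y : Space d) (u : L2 d) :
    transl y u =ᵐ[volume] fun x => u (x - y) := coeFn_compSub y u

theorem fourierChar_neg_inner_eq {d : ℕ} (y ξ : Space d) :
    (Real.fourierChar (-inner ℝ y ξ) : ℂ) =
      Complex.exp ((-(2 * Real.pi * inner ℝ y ξ) : ℝ) * Complex.I) := by
  rw [Real.fourierChar_apply]
  congr 2
  push_cast
  ring

theorem measurable_fourierChar_inner {d : ℕ} :
    Measurable fun p : Space d × Space d => (Real.fourierChar (-inner ℝ p.1 p.2) : ℂ) := by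
  have := Real.continuous_fourierChar
  exact Continuous.measurable (by fun_prop)

theorem memLp_fourierChar_mul {d : ℕ} (y : Space d) (f : L2C d) :
    MemLp (fun ξ => (Real.fourierChar (-inner ℝ y ξ) : ℂ) * f ξ) 2 volume := by
  refine (Lp.memLp f).of_le ?_ (Eventually.of_forall fun ξ => ?_)
  · exact (measurable_fourierChar_inner.comp measurable_prodMk_left).aestronglyMeasurable.mul
      (Lp.aestronglyMeasurable _)
  · rw [norm_mul, Circle.norm_coe, one_mul]

/-- On Schwartz functions this is a change of variables. It extends by density because translation
and multiplication by a unimodular character are both isometries. -/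
theorem fourier_compSub {d : ℕ} (y : Space d) (f : L2C d) :
    (𝓕 (Lp.compMeasurePreserving (fun x : Space d => x - y)
      (measurePreserving_sub_right volume y) f : L2C d) : L2C d) =
      (memLp_fourierChar_mul y (𝓕 f)).toLp _ := by
  have hFc : Continuous (fun f : L2C d => (𝓕 f : L2C d)) :=
    (Lp.fourierTransformₗᵢ (Space d) ℂ).continuous
  have hM : Continuous fun g : L2C d => (memLp_fourierChar_mul y g).toLp _ := by
    refine Isometry.continuous (Isometry.of_dist_eq fun g h => ?_)
    rw [dist_eq_norm, dist_eq_norm, Lp.norm_def, Lp.norm_def]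
    congr 1
    refine eLpNorm_congr_norm_ae ?_
    filter_upwards [Lp.coeFn_sub ((memLp_fourierChar_mul y g).toLp _)
      ((memLp_fourierChar_mul y h).toLp _), Lp.coeFn_sub g h,
      (memLp_fourierChar_mul y g).coeFn_toLp, (memLp_fourierChar_mul y h).coeFn_toLp]
      with ξ h1 h2 h3 h4
    rw [h1, h2, Pi.sub_apply, Pi.sub_apply, h3, h4, ← mul_sub, norm_mul, Circle.norm_coe, one_mul]
  refine (SchwartzMap.denseRange_toLpCLM (E := Space d) (F := ℂ) (p := 2) (μ := volume)
    ENNReal.ofNat_ne_top).induction_on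
    (p := fun f : L2C d => (𝓕 (Lp.compMeasurePreserving (fun x : Space d => x - y)
      (measurePreserving_sub_right volume y) f : L2C d) : L2C d) =
      (memLp_fourierChar_mul y (𝓕 f)).toLp _) f ?_ ?_
  · exact isClosed_eq (hFc.comp (Lp.isometry_compMeasurePreserving _).continuous) (hM.comp hFc)
  · intro ψ
    let ψ' := SchwartzMap.compSubConstCLM ℂ y ψ
    have h1 : Lp.compMeasurePreserving (fun x : Space d => x - y)
      (measurePreserving_sub_right volume y) (ψ.toLp 2) = ψ'.toLp 2 := by
      apply Lp.ext
      filter_upwards [coeFn_compSub y (ψ.toLp 2), ψ'.coeFn_toLp 2 volume,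
        (measurePreserving_sub_right volume y).quasiMeasurePreserving.ae (ψ.coeFn_toLp 2 volume)]
        with x h1 h2 h3
      rw [h1, h2, h3]
      exact (SchwartzMap.compSubConstCLM_apply ψ y x).symm
    rw [SchwartzMap.toLpCLM_apply, h1, SchwartzMap.toLp_fourier_eq]
    apply Lp.ext
    refine ((𝓕 ψ').coeFn_toLp 2 volume).trans
      (EventuallyEq.trans ?_ (memLp_fourierChar_mul y _).coeFn_toLp.symm)
    rw [SchwartzMap.toLp_fourier_eq]
    filter_upwards [(𝓕 ψ).coeFn_toLp 2 volume] with ξ h2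
    rw [h2, SchwartzMap.fourier_coe, SchwartzMap.fourier_coe, Real.fourier_eq, Real.fourier_eq,
      ← integral_const_mul]
    have e := integral_sub_right_eq_self (μ := (volume : Measure (Space d)))
      (fun v : Space d => Real.fourierChar (-inner ℝ (v + y) ξ) • ψ v) y
    simp only [sub_add_cancel] at e
    calc _ = ∫ v, Real.fourierChar (-inner ℝ v ξ) • ψ (v - y) := rfl
      _ = _ := by
        rw [e]
        congr 1
        ext v
        rw [inner_add_left, neg_add, AddChar.map_add_eq_mul, Circle.smul_def, Circle.smul_def,
          Circle.coe_mul, smul_eq_mul, smul_eq_mul]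
        ring

theorem hat_transl {d : ℕ} (y : Space d) (u : L2 d) :
    hat d (transl y u) =ᵐ[volume]
      fun ξ => (Real.fourierChar (-inner ℝ y ξ) : ℂ) * hat d u ξ := by
  have h : complexify d (transl y u) = Lp.compMeasurePreserving (fun x : Space d => x - y)
      (measurePreserving_sub_right volume y) (complexify d u) := by
    apply Lp.ext
    filter_upwards [coeFn_complexify d (transl y u), coeFn_transl y u,
      coeFn_compSub y (complexify d u), (measurePreserving_sub_right volume y
        ).quasiMeasurePreserving.ae (coeFn_complexify d u)] with x h1 h2 h3 h4
    rw [h1, h2, h3, h4]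
  rw [hat_apply, h, fourier_compSub]
  exact (memLp_fourierChar_mul y _).coeFn_toLp

/-- The squared `L²`-norm of the increment of `f` in direction `y`. -/
def incr {d : ℕ} (f : Space d → ℝ) (y : Space d) : ℝ≥0∞ :=
  ∫⁻ x, ENNReal.ofReal ((f x - f (x - y)) ^ 2)

theorem ae_compSub {d : ℕ} {p : Space d → Prop} (h : ∀ᵐ x, p x) (y : Space d) :
    ∀ᵐ x, p (x - y) :=
  (measurePreserving_sub_right volume y).quasiMeasurePreserving.ae h

theorem incr_congr {d : ℕ} {f g : Space d → ℝ} (h : f =ᵐ[volume] g) (y : Space d) :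
    incr f y = incr g y := by
  refine lintegral_congr_ae ?_
  filter_upwards [h, ae_compSub h y] with x h1 h2
  rw [h1, h2]

theorem enorm_sq_ofReal (a : ℝ) : ‖a‖ₑ ^ 2 = ENNReal.ofReal (a ^ 2) := by
  rw [← ofReal_norm, ← ENNReal.ofReal_pow (norm_nonneg _), Real.norm_eq_abs, sq_abs]

theorem norm_one_sub_fourierChar_sq {d : ℕ} (y ξ : Space d) :
    ‖(1 : ℂ) - (Real.fourierChar (-inner ℝ y ξ) : ℂ)‖ₑ ^ 2 =
      2 * ENNReal.ofReal (1 - Real.cos (2 * Real.pi * inner ℝ y ξ)) := by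
  rw [← ofReal_norm, ← ENNReal.ofReal_pow (norm_nonneg _), ← Complex.normSq_eq_norm_sq,
    fourierChar_neg_inner_eq]
  refine Eq.trans ?_ ((ENNReal.ofReal_mul
    (q := 1 - Real.cos (2 * Real.pi * inner ℝ y ξ)) zero_le_two).trans
    (by rw [ENNReal.ofReal_ofNat]))
  congr 1
  rw [Complex.normSq_apply]
  simp only [Complex.sub_re, Complex.one_re, Complex.exp_ofReal_mul_I_re, Complex.sub_im,
    Complex.one_im, Complex.exp_ofReal_mul_I_im, Real.cos_neg, Real.sin_neg]
  nlinarith [Real.sin_sq_add_cos_sq (2 * Real.pi * inner ℝ y ξ)]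

/-- Plancherel's theorem for u - u(· - y), with |1 - e^{-iθ}|² = 2(1 - cos θ). It links increments,
on which truncation and multiplication act pointwise, with the frequency side, on which the energy
is defined. -/
theorem incr_eq_lintegral_hat {d : ℕ} (u : L2 d) (y : Space d) :
    incr u y = ∫⁻ ξ, 2 * ENNReal.ofReal (1 - Real.cos (2 * Real.pi * inner ℝ y ξ)) *
      ‖hat d u ξ‖ₑ ^ 2 := by
  have h1 : incr u y = ‖u - transl y u‖ₑ ^ 2 := by
    rw [enorm_sq_eq_lintegral, incr]
    refine lintegral_congr_ae ?_
    filter_upwards [Lp.coeFn_sub u (transl y u), coeFn_transl y u] with x h1 h2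
    rw [h1, Pi.sub_apply, h2, enorm_sq_ofReal]
  rw [h1, enorm_sq_eq_lintegral_hat]
  refine lintegral_congr_ae ?_
  filter_upwards [hat_sub_ae d u (transl y u), hat_transl y u] with ξ h1 h2
  rw [h1, h2, ← norm_one_sub_fourierChar_sq, ← mul_pow, ← enorm_mul, sub_mul, one_mul]

/-- The modulus `2π‖ξ‖` of the angular frequency, to the power `α`. -/
def freq {d : ℕ} (α : ℝ) (ξ : Space d) : ℝ := (2 * Real.pi * ‖ξ‖) ^ α

theorem freq_nonneg {d : ℕ} (α : ℝ) (ξ : Space d) : 0 ≤ freq α ξ := by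
  unfold freq
  positivity

theorem measurable_freq {d : ℕ} (α : ℝ) : Measurable (freq (d := d) α) := by
  unfold freq
  fun_prop

theorem freq_neg {d : ℕ} (α : ℝ) (ξ : Space d) : freq α (-ξ) = freq α ξ := by
  rw [freq, norm_neg, freq]

/-- The quadratic form of the fractional Laplacian of order `α`. -/
def energy {d : ℕ} (α : ℝ) (u : L2 d) : ℝ≥0∞ :=
  ∫⁻ ξ, ENNReal.ofReal (freq α ξ) * ‖hat d u ξ‖ₑ ^ 2

/-- Measures `κ n` on `ℝᵈ` whose symbols `∫ (1 - cos (2π⟨y, ξ⟩)) dκ n(y)` increase to `|ξ|^α`. -/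
structure IsLevyApprox (d : ℕ) (α : ℝ) (κ : ℕ → Measure (Space d)) : Prop where
  sfinite : ∀ n, SFinite (κ n)
  le : ∀ n ξ, ∫⁻ y, ENNReal.ofReal (1 - Real.cos (2 * Real.pi * inner ℝ y ξ)) ∂(κ n) ≤
    ENNReal.ofReal (freq α ξ)
  tendsto : ∀ ξ, Tendsto
    (fun n => ∫⁻ y, ENNReal.ofReal (1 - Real.cos (2 * Real.pi * inner ℝ y ξ)) ∂(κ n)) atTop
    (𝓝 (ENNReal.ofReal (freq α ξ)))

theorem measurable_one_sub_cos_inner {d : ℕ} : Measurable fun p : Space d × Space d =>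
    ENNReal.ofReal (1 - Real.cos (2 * Real.pi * inner ℝ p.1 p.2)) := by
  refine (Continuous.measurable ?_).ennreal_ofReal
  fun_prop

theorem measurable_hat_enorm {d : ℕ} (u : L2 d) : Measurable fun ξ => ‖hat d u ξ‖ₑ ^ 2 :=
  (Lp.stronglyMeasurable (hat d u)).enorm.pow_const 2

theorem measurable_incr {d : ℕ} (u : L2 d) : Measurable (incr u) := by
  have : incr u = fun y => ∫⁻ ξ, 2 * ENNReal.ofReal
      (1 - Real.cos (2 * Real.pi * inner ℝ y ξ)) * ‖hat d u ξ‖ₑ ^ 2 := by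
    ext y
    exact incr_eq_lintegral_hat u y
  rw [this]
  refine Measurable.lintegral_prod_right' (f := fun p : Space d × Space d => 2 * ENNReal.ofReal
      (1 - Real.cos (2 * Real.pi * inner ℝ p.1 p.2)) * ‖hat d u p.2‖ₑ ^ 2) ?_
  exact (measurable_one_sub_cos_inner.const_mul 2).mul
    ((measurable_hat_enorm u).comp measurable_snd)

/-- Tonelli's theorem turns the average of the increments over `κ n` into the quadratic form whose
symbol is that of `κ n`. -/
theorem IsLevyApprox.lintegral_incr {d : ℕ} {α : ℝ} {κ : ℕ → Measure (Space d)}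
    (h : IsLevyApprox d α κ) (u : L2 d) (n : ℕ) :
    ∫⁻ y, incr u y ∂(κ n) = 2 * ∫⁻ ξ, (∫⁻ y, ENNReal.ofReal
      (1 - Real.cos (2 * Real.pi * inner ℝ y ξ)) ∂(κ n)) * ‖hat d u ξ‖ₑ ^ 2 := by
  have := h.sfinite n
  simp_rw [incr_eq_lintegral_hat]
  rw [lintegral_lintegral_swap, ← lintegral_const_mul']
  · refine lintegral_congr fun ξ => ?_
    rw [← lintegral_mul_const' _ _ (by simp), ← lintegral_const_mul' _ _ (by simp)]
    refine lintegral_congr fun y => ?_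
    rw [mul_assoc]
  · simp
  · exact ((measurable_one_sub_cos_inner.const_mul 2).mul
      ((measurable_hat_enorm u).comp measurable_snd)).aemeasurable

theorem measurable_levySymbol {d : ℕ} (κ : Measure (Space d)) [SFinite κ] :
    Measurable fun ξ : Space d =>
      ∫⁻ y, ENNReal.ofReal (1 - Real.cos (2 * Real.pi * inner ℝ y ξ)) ∂κ :=
  Measurable.lintegral_prod_right' (measurable_one_sub_cos_inner.comp measurable_swap)

/-- Fatou's lemma gives the lower bound and domination of the symbols by |ξ|^α the upper one. No
monotonicity in n is needed, and the energy may be infinite. -/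
theorem IsLevyApprox.tendsto_lintegral_incr {d : ℕ} {α : ℝ} {κ : ℕ → Measure (Space d)}
    (h : IsLevyApprox d α κ) (u : L2 d) :
    Tendsto (fun n => ∫⁻ y, incr u y ∂(κ n)) atTop (𝓝 (2 * energy α u)) := by
  simp_rw [h.lintegral_incr]
  refine ENNReal.Tendsto.const_mul ?_ (Or.inr (by simp))
  set F : ℕ → Space d → ℝ≥0∞ := fun n ξ => (∫⁻ y, ENNReal.ofReal
      (1 - Real.cos (2 * Real.pi * inner ℝ y ξ)) ∂(κ n)) * ‖hat d u ξ‖ₑ ^ 2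
  have hle : ∀ n, ∫⁻ ξ, F n ξ ≤ energy α u := fun n =>
    lintegral_mono fun ξ => mul_le_mul_left (h.le n ξ) _
  have hlim : ∀ ξ, Tendsto (fun n => F n ξ) atTop
      (𝓝 (ENNReal.ofReal (freq α ξ) * ‖hat d u ξ‖ₑ ^ 2)) := fun ξ =>
    ENNReal.Tendsto.mul_const (h.tendsto ξ) (Or.inr (by simp))
  have hF : energy α u ≤ liminf (fun n => ∫⁻ ξ, F n ξ) atTop := by
    have e : energy α u = ∫⁻ ξ, liminf (fun n => F n ξ) atTop :=
      lintegral_congr fun ξ => (hlim ξ).liminf_eq.symm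
    rw [e]
    refine lintegral_liminf_le fun n => ?_
    have := h.sfinite n
    exact (measurable_levySymbol (κ n)).mul (measurable_hat_enorm u)
  exact tendsto_of_le_liminf_of_limsup_le hF
    (limsup_le_of_le (h := Eventually.of_forall hle))

/-- Integrated form of a pointwise inequality between increments. -/
theorem IsLevyApprox.energy_le {d : ℕ} {α : ℝ} {κ : ℕ → Measure (Space d)}
    (h : IsLevyApprox d α κ) {a b c w : L2 d} {p q Q : ℝ≥0∞} {θ : Space d → ℝ≥0∞}
    (hp : p ≠ ⊤)
    (hθm : Measurable θ) (hθ : ∀ n, ∫⁻ y, θ y ∂(κ n) ≤ Q)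
    (hy : ∀ y, incr a y + incr b y ≤ incr c y + (p * incr w y + q * θ y)) :
    2 * energy α a + 2 * energy α b ≤
      2 * energy α c + (p * (2 * energy α w) + q * Q) := by
  refine le_of_tendsto_of_tendsto' ((h.tendsto_lintegral_incr a).add (h.tendsto_lintegral_incr b))
    ((h.tendsto_lintegral_incr c).add ((ENNReal.Tendsto.const_mul (h.tendsto_lintegral_incr w)
      (Or.inr hp)).add (tendsto_const_nhds (x := q * Q)))) fun n => ?_
  rw [← lintegral_add_left (measurable_incr a)]
  refine (lintegral_mono hy).trans ?_
  rw [lintegral_add_left (measurable_incr c), lintegral_add_left ((measurable_incr w).const_mul p),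
    lintegral_const_mul _ (measurable_incr w), lintegral_const_mul _ hθm]
  gcongr
  exact hθ n

theorem energy_le_of_incr_le {d : ℕ} {α : ℝ} {κ : ℕ → Measure (Space d)}
    (h : IsLevyApprox d α κ) {u v : L2 d} (hy : ∀ y, incr v y ≤ incr u y) :
    energy α v ≤ energy α u := by
  have := le_of_tendsto_of_tendsto' (h.tendsto_lintegral_incr v) (h.tendsto_lintegral_incr u)
    fun n => lintegral_mono hy
  exact (ENNReal.mul_le_mul_iff_right (by simp) (by simp)).mp this

/-- The energy is lower semicontinuous on `L²`. -/
theorem energy_le_of_tendsto {d : ℕ} {α : ℝ} {u : ℕ → L2 d} {v : L2 d} {c : ℝ≥0∞}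
    (hu : Tendsto u atTop (𝓝 v)) (hc : ∀ k, energy α (u k) ≤ c) : energy α v ≤ c := by
  have h1 : Tendsto (fun k => hat d (u k)) atTop (𝓝 (hat d v)) :=
    ((hat d).continuous.tendsto v).comp hu
  -- Along a subsequence the transforms converge a.e., and Fatou's lemma applies.
  obtain ⟨ns, -, hns⟩ := (tendstoInMeasure_of_tendsto_Lp h1).exists_seq_tendsto_ae
  have e : energy α v ≤ ∫⁻ ξ, liminf (fun k => ENNReal.ofReal (freq α ξ) *
      ‖hat d (u (ns k)) ξ‖ₑ ^ 2) atTop := by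
    refine (lintegral_congr_ae ?_).le
    filter_upwards [hns] with ξ hξ
    refine (Tendsto.liminf_eq ?_).symm
    exact ENNReal.Tendsto.const_mul (ENNReal.Tendsto.pow hξ.enorm) (Or.inr (by simp))
  refine e.trans ((lintegral_liminf_le fun k => ?_).trans ?_)
  · exact (measurable_freq α).ennreal_ofReal.mul (measurable_hat_enorm _)
  · exact liminf_le_of_le (h := fun b hb => by
      obtain ⟨k, hk⟩ := hb.exists
      exact hk.trans (hc _))

/-! ### Lévy measures for the fractional Laplacian -/

theorem measurable_gaussKernel (d : ℕ) (t : ℝ) : Measurable (gaussKernel d t) := by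
  unfold gaussKernel
  fun_prop

theorem measurable_one_sub_cos_inner_right {d : ℕ} (ξ : Space d) :
    Measurable fun y : Space d => ENNReal.ofReal (1 - Real.cos (2 * Real.pi * inner ℝ y ξ)) := by
  refine (Continuous.measurable ?_).ennreal_ofReal
  fun_prop

theorem gaussKernel_measurable (d : ℕ) :
    Measurable fun p : Space d × ℝ => gaussKernel d p.2 p.1 := by
  unfold gaussKernel
  fun_prop

theorem integral_cos_mul_of_fourier {d : ℕ} {k : Space d → ℝ} {c : ℝ} (ξ : Space d)
    (h : 𝓕 (fun x : Space d => (k x : ℂ)) ξ = c) (hk : Integrable k volume) :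
    ∫ y, Real.cos (2 * Real.pi * inner ℝ y ξ) * k y = c := by
  rw [Real.fourier_eq] at h
  have hkc : Integrable (fun v : Space d => (k v : ℂ)) volume := hk.ofReal
  have hi : Integrable (fun v : Space d => Real.fourierChar (-inner ℝ v ξ) • (k v : ℂ)) volume := by
    refine hkc.mono ?_ (Eventually.of_forall fun v => by simp [Circle.norm_smul])
    simp only [Circle.smul_def, smul_eq_mul]
    exact (measurable_fourierChar_inner.comp measurable_prodMk_right).aestronglyMeasurable.mul
      hkc.aestronglyMeasurable
  have h2 := congrArg Complex.re h
  have h3 := integral_re hi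
  simp only [Complex.ofReal_re] at h2
  rw [← h2]
  refine Eq.trans ?_ h3
  congr 1
  ext v
  simp only [Circle.smul_def, smul_eq_mul, fourierChar_neg_inner_eq, RCLike.re_to_complex,
    Complex.re_mul_ofReal, Complex.exp_ofReal_mul_I_re, Real.cos_neg]

/-- The real part of the Fourier transform of a Gaussian of mass one. This is the building block of
all the measures `κ n`, and, with y and ξ exchanged, of the moment bound. -/
theorem lintegral_one_sub_cos_mul_gaussKernel (d : ℕ) {s : ℝ} (hs : 0 < s) (ξ : Space d) :
    ∫⁻ y, ENNReal.ofReal (1 - Real.cos (2 * Real.pi * inner ℝ y ξ)) *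
      ENNReal.ofReal (gaussKernel d s y) =
        ENNReal.ofReal (1 - Real.exp (-((2 * Real.pi * ‖ξ‖) ^ 2 * s))) := by
  have hk := integrable_gaussKernel d hs
  have h1 := integral_cos_mul_of_fourier ξ (fourier_gaussKernel d hs ξ) hk
  have hc : Integrable (fun y => Real.cos (2 * Real.pi * inner ℝ y ξ) * gaussKernel d s y)
      volume := by
    refine hk.bdd_mul (c := 1) ?_ (Eventually.of_forall fun y => Real.abs_cos_le_one _)
    exact Continuous.aestronglyMeasurable (by fun_prop)
  have hnn : ∀ y : Space d, 0 ≤ (1 - Real.cos (2 * Real.pi * inner ℝ y ξ)) := fun y =>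
    sub_nonneg.mpr (Real.cos_le_one _)
  simp_rw [← ENNReal.ofReal_mul (hnn _), sub_mul, one_mul]
  have hsub : Integrable (fun y => gaussKernel d s y -
      Real.cos (2 * Real.pi * inner ℝ y ξ) * gaussKernel d s y) volume := hk.sub hc
  rw [← ofReal_integral_eq_lintegral_ofReal hsub, integral_sub hk hc,
    integral_gaussKernel d hs, h1]
  refine Eventually.of_forall fun y => ?_
  have := mul_nonneg (hnn y) (gaussKernel_nonneg d hs y)
  rwa [sub_mul, one_mul] at this

section Subordination

variable {β : ℝ}

/-- Near 0 the integrand is at most s^{-β}, integrable as β < 1; at infinity it is at most s^{-1-β},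
integrable as β > 0. -/
theorem integrableOn_one_sub_exp_mul_rpow (h0 : 0 < β) (h1 : β < 1) :
    IntegrableOn (fun s : ℝ => (1 - Real.exp (-s)) * s ^ (-1 - β)) (Set.Ioi 0) volume := by
  have hm : Measurable fun s : ℝ => (1 - Real.exp (-s)) * s ^ (-1 - β) := by fun_prop
  rw [← Set.Ioc_union_Ioi_eq_Ioi zero_le_one]
  refine IntegrableOn.union ?_ ?_
  · have hI : IntegrableOn (fun s : ℝ => s ^ (-β)) (Set.Ioc 0 1) volume := by
      have := (intervalIntegral.intervalIntegrable_rpow' (a := 0) (b := 1)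
        (by linarith : -1 < -β))
      rwa [intervalIntegrable_iff_integrableOn_Ioc_of_le zero_le_one] at this
    refine Integrable.mono hI hm.aestronglyMeasurable ?_
    filter_upwards [ae_restrict_mem measurableSet_Ioc] with s hs
    have hs0 : 0 < s := hs.1
    have e1 : 0 ≤ 1 - Real.exp (-s) := by
      have := Real.exp_le_one_iff.mpr (by linarith : -s ≤ 0)
      linarith
    have e2 : 1 - Real.exp (-s) ≤ s := by
      have := Real.add_one_le_exp (-s)
      linarith
    rw [Real.norm_of_nonneg (by positivity), Real.norm_of_nonneg (by positivity)]
    calc _ ≤ s * s ^ (-1 - β) := by gcongr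
      _ = s ^ (-β) := by
        rw [← Real.rpow_one_add' hs0.le (by linarith)]
        congr 1
        ring
  · have hI : IntegrableOn (fun s : ℝ => s ^ (-1 - β)) (Set.Ioi 1) volume :=
      integrableOn_Ioi_rpow_of_lt (by linarith) one_pos
    refine Integrable.mono hI hm.aestronglyMeasurable ?_
    filter_upwards [ae_restrict_mem measurableSet_Ioi] with s hs
    have hs0 : (0 : ℝ) < s := one_pos.trans hs
    have e1 : 0 ≤ 1 - Real.exp (-s) := by
      have := Real.exp_le_one_iff.mpr (by linarith : -s ≤ 0)
      linarith
    rw [Real.norm_of_nonneg (by positivity), Real.norm_of_nonneg (by positivity)]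
    have : 1 - Real.exp (-s) ≤ 1 := by
      have := Real.exp_pos (-s)
      linarith
    calc _ ≤ 1 * s ^ (-1 - β) := by gcongr
      _ = _ := one_mul _

variable (β) in
/-- The normalizing constant `∫₀^∞ (1 - e^{-s}) s^{-1-β} ds`. -/
def subordConst : ℝ := ∫ s in Set.Ioi (0 : ℝ), (1 - Real.exp (-s)) * s ^ (-1 - β)

theorem subordConst_pos (h0 : 0 < β) (h1 : β < 1) : 0 < subordConst β := by
  rw [subordConst, setIntegral_pos_iff_support_of_nonneg_ae _
    (integrableOn_one_sub_exp_mul_rpow h0 h1)]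
  · refine lt_of_lt_of_le ?_ (measure_mono (s := Set.Ioi (0 : ℝ)) fun s (hs : 0 < s) => ⟨?_, hs⟩)
    · simp
    · have : Real.exp (-s) < 1 := Real.exp_lt_one_iff.mpr (neg_lt_zero.mpr (by assumption))
      have h2 : 0 < 1 - Real.exp (-s) := by linarith
      exact (mul_pos h2 (Real.rpow_pos_of_pos hs _)).ne'
  · filter_upwards [ae_restrict_mem measurableSet_Ioi] with s hs
    have hs0 : (0 : ℝ) < s := hs
    have : Real.exp (-s) < 1 := Real.exp_lt_one_iff.mpr (neg_lt_zero.mpr (by assumption))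
    have h2 : 0 < 1 - Real.exp (-s) := by linarith
    exact (mul_pos h2 (Real.rpow_pos_of_pos hs _)).le

/-- The substitution s ↦ xs in the integral defining `subordConst` produces the factor x^β. -/
theorem lintegral_subordination (h0 : 0 < β) (h1 : β < 1) {x : ℝ} (hx : 0 ≤ x) :
    ∫⁻ s in Set.Ioi (0 : ℝ), ENNReal.ofReal ((subordConst β)⁻¹ * s ^ (-1 - β)) *
      ENNReal.ofReal (1 - Real.exp (-(x * s))) = ENNReal.ofReal (x ^ β) := by
  have hC := subordConst_pos h0 h1
  rcases hx.eq_or_lt with rfl | hx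
  · simp [Real.zero_rpow h0.ne']
  have e : ∀ᵐ s : ℝ ∂(volume.restrict (Set.Ioi 0)),
      ENNReal.ofReal ((subordConst β)⁻¹ * s ^ (-1 - β)) *
        ENNReal.ofReal (1 - Real.exp (-(x * s))) =
      ENNReal.ofReal ((subordConst β)⁻¹ * x ^ (1 + β) *
        ((1 - Real.exp (-(x * s))) * (x * s) ^ (-1 - β))) := by
    filter_upwards [ae_restrict_mem measurableSet_Ioi] with s hs
    have hs0 : (0 : ℝ) < s := hs
    rw [← ENNReal.ofReal_mul (by positivity), Real.mul_rpow hx.le hs0.le]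
    congr 1
    have : x ^ (1 + β) * x ^ (-1 - β) = 1 := by
      rw [← Real.rpow_add hx]
      ring_nf
      exact Real.rpow_zero x
    linear_combination -((subordConst β)⁻¹ * s ^ (-1 - β) * (1 - Real.exp (-(x * s)))) * this
  rw [lintegral_congr_ae e]
  have hi : IntegrableOn (fun s : ℝ => (1 - Real.exp (-(x * s))) * (x * s) ^ (-1 - β))
      (Set.Ioi 0) volume := by
    have := (integrableOn_Ioi_comp_mul_left_iff
      (fun s : ℝ => (1 - Real.exp (-s)) * s ^ (-1 - β)) 0 hx).mpr
    rw [mul_zero] at this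
    exact this (integrableOn_one_sub_exp_mul_rpow h0 h1)
  have hs := integral_comp_mul_left_Ioi
    (fun s : ℝ => (1 - Real.exp (-s)) * s ^ (-1 - β)) 0 hx
  rw [mul_zero] at hs
  rw [← ofReal_integral_eq_lintegral_ofReal (hi.const_mul _), integral_const_mul, hs]
  · congr 1
    rw [← subordConst, smul_eq_mul]
    have : x ^ (1 + β) = x * x ^ β := Real.rpow_one_add' hx.le (by linarith)
    rw [this]
    field_simp
  · filter_upwards [ae_restrict_mem measurableSet_Ioi] with s hs
    have hs0 : (0 : ℝ) < s := hs
    have : Real.exp (-(x * s)) ≤ 1 := Real.exp_le_one_iff.mpr (by nlinarith)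
    have h2 : 0 ≤ 1 - Real.exp (-(x * s)) := by linarith
    positivity

end Subordination

/-- Subordination with β = α/2 at x = |2πξ|²: mixing Gauss kernels with weight proportional to
s^{-1-α/2} gives one measure whose symbol is exactly |2πξ|^α, so a constant sequence suffices. -/
theorem exists_isLevyApprox_of_lt_two (d : ℕ) {α : ℝ} (h0 : 0 < α) (h2 : α < 2) :
    ∃ κ, IsLevyApprox d α κ := by
  set w : ℝ → ℝ≥0∞ := fun s => ENNReal.ofReal ((subordConst (α / 2))⁻¹ * s ^ (-1 - α / 2))
  have hwm : Measurable w := by fun_prop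
  have hgm := (gaussKernel_measurable d).ennreal_ofReal
  set κ : Measure (Space d) := volume.withDensity fun y =>
    ∫⁻ s in Set.Ioi (0 : ℝ), w s * ENNReal.ofReal (gaussKernel d s y)
  have hdm : Measurable fun y : Space d =>
      ∫⁻ s in Set.Ioi (0 : ℝ), w s * ENNReal.ofReal (gaussKernel d s y) :=
    Measurable.lintegral_prod_right' (f := fun p : Space d × ℝ =>
      w p.2 * ENNReal.ofReal (gaussKernel d p.2 p.1)) ((hwm.comp measurable_snd).mul hgm)
  have key : ∀ ξ : Space d, ∫⁻ y, ENNReal.ofReal (1 - Real.cos (2 * Real.pi * inner ℝ y ξ)) ∂κ =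
      ENNReal.ofReal (freq α ξ) := by
    intro ξ
    have hcm := measurable_one_sub_cos_inner_right ξ
    rw [lintegral_withDensity_eq_lintegral_mul _ hdm hcm]
    simp only [Pi.mul_apply]
    simp_rw [← lintegral_mul_const' _ _ ENNReal.ofReal_ne_top]
    rw [lintegral_lintegral_swap]
    · have e : ∀ᵐ s : ℝ ∂(volume.restrict (Set.Ioi 0)),
          ∫⁻ y : Space d, w s * ENNReal.ofReal (gaussKernel d s y) *
            ENNReal.ofReal (1 - Real.cos (2 * Real.pi * inner ℝ y ξ)) =
          w s * ENNReal.ofReal (1 - Real.exp (-((2 * Real.pi * ‖ξ‖) ^ 2 * s))) := by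
        filter_upwards [ae_restrict_mem measurableSet_Ioi] with s hs
        rw [← lintegral_one_sub_cos_mul_gaussKernel d hs ξ,
          ← lintegral_const_mul' _ _ ENNReal.ofReal_ne_top]
        refine lintegral_congr fun y => ?_
        ring
      rw [lintegral_congr_ae e, lintegral_subordination (by linarith) (by linarith) (sq_nonneg _)]
      congr 1
      rw [freq, ← Real.rpow_natCast, ← Real.rpow_mul (by positivity)]
      congr 1
      push_cast
      ring
    · exact (((hwm.comp measurable_snd).mul hgm).mul (hcm.comp measurable_fst)).aemeasurable
  refine ⟨fun _ => κ, fun _ => inferInstance, fun _ ξ => (key ξ).le, fun ξ => ?_⟩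
  simp_rw [key]
  exact tendsto_const_nhds

/-- The Laplacian is local and is only a limit of jump operators. The measures with density p_t / t,
where p_t is the Gauss kernel and t = 1/(n + 1), have symbols (1 - e^{-at})/t with a = |2πξ|²,
squeezed between a e^{-at} and a. -/
theorem exists_isLevyApprox_two (d : ℕ) : ∃ κ, IsLevyApprox d 2 κ := by
  set t : ℕ → ℝ := fun n => 1 / ((n : ℝ) + 1)
  have ht : ∀ n, 0 < t n := fun n => Nat.one_div_pos_of_nat
  set κ : ℕ → Measure (Space d) := fun n => volume.withDensity fun y =>
    ENNReal.ofReal ((t n)⁻¹) * ENNReal.ofReal (gaussKernel d (t n) y)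
  have hgm : ∀ n, Measurable fun y : Space d => ENNReal.ofReal ((t n)⁻¹) *
      ENNReal.ofReal (gaussKernel d (t n) y) := fun n =>
    (measurable_gaussKernel d _).ennreal_ofReal.const_mul _
  have key : ∀ n (ξ : Space d),
      ∫⁻ y, ENNReal.ofReal (1 - Real.cos (2 * Real.pi * inner ℝ y ξ)) ∂(κ n) =
        ENNReal.ofReal ((t n)⁻¹ * (1 - Real.exp (-((2 * Real.pi * ‖ξ‖) ^ 2 * t n)))) := by
    intro n ξ
    have hcm := measurable_one_sub_cos_inner_right ξ
    rw [lintegral_withDensity_eq_lintegral_mul _ (hgm n) hcm,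
      ENNReal.ofReal_mul (inv_nonneg.mpr (ht n).le),
      ← lintegral_one_sub_cos_mul_gaussKernel d (ht n) ξ,
      ← lintegral_const_mul' _ _ ENNReal.ofReal_ne_top]
    refine lintegral_congr fun y => ?_
    simp only [Pi.mul_apply]
    ring
  have hfreq : ∀ ξ : Space d, freq 2 ξ = (2 * Real.pi * ‖ξ‖) ^ 2 := fun ξ => Real.rpow_two _
  have hup : ∀ n (ξ : Space d),
      (t n)⁻¹ * (1 - Real.exp (-((2 * Real.pi * ‖ξ‖) ^ 2 * t n))) ≤ freq 2 ξ := by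
    intro n ξ
    have := Real.add_one_le_exp (-((2 * Real.pi * ‖ξ‖) ^ 2 * t n))
    rw [hfreq, inv_mul_le_iff₀ (ht n)]
    linarith
  refine ⟨κ, fun n => by simp only [κ]; infer_instance, fun n ξ => ?_, fun ξ => ?_⟩
  · rw [key]
    exact ENNReal.ofReal_le_ofReal (hup n ξ)
  · simp_rw [key]
    refine ENNReal.tendsto_ofReal ?_
    have hlow : ∀ n, freq 2 ξ * Real.exp (-((2 * Real.pi * ‖ξ‖) ^ 2 * t n)) ≤
        (t n)⁻¹ * (1 - Real.exp (-((2 * Real.pi * ‖ξ‖) ^ 2 * t n))) := by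
      intro n
      rw [hfreq, le_inv_mul_iff₀ (ht n)]
      have h1 := Real.add_one_le_exp ((2 * Real.pi * ‖ξ‖) ^ 2 * t n)
      have h2 : Real.exp ((2 * Real.pi * ‖ξ‖) ^ 2 * t n) *
          Real.exp (-((2 * Real.pi * ‖ξ‖) ^ 2 * t n)) = 1 := by
        rw [← Real.exp_add, add_neg_cancel, Real.exp_zero]
      nlinarith [Real.exp_pos (-((2 * Real.pi * ‖ξ‖) ^ 2 * t n))]
    refine tendsto_of_tendsto_of_tendsto_of_le_of_le ?_ tendsto_const_nhds hlow (hup · ξ)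
    have ht0 : Tendsto t atTop (𝓝 0) := tendsto_one_div_add_atTop_nhds_zero_nat
    have hc : Continuous fun s : ℝ => freq 2 ξ * Real.exp (-((2 * Real.pi * ‖ξ‖) ^ 2 * s)) := by
      fun_prop
    have := (hc.tendsto 0).comp ht0
    simpa [Function.comp_def] using this

theorem exists_isLevyApprox (d : ℕ) {α : ℝ} (h0 : 0 < α) (h2 : α ≤ 2) :
    ∃ κ, IsLevyApprox d α κ := by
  rcases h2.eq_or_lt with rfl | h2
  · exact exists_isLevyApprox_two d
  · exact exists_isLevyApprox_of_lt_two d h0 h2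

theorem freq_le_one_add_sq {d : ℕ} {α : ℝ} (h0 : 0 < α) (h2 : α ≤ 2) (ξ : Space d) :
    freq α ξ ≤ 1 + (2 * Real.pi * ‖ξ‖) ^ 2 := by
  have hy : 0 ≤ 2 * Real.pi * ‖ξ‖ := by positivity
  unfold freq
  rcases le_total (2 * Real.pi * ‖ξ‖) 1 with h | h
  · have := Real.rpow_le_one hy h h0.le
    nlinarith [sq_nonneg (2 * Real.pi * ‖ξ‖)]
  · have := Real.rpow_le_rpow_of_exponent_le h h2
    rw [Real.rpow_two] at this
    linarith

/-- Half of the Gaussian exponent absorbs the square, by z e^{-z} ≤ 1 with z = ‖ξ‖²/(8t); the other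
half is a Gauss kernel at time 2t. -/
theorem integrable_sq_mul_gaussKernel (d : ℕ) {t : ℝ} (ht : 0 < t) :
    Integrable (fun ξ : Space d => ‖ξ‖ ^ 2 * gaussKernel d t ξ) volume := by
  have h2t : 0 < 2 * t := by positivity
  refine ((integrable_gaussKernel d h2t).const_mul
    (8 * t * ((4 * Real.pi * t) ^ (-(d : ℝ) / 2) / (4 * Real.pi * (2 * t)) ^ (-(d : ℝ) / 2)))).mono
    ?_ (Eventually.of_forall fun ξ => ?_)
  · refine Measurable.aestronglyMeasurable ?_
    exact (measurable_norm.pow_const 2).mul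
      (measurable_gaussKernel d _)
  · have hp : 0 < (4 * Real.pi * (2 * t)) ^ (-(d : ℝ) / 2) := by positivity
    rw [Real.norm_of_nonneg (mul_nonneg (sq_nonneg _) (gaussKernel_nonneg d ht ξ)),
      Real.norm_of_nonneg (mul_nonneg (by positivity) (gaussKernel_nonneg d h2t ξ)),
      gaussKernel, gaussKernel]
    have e1 : -‖ξ‖ ^ 2 / (4 * t) = -(‖ξ‖ ^ 2 / (8 * t)) + -(‖ξ‖ ^ 2 / (8 * t)) := by
      field_simp
      ring
    have e2 : -‖ξ‖ ^ 2 / (4 * (2 * t)) = -(‖ξ‖ ^ 2 / (8 * t)) := by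
      field_simp
      ring
    rw [e1, e2, Real.exp_add]
    set z := ‖ξ‖ ^ 2 / (8 * t) with hz
    have hz2 : ‖ξ‖ ^ 2 = 8 * t * z := by
      rw [hz]
      field_simp
    have hze : z * Real.exp (-z) ≤ 1 := by
      have h1 := Real.add_one_le_exp z
      have h2 : Real.exp z * Real.exp (-z) = 1 := by
        rw [← Real.exp_add, add_neg_cancel, Real.exp_zero]
      nlinarith [Real.exp_pos (-z)]
    rw [hz2]
    calc 8 * t * z * ((4 * Real.pi * t) ^ (-(d : ℝ) / 2) * (Real.exp (-z) * Real.exp (-z)))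
        = 8 * t * (4 * Real.pi * t) ^ (-(d : ℝ) / 2) * Real.exp (-z) * (z * Real.exp (-z)) := by
          ring
      _ ≤ 8 * t * (4 * Real.pi * t) ^ (-(d : ℝ) / 2) * Real.exp (-z) * 1 := by
          gcongr
      _ = _ := by
          field_simp

theorem min_one_le_two_mul_one_sub_exp {z : ℝ} (hz : 0 ≤ z) :
    min 1 z ≤ 2 * (1 - Real.exp (-z)) := by
  have h2 : Real.exp z * Real.exp (-z) = 1 := by
    rw [← Real.exp_add, add_neg_cancel, Real.exp_zero]
  have h1 := Real.add_one_le_exp z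
  have h3 := Real.exp_pos (-z)
  have h4 : (1 + z) * Real.exp (-z) ≤ 1 := by nlinarith
  rcases le_total z 1 with h | h
  · rw [min_eq_right h]
    nlinarith
  · rw [min_eq_left h]
    nlinarith

/-- The symbols are dominated by |ξ|^α; integrate this against a Gaussian in ξ. The corresponding
average of 1 - cos is 1 - e^{-‖y‖²}, which is at least min(1, ‖y‖²)/2. The bound is uniform in n. -/
theorem IsLevyApprox.exists_moment_bound {d : ℕ} {α : ℝ} {κ : ℕ → Measure (Space d)}
    (h : IsLevyApprox d α κ) (h0 : 0 < α) (h2 : α ≤ 2) :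
    ∃ Q : ℝ≥0∞, Q ≠ ⊤ ∧ ∀ n, ∫⁻ y, ENNReal.ofReal (min 1 (‖y‖ ^ 2)) ∂(κ n) ≤ Q := by
  -- This time cancels the factor 2π, so that the exponent below is ‖y‖².
  set t : ℝ := ((2 * Real.pi) ^ 2)⁻¹
  have ht : 0 < t := by positivity
  refine ⟨2 * ∫⁻ ξ : Space d, ENNReal.ofReal (freq α ξ) * ENNReal.ofReal (gaussKernel d t ξ),
    ENNReal.mul_ne_top (by simp) ?_, fun n => ?_⟩
  · simp_rw [← ENNReal.ofReal_mul (freq_nonneg α _)]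
    refine (Integrable.lintegral_lt_top ?_).ne
    have hi := (integrable_gaussKernel d ht).add
      ((integrable_sq_mul_gaussKernel d ht).const_mul ((2 * Real.pi) ^ 2))
    refine hi.mono ?_ (Eventually.of_forall fun ξ => ?_)
    · exact ((measurable_freq α).mul
        (measurable_gaussKernel d _)).aestronglyMeasurable
    · have hg := gaussKernel_nonneg d ht ξ
      rw [Real.norm_of_nonneg (mul_nonneg (freq_nonneg _ _) hg)]
      refine le_trans ?_ (le_abs_self _)
      have := mul_le_mul_of_nonneg_right (freq_le_one_add_sq h0 h2 ξ) hg
      simp only [Pi.add_apply]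
      nlinarith
  · have := h.sfinite n
    have hcm := measurable_one_sub_cos_inner (d := d)
    have hgm : Measurable fun ξ : Space d => ENNReal.ofReal (gaussKernel d t ξ) :=
      (measurable_gaussKernel d _).ennreal_ofReal
    calc ∫⁻ y, ENNReal.ofReal (min 1 (‖y‖ ^ 2)) ∂(κ n)
        ≤ ∫⁻ y, (2 * ∫⁻ ξ, ENNReal.ofReal (1 - Real.cos (2 * Real.pi * inner ℝ y ξ)) *
            ENNReal.ofReal (gaussKernel d t ξ)) ∂(κ n) := by
          refine lintegral_mono fun y => ?_
          have e := lintegral_one_sub_cos_mul_gaussKernel d ht y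
          simp_rw [real_inner_comm y] at e
          rw [e]
          have e2 : (2 * Real.pi * ‖y‖) ^ 2 * t = ‖y‖ ^ 2 := by
            simp only [t]
            field_simp
          rw [e2]
          refine (ENNReal.ofReal_le_ofReal
            (min_one_le_two_mul_one_sub_exp (sq_nonneg ‖y‖))).trans ?_
          rw [ENNReal.ofReal_mul zero_le_two, ENNReal.ofReal_ofNat]
      _ = 2 * ∫⁻ ξ, (∫⁻ y, ENNReal.ofReal (1 - Real.cos (2 * Real.pi * inner ℝ y ξ)) ∂(κ n)) *
            ENNReal.ofReal (gaussKernel d t ξ) := by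
          rw [lintegral_const_mul' _ _ (by simp), lintegral_lintegral_swap]
          · simp_rw [lintegral_mul_const' _ _ ENNReal.ofReal_ne_top]
          · exact (hcm.mul (hgm.comp measurable_snd)).aemeasurable
      _ ≤ _ := by
          gcongr with ξ
          exact h.le n ξ

/-! ### Energy estimates for truncations and products -/

theorem hat_zero_ae (d : ℕ) : hat d 0 =ᵐ[volume] fun _ => 0 := by
  rw [map_zero]
  exact Lp.coeFn_zero _ _ _

theorem energy_zero (d : ℕ) (α : ℝ) : energy α (0 : L2 d) = 0 := by
  rw [energy, lintegral_congr_ae (g := fun _ => 0)]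
  · simp
  · filter_upwards [hat_zero_ae d] with ξ hξ
    simp

theorem energy_smul {d : ℕ} (α c : ℝ) (u : L2 d) :
    energy α (c • u) = ENNReal.ofReal (c ^ 2) * energy α u := by
  rw [energy, energy, ← lintegral_const_mul' _ _ ENNReal.ofReal_ne_top]
  refine lintegral_congr_ae ?_
  filter_upwards [hat_smul_ae d c u] with ξ hξ
  rw [hξ, enorm_mul, mul_pow, ← enorm_sq_ofReal]
  have : ‖(c : ℂ)‖ₑ = ‖c‖ₑ := by rw [← ofReal_norm, ← ofReal_norm, Complex.norm_real]
  rw [this]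
  ring

/-- Truncation to the unit interval. -/
def clamp (a : ℝ) : ℝ := max (min a 1) 0

theorem clamp_mem (a : ℝ) : 0 ≤ clamp a ∧ clamp a ≤ 1 :=
  ⟨le_max_right _ _, max_le (min_le_right _ _) zero_le_one⟩

theorem abs_clamp_sub_le (a b : ℝ) : |clamp a - clamp b| ≤ |a - b| := by
  refine (abs_max_sub_max_le_abs _ _ 0).trans ?_
  have := abs_min_sub_min_le_max a 1 b 1
  simpa using this

theorem clamp_zero : clamp 0 = 0 := by simp [clamp]

theorem abs_clamp_le (a : ℝ) : |clamp a| ≤ |a| := by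
  simpa [clamp_zero] using abs_clamp_sub_le a 0

theorem continuous_clamp : Continuous clamp := by
  unfold clamp
  fun_prop

/-- Truncation is 1-Lipschitz, hence decreases every increment. This makes the energy a Dirichlet
form and is the source of the Markov property of the semigroups constructed below. -/
theorem energy_clamp_le {d : ℕ} {α : ℝ} {κ : ℕ → Measure (Space d)}
    (h : IsLevyApprox d α κ) {u v : L2 d} (hv : v =ᵐ[volume] fun x => clamp (u x)) :
    energy α v ≤ energy α u := by
  refine energy_le_of_incr_le h fun y => ?_
  rw [incr_congr hv]
  refine lintegral_mono fun x => ENNReal.ofReal_le_ofReal ?_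
  exact sq_le_sq.mpr (abs_clamp_sub_le _ _)

theorem lintegral_ofReal_sq {d : ℕ} (v : L2 d) :
    ∫⁻ x, ENNReal.ofReal (v x ^ 2) = ‖v‖ₑ ^ 2 := by
  rw [enorm_sq_eq_lintegral]
  simp_rw [enorm_sq_ofReal]

theorem lintegral_ofReal_sq_compSub {d : ℕ} (v : L2 d) (y : Space d) :
    ∫⁻ x, ENNReal.ofReal (v (x - y) ^ 2) = ‖v‖ₑ ^ 2 := by
  rw [← lintegral_ofReal_sq,
    lintegral_sub_right_eq_self (fun x => ENNReal.ofReal (v x ^ 2)) y]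

theorem measurable_coeFn {d : ℕ} (v : L2 d) : Measurable (v : Space d → ℝ) :=
  (Lp.stronglyMeasurable v).measurable

theorem measurable_incr_integrand {d : ℕ} (v : L2 d) (y : Space d) :
    Measurable fun x => ENNReal.ofReal ((v x - v (x - y)) ^ 2) :=
  (((measurable_coeFn v).sub ((measurable_coeFn v).comp
    (measurable_id.sub_const y))).pow_const 2).ennreal_ofReal

/-- The energy of a product `g w`. -/
theorem energy_mul_le {d : ℕ} {α : ℝ} {κ : ℕ → Measure (Space d)} (h : IsLevyApprox d α κ)
    {Q : ℝ≥0∞} (hQ : ∀ n, ∫⁻ y, ENNReal.ofReal (min 1 (‖y‖ ^ 2)) ∂(κ n) ≤ Q)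
    {g : Space d → ℝ} {M q : ℝ} (hM : ∀ x, |g x| ≤ M) (hq : 0 ≤ q)
    (hg : ∀ x y, (g x - g (x - y)) ^ 2 ≤ q * min 1 (‖y‖ ^ 2))
    {w p : L2 d} (hp : p =ᵐ[volume] fun x => g x * w x) :
    energy α p ≤ ENNReal.ofReal (2 * M ^ 2) * energy α w + ENNReal.ofReal q * ‖w‖ₑ ^ 2 * Q := by
  have key : ∀ y, incr p y + incr (0 : L2 d) y ≤ incr (0 : L2 d) y +
      (ENNReal.ofReal (2 * M ^ 2) * incr w y +
        -- The terms in 0 only bring the inequality into the shape that `IsLevyApprox.energy_le`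
        -- expects.
        (2 * (ENNReal.ofReal q * ‖w‖ₑ ^ 2)) * ENNReal.ofReal (min 1 (‖y‖ ^ 2))) := by
    intro y
    rw [add_comm]
    gcongr
    rw [incr_congr hp]
    have hθ : 0 ≤ min 1 (‖y‖ ^ 2) := by positivity
    calc ∫⁻ x, ENNReal.ofReal ((g x * w x - g (x - y) * w (x - y)) ^ 2)
        ≤ ∫⁻ x, (ENNReal.ofReal (2 * M ^ 2) * ENNReal.ofReal ((w x - w (x - y)) ^ 2) +
            ENNReal.ofReal (2 * (q * min 1 (‖y‖ ^ 2))) * ENNReal.ofReal (w (x - y) ^ 2)) := by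
          refine lintegral_mono fun x => ?_
          rw [← ENNReal.ofReal_mul (by positivity), ← ENNReal.ofReal_mul (by positivity),
            ← ENNReal.ofReal_add (by positivity) (by positivity)]
          refine ENNReal.ofReal_le_ofReal ?_
          have h1 : g x ^ 2 ≤ M ^ 2 := sq_le_sq' (abs_le.mp (hM x)).1 (abs_le.mp (hM x)).2
          have h2 := mul_le_mul_of_nonneg_right h1 (sq_nonneg (w x - w (x - y)))
          have h3 := mul_le_mul_of_nonneg_right (hg x y) (sq_nonneg (w (x - y)))
          -- With w' = w(x - y) and g' = g(x - y), gw - g'w' = g(w - w') + (g - g')w', and (a + b)²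
          -- ≤ 2a² + 2b².
          nlinarith [sq_nonneg (g x * (w x - w (x - y)) - (g x - g (x - y)) * w (x - y))]
      _ = _ := by
          rw [lintegral_add_left ((measurable_incr_integrand w y).const_mul _),
            lintegral_const_mul' _ _ ENNReal.ofReal_ne_top,
            lintegral_const_mul' _ _ ENNReal.ofReal_ne_top, lintegral_ofReal_sq_compSub,
            ENNReal.ofReal_mul (q := q * min 1 (‖y‖ ^ 2)) zero_le_two, ENNReal.ofReal_mul hq,
            ENNReal.ofReal_ofNat, incr]
          ring
  have := h.energy_le ENNReal.ofReal_ne_top (by fun_prop) hQ key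
  rw [energy_zero, mul_zero, add_zero, zero_add] at this
  refine (ENNReal.mul_le_mul_iff_right (a := 2) (by simp) (by simp)).mp (this.trans (le_of_eq ?_))
  ring

/-- X(1 - W) - X'(1 - W') = (X - X')(1 - W) - X'(W - W'). In the W-part V V' ≤ 1 suffices, leaving
the small energy of the cutoff. In the X-part V V' ≤ (V² + V'²)/2 must be kept: t will not depend on
x, and only V makes that term integrable in x. -/
theorem mul_cutoff_sub_sq_le {V V' W W' X X' t : ℝ} (hV : 0 ≤ V ∧ V ≤ 1) (hV' : 0 ≤ V' ∧ V' ≤ 1)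
    (hW : 0 ≤ W ∧ W ≤ 1) (hX' : 0 ≤ X' ∧ X' ≤ 1)
    (h : (X - X') ^ 2 ≤ t) :
    V * V' * (X * (1 - W) - X' * (1 - W')) ^ 2 ≤ 2 * (W - W') ^ 2 + t * (V ^ 2 + V' ^ 2) := by
  have hp : (X * (1 - W) - X' * (1 - W')) ^ 2 ≤ 2 * (X - X') ^ 2 + 2 * (W - W') ^ 2 := by
    have k1 : (1 - W) ^ 2 ≤ 1 := by nlinarith
    have k2 : X' ^ 2 ≤ 1 := by nlinarith
    have k3 := mul_le_mul_of_nonneg_right k1 (sq_nonneg (X - X'))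
    have k4 := mul_le_mul_of_nonneg_right k2 (sq_nonneg (W - W'))
    have k5 := sq_nonneg ((X - X') * (1 - W) + X' * (W - W'))
    linarith
  have hVV0 : 0 ≤ V * V' := mul_nonneg hV.1 hV'.1
  have hVV1 : V * V' ≤ 1 := mul_le_one₀ hV.2 hV'.1 hV'.2
  have hVV2 : 2 * (V * V') ≤ V ^ 2 + V' ^ 2 := by linarith [sq_nonneg (V - V')]
  have k5 := mul_le_mul_of_nonneg_left hp hVV0
  have k6 := mul_le_mul_of_nonneg_right hVV1 (sq_nonneg (W - W'))
  have k7 : 2 * (V * V') * (X - X') ^ 2 ≤ (V ^ 2 + V' ^ 2) * t :=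
    mul_le_mul hVV2 h (sq_nonneg _) (by positivity)
  linarith

/-- The energy of `v φ` for `0 ≤ v ≤ 1` and `φ = χ (1 - w)` in terms of the mutual energy of `v`
and `v φ²`, which is `energy ((v + vφ²)/2) - energy ((v - vφ²)/2)`. -/
theorem energy_mul_cutoff_le {d : ℕ} {α : ℝ} {κ : ℕ → Measure (Space d)}
    (h : IsLevyApprox d α κ)
    {Q : ℝ≥0∞} (hQ : ∀ n, ∫⁻ y, ENNReal.ofReal (min 1 (‖y‖ ^ 2)) ∂(κ n) ≤ Q)
    {χ φ : Space d → ℝ} {q : ℝ} (hχ : ∀ x, 0 ≤ χ x ∧ χ x ≤ 1) (hq : 0 ≤ q)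
    (hχq : ∀ x y, (χ x - χ (x - y)) ^ 2 ≤ q * min 1 (‖y‖ ^ 2))
    {v w a ψ : L2 d} (hv : ∀ᵐ x, 0 ≤ v x ∧ v x ≤ 1) (hw : ∀ᵐ x, 0 ≤ w x ∧ w x ≤ 1)
    (hφ : ∀ᵐ x, φ x = χ x * (1 - w x))
    (ha : a =ᵐ[volume] fun x => v x * φ x) (hψ : ψ =ᵐ[volume] fun x => v x * φ x ^ 2) :
    energy α a + energy α ((1 / 2 : ℝ) • (v - ψ)) ≤
      energy α ((1 / 2 : ℝ) • (v + ψ)) + (2 * energy α w + ENNReal.ofReal q * ‖v‖ₑ ^ 2 * Q) := by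
  have hb : ((1 / 2 : ℝ) • (v - ψ) : L2 d) =ᵐ[volume] fun x => 1 / 2 * (v x - v x * φ x ^ 2) := by
    filter_upwards [Lp.coeFn_smul (1 / 2 : ℝ) (v - ψ), Lp.coeFn_sub v ψ, hψ] with x h1 h2 h3
    rw [h1, Pi.smul_apply, h2, Pi.sub_apply, h3, smul_eq_mul]
  have hc : ((1 / 2 : ℝ) • (v + ψ) : L2 d) =ᵐ[volume] fun x => 1 / 2 * (v x + v x * φ x ^ 2) := by
    filter_upwards [Lp.coeFn_smul (1 / 2 : ℝ) (v + ψ), Lp.coeFn_add v ψ, hψ] with x h1 h2 h3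
    rw [h1, Pi.smul_apply, h2, Pi.add_apply, h3, smul_eq_mul]
  set b : L2 d := (1 / 2 : ℝ) • (v - ψ)
  set c : L2 d := (1 / 2 : ℝ) • (v + ψ)
  have key : ∀ y, incr a y + incr b y ≤ incr c y +
      (2 * incr w y + (2 * (ENNReal.ofReal q * ‖v‖ₑ ^ 2)) *
        ENNReal.ofReal (min 1 (‖y‖ ^ 2))) := by
    intro y
    have hθ : 0 ≤ min 1 (‖y‖ ^ 2) := by positivity
    calc incr a y + incr b y
        = ∫⁻ x, (ENNReal.ofReal ((a x - a (x - y)) ^ 2) +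
            ENNReal.ofReal ((b x - b (x - y)) ^ 2)) := by
          rw [lintegral_add_left (measurable_incr_integrand a y), incr, incr]
      _ ≤ ∫⁻ x, (ENNReal.ofReal ((c x - c (x - y)) ^ 2) +
            (ENNReal.ofReal 2 * ENNReal.ofReal ((w x - w (x - y)) ^ 2) +
            ENNReal.ofReal (q * min 1 (‖y‖ ^ 2)) * (ENNReal.ofReal (v x ^ 2) +
              ENNReal.ofReal (v (x - y) ^ 2)))) := by
          refine lintegral_mono_ae ?_
          filter_upwards [hv, ae_compSub hv y, hw, hφ, ae_compSub hφ y, ha,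
            ae_compSub ha y, hb, ae_compSub hb y, hc, ae_compSub hc y] with
            x v1 v2 w1 f1 f2 a1 a2 b1 b2 c1 c2
          refine le_trans (ENNReal.ofReal_add (sq_nonneg _) (sq_nonneg _)).ge ?_
          rw [← ENNReal.ofReal_add (sq_nonneg _) (sq_nonneg _),
            ← ENNReal.ofReal_mul zero_le_two, ← ENNReal.ofReal_mul (by positivity),
            ← ENNReal.ofReal_add (by positivity) (by positivity),
            ← ENNReal.ofReal_add (by positivity) (by positivity)]
          refine ENNReal.ofReal_le_ofReal ?_
          rw [a1, a2, b1, b2, c1, c2]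
          -- The discrete product rule (sp - tr)² = (s - t)(sp² - tr²) + st(p - r)², with the first
          -- product on the right polarized.
          have e : ∀ s t p r : ℝ, (s * p - t * r) ^ 2 +
              (1 / 2 * (s - s * p ^ 2) - 1 / 2 * (t - t * r ^ 2)) ^ 2 =
              (1 / 2 * (s + s * p ^ 2) - 1 / 2 * (t + t * r ^ 2)) ^ 2 + s * t * (p - r) ^ 2 := by
            intro s t p r
            ring
          rw [e]
          have := mul_cutoff_sub_sq_le (W' := w (x - y)) v1 v2 w1 (hχ (x - y)) (hχq x y)
          rw [← f1, ← f2] at this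
          linarith
      _ = _ := by
          have hvm : Measurable fun x => ENNReal.ofReal (v x ^ 2) :=
            ((measurable_coeFn v).pow_const 2).ennreal_ofReal
          rw [lintegral_add_left (measurable_incr_integrand c y),
            lintegral_add_left ((measurable_incr_integrand w y).const_mul _),
            lintegral_const_mul' _ _ ENNReal.ofReal_ne_top,
            lintegral_const_mul' _ _ ENNReal.ofReal_ne_top,
            lintegral_add_left hvm, lintegral_ofReal_sq_compSub, lintegral_ofReal_sq,
            ENNReal.ofReal_mul hq, ENNReal.ofReal_ofNat, incr, incr]
          ring
  have := h.energy_le ENNReal.ofNat_ne_top (by fun_prop) hQ key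
  refine (ENNReal.mul_le_mul_iff_right (a := 2) (by simp) (by simp)).mp ?_
  rw [mul_add]
  refine this.trans (le_of_eq ?_)
  ring

/-! ### The fractional Laplacian as a relation, and its energy form -/

/-- `z = (-Δ)^{α/2} u`. -/
def HasFracLap {d : ℕ} (α : ℝ) (u z : L2 d) : Prop :=
  hat d z =ᵐ[volume] fun ξ => (freq α ξ : ℂ) * hat d u ξ

theorem mem_fracLaplacian_graph_iff {d : ℕ} {α : ℝ} {u z : L2 d} :
    (u, z) ∈ (fracLaplacian d α).graph ↔ HasFracLap α u z := by
  have hs : fracSymbolMul d α u = fun ξ => (freq α ξ : ℂ) * hat d u ξ := rfl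
  rw [LinearPMap.mem_graph_iff]
  constructor
  · rintro ⟨x, hx, hz⟩
    have h := complexify_fracLaplacian d α x
    rw [hz] at h
    rw [HasFracLap, hat_apply, h, fourier_fourierInv_eq]
    simp only at hx
    rw [← hs, ← hx]
    exact MemLp.coeFn_toLp x.2
  · intro h
    have hm : MemLp (fracSymbolMul d α u) 2 volume := (memLp_congr_ae h).mp (Lp.memLp _)
    refine ⟨⟨u, hm⟩, rfl, ?_⟩
    apply hat_injective d
    rw [hat_apply, complexify_fracLaplacian, fourier_fourierInv_eq]
    exact Lp.ext ((MemLp.coeFn_toLp hm).trans (hs ▸ h.symm))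

theorem HasFracLap.inner_comm {d : ℕ} {α : ℝ} {u z v y : L2 d} (h : HasFracLap α u z)
    (h' : HasFracLap α v y) : inner ℝ z v = inner ℝ u y := by
  rw [inner_eq_integral_hat, inner_eq_integral_hat]
  refine integral_congr_ae ?_
  filter_upwards [h, h'] with ξ h1 h2
  rw [h1, h2]
  simp only [Complex.inner, map_mul, Complex.conj_ofReal]
  congr 1
  ring

theorem HasFracLap.mult {d : ℕ} {α : ℝ} {u z : L2 d} (h : HasFracLap α u z) (m : Symbol d) :
    HasFracLap α (mult m u) (mult m z) := by
  unfold HasFracLap at h ⊢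
  filter_upwards [h, hat_mult m u, hat_mult m z] with ξ h1 h2 h3
  rw [h3, h1, h2]
  ring

/-- From |ξ|^α ≤ 1 + |ξ|^{2α}: the operator domain lies in the form domain. -/
theorem HasFracLap.energy_ne_top {d : ℕ} {α : ℝ} {u z : L2 d} (h : HasFracLap α u z) :
    energy α u ≠ ⊤ := by
  have : energy α u ≤ ‖u‖ₑ ^ 2 + ‖z‖ₑ ^ 2 := by
    rw [enorm_sq_eq_lintegral_hat, enorm_sq_eq_lintegral_hat,
      ← lintegral_add_left (measurable_hat_enorm u)]
    refine lintegral_mono_ae ?_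
    filter_upwards [h] with ξ hξ
    rw [hξ, enorm_mul, mul_pow, ← one_add_mul]
    gcongr
    have : ‖(freq α ξ : ℂ)‖ₑ = ENNReal.ofReal (freq α ξ) := by
      rw [← ofReal_norm, Complex.norm_real, Real.norm_of_nonneg (freq_nonneg _ _)]
    rw [this, ← ENNReal.ofReal_pow (freq_nonneg _ _), ← ENNReal.ofReal_one,
      ← ENNReal.ofReal_add zero_le_one (sq_nonneg _)]
    refine ENNReal.ofReal_le_ofReal ?_
    nlinarith [sq_nonneg (freq α ξ - 1)]
  exact ne_top_of_le_ne_top (by simp) this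

theorem measurable_energy_integrand {d : ℕ} (α : ℝ) (u : L2 d) :
    Measurable fun ξ => ENNReal.ofReal (freq α ξ) * ‖hat d u ξ‖ₑ ^ 2 :=
  (measurable_freq α).ennreal_ofReal.mul (measurable_hat_enorm u)

theorem enorm_sq_complex (z : ℂ) : ‖z‖ₑ ^ 2 = ENNReal.ofReal (‖z‖ ^ 2) := by
  rw [← ofReal_norm, ← ENNReal.ofReal_pow (norm_nonneg _)]

theorem energy_add_le {d : ℕ} (α : ℝ) (u v : L2 d) :
    energy α (u + v) ≤ 2 * energy α u + 2 * energy α v := by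
  rw [energy, energy, energy, ← lintegral_const_mul' _ _ ENNReal.ofNat_ne_top,
    ← lintegral_const_mul' _ _ ENNReal.ofNat_ne_top, ← lintegral_add_left
      ((measurable_energy_integrand α u).const_mul 2)]
  refine lintegral_mono_ae ?_
  filter_upwards [hat_add_ae d u v] with ξ hξ
  have : ‖hat d (u + v) ξ‖ₑ ^ 2 ≤ 2 * ‖hat d u ξ‖ₑ ^ 2 + 2 * ‖hat d v ξ‖ₑ ^ 2 := by
    rw [hξ, enorm_sq_complex, enorm_sq_complex, enorm_sq_complex, ← mul_add,
      ← ENNReal.ofReal_add (sq_nonneg _) (sq_nonneg _)]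
    refine le_trans (ENNReal.ofReal_le_ofReal ?_) ((ENNReal.ofReal_mul
      (q := ‖hat d u ξ‖ ^ 2 + ‖hat d v ξ‖ ^ 2) zero_le_two).le.trans
      (by rw [ENNReal.ofReal_ofNat]))
    have h1 := norm_add_le (hat d u ξ) (hat d v ξ)
    nlinarith [sq_nonneg (‖hat d u ξ‖ - ‖hat d v ξ‖), norm_nonneg (hat d u ξ + hat d v ξ),
      norm_nonneg (hat d u ξ), norm_nonneg (hat d v ξ)]
  calc _ ≤ ENNReal.ofReal (freq α ξ) * (2 * ‖hat d u ξ‖ₑ ^ 2 + 2 * ‖hat d v ξ‖ₑ ^ 2) := by gcongr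
    _ = _ := by ring

theorem integrable_energy {d : ℕ} {α : ℝ} {u : L2 d} (h : energy α u ≠ ⊤) :
    Integrable (fun ξ => freq α ξ * ‖hat d u ξ‖ ^ 2) volume ∧
      energy α u = ENNReal.ofReal (∫ ξ, freq α ξ * ‖hat d u ξ‖ ^ 2) := by
  have hm : Measurable fun ξ => freq α ξ * ‖hat d u ξ‖ ^ 2 :=
    (measurable_freq α).mul ((Lp.stronglyMeasurable (hat d u)).norm.measurable.pow_const 2)
  have hnn : ∀ ξ, 0 ≤ freq α ξ * ‖hat d u ξ‖ ^ 2 := fun ξ =>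
    mul_nonneg (freq_nonneg _ _) (sq_nonneg _)
  have he : energy α u = ∫⁻ ξ, ENNReal.ofReal (freq α ξ * ‖hat d u ξ‖ ^ 2) :=
    lintegral_congr fun ξ => by rw [ENNReal.ofReal_mul (freq_nonneg _ _), enorm_sq_complex]
  have hi : Integrable (fun ξ => freq α ξ * ‖hat d u ξ‖ ^ 2) volume := by
    refine ⟨hm.aestronglyMeasurable, ?_⟩
    rw [hasFiniteIntegral_iff_ofReal (Eventually.of_forall hnn), ← he]
    exact h.lt_top
  exact ⟨hi, by rw [he, ofReal_integral_eq_lintegral_ofReal hi (Eventually.of_forall hnn)]⟩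

/-- Polarization of the energy. -/
theorem HasFracLap.energy_add_eq {d : ℕ} {α : ℝ} {u z v : L2 d} (h : HasFracLap α u z)
    (hv : energy α v ≠ ⊤) :
    energy α ((1 / 2 : ℝ) • (u + v)) ≤
      energy α ((1 / 2 : ℝ) • (u - v)) + ENNReal.ofReal (inner ℝ z v) ∧
    energy α ((1 / 2 : ℝ) • (u - v)) ≠ ⊤ := by
  have hu := h.energy_ne_top
  have hs : energy α ((-1 : ℝ) • v) = energy α v := by rw [energy_smul]; simp
  have hadd : energy α ((1 / 2 : ℝ) • (u + v)) ≠ ⊤ := by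
    rw [energy_smul]
    refine ENNReal.mul_ne_top ENNReal.ofReal_ne_top
      (ne_top_of_le_ne_top ?_ (energy_add_le α u v))
    simp [hu, hv, ENNReal.mul_eq_top]
  have hsub : energy α ((1 / 2 : ℝ) • (u - v)) ≠ ⊤ := by
    rw [energy_smul, sub_eq_add_neg, ← neg_one_smul ℝ v]
    refine ENNReal.mul_ne_top ENNReal.ofReal_ne_top
      (ne_top_of_le_ne_top ?_ (energy_add_le α u _))
    rw [hs]
    simp [hu, hv, ENNReal.mul_eq_top]
  refine ⟨?_, hsub⟩
  obtain ⟨i1, e1⟩ := integrable_energy hadd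
  obtain ⟨i2, e2⟩ := integrable_energy hsub
  rw [e1, e2]
  -- For real numbers this is an equality. The inner product may be negative, where `ENNReal.ofReal`
  -- truncates it, so only an inequality remains.
  refine (ENNReal.ofReal_le_ofReal (le_of_eq ?_)).trans ENNReal.ofReal_add_le
  rw [inner_eq_integral_hat]
  have key : ∀ᵐ ξ, freq α ξ * ‖hat d ((1 / 2 : ℝ) • (u + v)) ξ‖ ^ 2 -
      freq α ξ * ‖hat d ((1 / 2 : ℝ) • (u - v)) ξ‖ ^ 2 = inner ℝ (hat d z ξ) (hat d v ξ) := by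
    filter_upwards [hat_smul_ae d (1 / 2) (u + v), hat_smul_ae d (1 / 2) (u - v),
      hat_add_ae d u v, hat_sub_ae d u v, h] with ξ h1 h2 h3 h4 h5
    rw [h1, h2, h3, h4, h5, ← Complex.normSq_eq_norm_sq, ← Complex.normSq_eq_norm_sq]
    simp only [Complex.normSq_apply, Complex.inner, Complex.mul_re, Complex.mul_im,
      Complex.ofReal_re, Complex.ofReal_im, Complex.add_re, Complex.add_im, Complex.sub_re,
      Complex.sub_im, Complex.conj_re, Complex.conj_im]
    ring
  rw [← integral_congr_ae key, integral_sub i1 i2]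
  ring

/-- Cauchy–Schwarz inequality for the energy form. -/
theorem HasFracLap.inner_sq_le {d : ℕ} {α : ℝ} {u v y : L2 d} (h : HasFracLap α v y)
    (hu : energy α u ≠ ⊤) :
    ENNReal.ofReal ((inner ℝ u y) ^ 2) ≤ energy α u * energy α v := by
  obtain ⟨i1, e1⟩ := integrable_energy hu
  obtain ⟨i2, e2⟩ := integrable_energy h.energy_ne_top
  set A := ∫ ξ, freq α ξ * ‖hat d u ξ‖ ^ 2 with hA
  set B := ∫ ξ, freq α ξ * ‖hat d v ξ‖ ^ 2 with hB
  have hA0 : 0 ≤ A := integral_nonneg fun ξ => mul_nonneg (freq_nonneg _ _) (sq_nonneg _)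
  rw [e1, e2, ← ENNReal.ofReal_mul hA0]
  refine ENNReal.ofReal_le_ofReal ?_
  -- The quadratic polynomial in s is the energy of su + v, hence nonnegative, and its discriminant
  -- gives the claim.
  have hk : ∀ s : ℝ, 0 ≤ A * (s * s) + (2 * inner ℝ u y) * s + B := by
    intro s
    have i3 : Integrable (fun ξ => inner ℝ (hat d u ξ) (hat d y ξ)) volume :=
      L2.integrable_inner (𝕜 := ℝ) (hat d u) (hat d y)
    have : A * (s * s) + (2 * inner ℝ u y) * s + B = ∫ ξ, (freq α ξ * ‖hat d u ξ‖ ^ 2 * (s * s) +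
        (2 * s) * inner ℝ (hat d u ξ) (hat d y ξ) + freq α ξ * ‖hat d v ξ‖ ^ 2) := by
      have i4 : Integrable (fun ξ => freq α ξ * ‖hat d u ξ‖ ^ 2 * (s * s) +
          (2 * s) * inner ℝ (hat d u ξ) (hat d y ξ)) volume :=
        (i1.mul_const _).add (i3.const_mul _)
      rw [integral_add i4 i2,
        integral_add (i1.mul_const _) (i3.const_mul _), integral_mul_const, integral_const_mul,
        inner_eq_integral_hat]
      ring
    rw [this]
    refine integral_nonneg_of_ae ?_
    filter_upwards [h] with ξ h1
    rw [h1, ← Complex.normSq_eq_norm_sq, ← Complex.normSq_eq_norm_sq]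
    simp only [Complex.normSq_apply, Complex.inner, Complex.mul_re, Complex.mul_im,
      Complex.ofReal_re, Complex.ofReal_im, Complex.conj_re, Complex.conj_im]
    have hf := freq_nonneg α ξ
    have := mul_nonneg hf (add_nonneg
      (sq_nonneg (s * (hat d u ξ).re + (hat d v ξ).re))
      (sq_nonneg (s * (hat d u ξ).im + (hat d v ξ).im)))
    refine this.trans (le_of_eq ?_)
    ring
  have := discrim_le_zero hk
  rw [discrim] at this
  nlinarith

/-! ### Convolution with probability densities -/

theorem real_inner_eq_mul (a b : ℝ) : inner ℝ a b = a * b := by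
  rw [real_inner_eq_re_inner, RCLike.inner_apply, conj_trivial, mul_comm, RCLike.re_to_real]

/-- Test with the negative part: ⟨g, g⁻⟩ = -‖g⁻‖². -/
theorem ae_nonneg_of_inner_nonneg {d : ℕ} {g : L2 d}
    (h : ∀ w : L2 d, (∀ᵐ x, 0 ≤ w x) → 0 ≤ inner ℝ g w) : ∀ᵐ x, 0 ≤ g x := by
  have hn : (Lp.negPart g : L2 d) =ᵐ[volume] fun x => max (-g x) 0 := Lp.coeFn_negPart_eq_max g
  have h0 := h (Lp.negPart g) (by filter_upwards [hn] with x hx; rw [hx]; exact le_max_right _ _)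
  have h1 : inner ℝ g (Lp.negPart g) = -‖(Lp.negPart g : L2 d)‖ ^ 2 := by
    rw [← real_inner_self_eq_norm_sq, L2.inner_def, L2.inner_def, ← integral_neg]
    refine integral_congr_ae ?_
    filter_upwards [hn] with x hx
    rw [hx]
    simp only [real_inner_eq_mul]
    rcases max_cases (-g x) 0 with ⟨e, _⟩ | ⟨e, _⟩ <;> rw [e] <;> ring
  have h2 : (Lp.negPart g : L2 d) = 0 := by
    rw [← norm_eq_zero]
    nlinarith [norm_nonneg (Lp.negPart g : L2 d)]
  rw [h2] at hn
  filter_upwards [hn, Lp.coeFn_zero ℝ 2 (volume : Measure (Space d))] with x h3 h4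
  rw [h4] at h3
  have := le_max_left (-g x) 0
  rw [← h3] at this
  simpa using this

theorem lintegral_mul_compSub_comm {d : ℕ} (k F : Space d → ℝ≥0∞) (x : Space d) :
    ∫⁻ y, k (x - y) * F y = ∫⁻ z, k z * F (x - z) := by
  rw [← lintegral_sub_left_eq_self (fun z => k z * F (x - z)) x]
  simp only [sub_sub_cancel]

section Kernel

variable {d : ℕ} {k : Space d → ℝ≥0∞} {m : Symbol d}

theorem integrable_toReal_kernel (hk : Measurable k) (h1 : ∫⁻ x, k x = 1) :
    Integrable (fun x => (k x).toReal) volume :=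
  integrable_toReal_of_lintegral_ne_top hk.aemeasurable (by rw [h1]; simp)

/-- The weak form of the statement that the multiplier is convolution with k: Fubini's theorem in z
and ξ, where the z-integral of k against the character is the Fourier transform of k. Complex inner
products are used inside, so that the character factors out, and real parts are taken at both ends.
-/
theorem inner_mult_eq_integral_transl (hk : Measurable k) (h1 : ∫⁻ x, k x = 1)
    (hm : ∀ ξ, 𝓕 (fun x => ((k x).toReal : ℂ)) ξ = (m ξ : ℂ)) (f w : L2 d) :
    Integrable (fun z => (k z).toReal * inner ℝ (transl z f) w) volume ∧
      inner ℝ (mult m f) w = ∫ z, (k z).toReal * inner ℝ (transl z f) w := by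
  have hki := integrable_toReal_kernel hk h1
  have hC : Integrable (fun ξ => inner ℂ (hat d f ξ) (hat d w ξ)) volume :=
    L2.integrable_inner (𝕜 := ℂ) (hat d f) (hat d w)
  set C : Space d → ℂ := fun ξ => inner ℂ (hat d f ξ) (hat d w ξ)
  set e : Space d → Space d → ℂ := fun z ξ => (Real.fourierChar (-inner ℝ z ξ) : ℂ)
  have hJ : Integrable (fun p : Space d × Space d =>
      ((k p.1).toReal : ℂ) * C p.2 * (starRingEnd ℂ) (e p.1 p.2)) (volume.prod volume) := by
    refine Integrable.mul_bdd (c := 1) (hki.ofReal.mul_prod hC) ?_ ?_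
    · exact (Complex.continuous_conj.measurable.comp
        measurable_fourierChar_inner).aestronglyMeasurable
    · refine Eventually.of_forall fun p => ?_
      rw [RCLike.norm_conj, Circle.norm_coe]
  have hin : ∀ z, (((k z).toReal * inner ℝ (transl z f) w : ℝ)) =
      Complex.re (∫ ξ, ((k z).toReal : ℂ) * C ξ * (starRingEnd ℂ) (e z ξ)) := by
    intro z
    have hz : Integrable (fun ξ => C ξ * (starRingEnd ℂ) (e z ξ)) volume := by
      refine Integrable.mul_bdd (c := 1) hC ?_ ?_
      · exact (Complex.continuous_conj.measurable.comp (measurable_fourierChar_inner.comp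
          measurable_prodMk_left)).aestronglyMeasurable
      · refine Eventually.of_forall fun p => ?_
        rw [RCLike.norm_conj, Circle.norm_coe]
    simp_rw [mul_assoc]
    rw [integral_const_mul, Complex.re_ofReal_mul, ← RCLike.re_to_complex, ← integral_re hz,
      inner_eq_integral_hat]
    congr 1
    refine integral_congr_ae ?_
    filter_upwards [hat_transl z f] with ξ hξ
    rw [hξ]
    simp only [C, e, Complex.inner, RCLike.inner_apply, map_mul, RCLike.re_to_complex]
    congr 1
    ring
  have hint : Integrable (fun z => (k z).toReal * inner ℝ (transl z f) w) volume := by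
    simp_rw [hin]
    exact hJ.integral_prod_left.re
  refine ⟨hint, ?_⟩
  simp_rw [hin]
  have hs := integral_re hJ.integral_prod_left
  simp only [RCLike.re_to_complex] at hs
  rw [hs, integral_integral_swap hJ, inner_eq_integral_hat]
  have hmul : ∀ ξ, ∫ z, ((k z).toReal : ℂ) * C ξ * (starRingEnd ℂ) (e z ξ) = (m ξ : ℂ) * C ξ := by
    intro ξ
    have h2 := congrArg (starRingEnd ℂ) (hm ξ)
    rw [Real.fourier_eq, ← integral_conj, Complex.conj_ofReal] at h2
    rw [← h2, ← integral_mul_const]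
    congr 1
    ext z
    simp only [Circle.smul_def, smul_eq_mul, map_mul, Complex.conj_ofReal, e]
    ring
  simp_rw [hmul]
  obtain ⟨M, hM⟩ := m.bounded
  have hmC : Integrable (fun ξ => (m ξ : ℂ) * C ξ) volume := by
    refine Integrable.bdd_mul (c := M) hC ?_ ?_
    · exact (Complex.measurable_ofReal.comp m.measurable).aestronglyMeasurable
    · refine Eventually.of_forall fun ξ => ?_
      rw [Complex.norm_real]
      exact hM ξ
  rw [← RCLike.re_to_complex, ← integral_re hmC]
  refine integral_congr_ae ?_
  filter_upwards [hat_mult m f] with ξ hξ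
  rw [hξ]
  simp only [C, Complex.inner, RCLike.inner_apply, map_mul, RCLike.re_to_complex,
    Complex.conj_ofReal]
  congr 1
  ring

theorem lintegral_transl_mul (z : Space d) {f w : L2 d} (hf : ∀ᵐ x, 0 ≤ f x)
    (hw : ∀ᵐ x, 0 ≤ w x) :
    ∫⁻ x, ENNReal.ofReal (f (x - z)) * ENNReal.ofReal (w x) =
      ENNReal.ofReal (inner ℝ (transl z f) w) ∧ 0 ≤ inner ℝ (transl z f) w := by
  have h0 : ∀ᵐ x, 0 ≤ inner ℝ (transl z f x) (w x) := by
    filter_upwards [ae_compSub hf z, coeFn_transl z f, hw] with x h1 h2 h3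
    rw [h2]
    simp only [real_inner_eq_mul]
    positivity
  constructor
  · rw [L2.inner_def, ofReal_integral_eq_lintegral_ofReal (L2.integrable_inner _ _) h0]
    refine lintegral_congr_ae ?_
    filter_upwards [ae_compSub hf z, coeFn_transl z f, hw] with x h1 h2 h3
    rw [h2, ← ENNReal.ofReal_mul h1]
    simp only [real_inner_eq_mul]
  · rw [L2.inner_def]
    exact integral_nonneg_of_ae h0

theorem mult_nonneg_of_kernel (hk : Measurable k) (h1 : ∫⁻ x, k x = 1)
    (hm : ∀ ξ, 𝓕 (fun x => ((k x).toReal : ℂ)) ξ = (m ξ : ℂ)) {f : L2 d}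
    (hf : ∀ᵐ x, 0 ≤ f x) : ∀ᵐ x, 0 ≤ mult m f x := by
  refine ae_nonneg_of_inner_nonneg fun w hw => ?_
  rw [(inner_mult_eq_integral_transl hk h1 hm f w).2]
  exact integral_nonneg fun z =>
    mul_nonneg ENNReal.toReal_nonneg (lintegral_transl_mul z hf hw).2

/-- Convolution with a probability density is the multiplier by its Fourier transform. -/
theorem lintegral_kernel_ae_eq_mult (hk : Measurable k) (h1 : ∫⁻ x, k x = 1)
    (hm : ∀ ξ, 𝓕 (fun x => ((k x).toReal : ℂ)) ξ = (m ξ : ℂ)) {f : L2 d}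
    (hf : ∀ᵐ x, 0 ≤ f x) :
    (fun x => ∫⁻ z, k z * ENNReal.ofReal (f (x - z))) =ᵐ[volume]
      fun x => ENNReal.ofReal (mult m f x) := by
  have hF : Measurable fun x => ENNReal.ofReal (f x) := (measurable_coeFn f).ennreal_ofReal
  have hj : Measurable fun p : Space d × Space d => k p.2 * ENNReal.ofReal (f (p.1 - p.2)) :=
    (hk.comp measurable_snd).mul (hF.comp (measurable_fst.sub measurable_snd))
  have hnn := mult_nonneg_of_kernel hk h1 hm hf
  -- Integrating over a set of finite measure amounts to pairing with its indicator, an element of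
  -- L², so the weak form applies.
  refine ae_eq_of_forall_setLIntegral_eq_of_sigmaFinite hj.lintegral_prod_right'
    (measurable_coeFn _).ennreal_ofReal fun S hS hμ => ?_
  set w : L2 d := indicatorConstLp 2 hS hμ.ne (1 : ℝ)
  have hwS : w =ᵐ[volume] S.indicator fun _ => (1 : ℝ) := indicatorConstLp_coeFn
  have hw0 : ∀ᵐ x, 0 ≤ w x := by
    filter_upwards [hwS] with x hx
    rw [hx]
    exact Set.indicator_nonneg (fun _ _ => zero_le_one) x
  have hset : ∀ G : Space d → ℝ≥0∞, ∫⁻ x in S, G x = ∫⁻ x, G x * ENNReal.ofReal (w x) := by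
    intro G
    rw [← lintegral_indicator hS]
    refine lintegral_congr_ae ?_
    filter_upwards [hwS] with x hx
    rw [hx]
    by_cases h : x ∈ S <;> simp [h]
  rw [hset, hset]
  have hkt : ∀ᵐ z, k z < ⊤ := ae_lt_top hk (by rw [h1]; simp)
  obtain ⟨hi, he⟩ := inner_mult_eq_integral_transl hk h1 hm f w
  calc ∫⁻ x, (∫⁻ z, k z * ENNReal.ofReal (f (x - z))) * ENNReal.ofReal (w x)
      = ∫⁻ x, ∫⁻ z, k z * (ENNReal.ofReal (f (x - z)) * ENNReal.ofReal (w x)) := by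
        refine lintegral_congr fun x => ?_
        rw [← lintegral_mul_const' _ _ ENNReal.ofReal_ne_top]
        simp_rw [mul_assoc]
    _ = ∫⁻ z, k z * ENNReal.ofReal (inner ℝ (transl z f) w) := by
        rw [lintegral_lintegral_swap]
        · refine lintegral_congr fun z => ?_
          rw [lintegral_const_mul'', (lintegral_transl_mul z hf hw0).1]
          exact ((hF.comp (measurable_id.sub_const z)).mul
            (measurable_coeFn w).ennreal_ofReal).aemeasurable
        · exact ((hk.comp measurable_snd).mul ((hF.comp (measurable_fst.sub measurable_snd)).mul
            ((measurable_coeFn w).ennreal_ofReal.comp measurable_fst))).aemeasurable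
    _ = ENNReal.ofReal (inner ℝ (mult m f) w) := by
        rw [he, ofReal_integral_eq_lintegral_ofReal hi (Eventually.of_forall fun z =>
          mul_nonneg ENNReal.toReal_nonneg (lintegral_transl_mul z hf hw0).2)]
        refine lintegral_congr_ae ?_
        filter_upwards [hkt] with z hz
        rw [ENNReal.ofReal_mul ENNReal.toReal_nonneg, ENNReal.ofReal_toReal hz.ne]
    _ = ∫⁻ x, ENNReal.ofReal (mult m f x) * ENNReal.ofReal (w x) := by
        rw [L2.inner_def, ofReal_integral_eq_lintegral_ofReal (L2.integrable_inner _ _)]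
        · refine lintegral_congr_ae ?_
          filter_upwards [hnn] with x hx
          rw [← ENNReal.ofReal_mul hx]
          simp only [real_inner_eq_mul]
        · filter_upwards [hnn, hw0] with x h2 h3
          simp only [real_inner_eq_mul]
          exact mul_nonneg h2 h3

end Kernel

/-! ### Mollification -/

/-- A bump function supported in the ball of radius `1 / (n + 1)`. -/
def mollBump (d : ℕ) (n : ℕ) : ContDiffBump (0 : Space d) where
  rIn := 1 / (2 * ((n : ℝ) + 1))
  rOut := 1 / ((n : ℝ) + 1)
  rIn_pos := by positivity
  rIn_lt_rOut := by
    apply one_div_lt_one_div_of_lt <;> linarith [(n.cast_nonneg : (0 : ℝ) ≤ n)]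

/-- The standard mollifier. -/
def moll (d : ℕ) (n : ℕ) : Space d → ℝ := (mollBump d n).normed volume

section Mollifier

variable {d : ℕ} (n : ℕ)

theorem moll_nonneg (x : Space d) : 0 ≤ moll d n x := (mollBump d n).nonneg_normed x

theorem contDiff_moll : ContDiff ℝ ∞ (moll d n) := (mollBump d n).contDiff_normed

theorem hasCompactSupport_moll : HasCompactSupport (moll d n) :=
  (mollBump d n).hasCompactSupport_normed

theorem integral_moll : ∫ x, moll d n x = 1 := (mollBump d n).integral_normed

theorem moll_neg (x : Space d) : moll d n (-x) = moll d n x := (mollBump d n).normed_neg x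

theorem moll_eq_zero {x : Space d} (hx : 1 / ((n : ℝ) + 1) ≤ ‖x‖) : moll d n x = 0 := by
  by_contra h
  have : x ∈ Function.support (moll d n) := h
  rw [moll, ContDiffBump.support_normed_eq, mem_ball_zero_iff] at this
  exact absurd this (not_lt.mpr hx)

theorem integrable_moll : Integrable (moll d n) volume :=
  (contDiff_moll n).continuous.integrable_of_hasCompactSupport (hasCompactSupport_moll n)

variable (d) in
/-- The mollifier as a Schwartz function. -/
def mollSchwartz : SchwartzMap (Space d) ℂ :=
  ((hasCompactSupport_moll (d := d) n).comp_left (g := Complex.ofRealCLM)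
    (map_zero _)).toSchwartzMap (Complex.ofRealCLM.contDiff.comp (contDiff_moll n))

theorem fourier_mollSchwartz (ξ : Space d) :
    (𝓕 (mollSchwartz d n)) ξ = 𝓕 (fun x : Space d => (moll d n x : ℂ)) ξ := by
  rw [SchwartzMap.fourier_coe]
  rfl

theorem fourier_moll_conj (ξ : Space d) :
    (starRingEnd ℂ) (𝓕 (fun x : Space d => (moll d n x : ℂ)) ξ) =
      𝓕 (fun x : Space d => (moll d n x : ℂ)) ξ := by
  rw [Real.fourier_eq, ← integral_conj, ← integral_neg_eq_self]
  congr 1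
  ext v
  rw [moll_neg]
  simp only [Circle.smul_def, smul_eq_mul, map_mul, Complex.conj_ofReal, inner_neg_left, neg_neg]
  congr 1
  rw [← Circle.coe_inv_eq_conj, ← AddChar.map_neg_eq_inv]

theorem fourier_moll_eq_ofReal (ξ : Space d) :
    𝓕 (fun x : Space d => (moll d n x : ℂ)) ξ =
      ((𝓕 (mollSchwartz d n) ξ).re : ℂ) := by
  rw [fourier_mollSchwartz]
  exact (Complex.conj_eq_iff_re.mp (fourier_moll_conj n ξ)).symm

theorem re_fourier_moll (ξ : Space d) : (𝓕 (mollSchwartz d n) ξ).re =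
    ∫ y, Real.cos (2 * Real.pi * inner ℝ y ξ) * moll d n y :=
  (integral_cos_mul_of_fourier ξ (fourier_moll_eq_ofReal n ξ) (integrable_moll n)).symm

theorem abs_re_fourier_moll_le (ξ : Space d) : |(𝓕 (mollSchwartz d n) ξ).re| ≤ 1 := by
  rw [re_fourier_moll, ← Real.norm_eq_abs, ← integral_moll (d := d) n]
  refine norm_integral_le_of_norm_le (integrable_moll n) (Eventually.of_forall fun y => ?_)
  rw [norm_mul, Real.norm_of_nonneg (moll_nonneg n y), Real.norm_eq_abs]
  have := Real.abs_cos_le_one (2 * Real.pi * inner ℝ y ξ)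
  nlinarith [moll_nonneg n y]

variable (d) in
/-- The Fourier transform of the mollifier. -/
def mollSymbol : Symbol d where
  toFun ξ := (𝓕 (mollSchwartz d n) ξ).re
  measurable := (Complex.continuous_re.comp (SchwartzMap.continuous _)).measurable
  even ξ := by
    rw [re_fourier_moll, re_fourier_moll]
    simp only [inner_neg_right, mul_neg, Real.cos_neg]
  bounded := ⟨1, abs_re_fourier_moll_le n⟩

theorem abs_mollSymbol_le (ξ : Space d) : |mollSymbol d n ξ| ≤ 1 := abs_re_fourier_moll_le n ξ

theorem integrable_cos_mul_moll (ξ : Space d) :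
    Integrable (fun y => Real.cos (2 * Real.pi * inner ℝ y ξ) * moll d n y) volume := by
  refine (integrable_moll n).bdd_mul (c := 1) ?_ (Eventually.of_forall fun y =>
    Real.abs_cos_le_one _)
  exact Continuous.aestronglyMeasurable (by fun_prop)

variable (d) in
/-- The operator of convolution with the mollifier. -/
def mollify : L2 d →L[ℝ] L2 d := mult (mollSymbol d n)

theorem norm_mollify_le (u : L2 d) : ‖mollify d n u‖ ≤ ‖u‖ := by
  have := norm_mult_le (mollSymbol d n) (abs_mollSymbol_le n) u
  rwa [one_mul] at this

end Mollifier

/-- |cos θ - 1| ≤ |θ|, and the mollifier lives on ‖y‖ < 1/(n + 1). -/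
theorem tendsto_mollSymbol {d : ℕ} (ξ : Space d) :
    Tendsto (fun n => mollSymbol d n ξ) atTop (𝓝 1) := by
  have hbound : ∀ n, |mollSymbol d n ξ - 1| ≤ 2 * Real.pi * ‖ξ‖ * (1 / ((n : ℝ) + 1)) := by
    intro n
    have e : mollSymbol d n ξ - 1 =
        ∫ y, (Real.cos (2 * Real.pi * inner ℝ y ξ) * moll d n y - moll d n y) := by
      rw [integral_sub (integrable_cos_mul_moll n ξ) (integrable_moll n), integral_moll,
        ← re_fourier_moll]
      rfl
    rw [e, ← Real.norm_eq_abs]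
    have hi := (integrable_moll (d := d) n).const_mul (2 * Real.pi * ‖ξ‖ * (1 / ((n : ℝ) + 1)))
    refine (norm_integral_le_of_norm_le hi (Eventually.of_forall fun y => ?_)).trans ?_
    · rw [← sub_one_mul, norm_mul, Real.norm_of_nonneg (moll_nonneg n y)]
      rcases le_or_gt (1 / ((n : ℝ) + 1)) ‖y‖ with h | h
      · rw [moll_eq_zero n h, mul_zero, mul_zero]
      · refine mul_le_mul_of_nonneg_right ?_ (moll_nonneg n y)
        have h1 := Real.abs_cos_sub_cos_le (2 * Real.pi * inner ℝ y ξ) 0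
        rw [Real.cos_zero, sub_zero] at h1
        refine (le_of_eq (Real.norm_eq_abs _)).trans (h1.trans ?_)
        have h9 : |inner ℝ y ξ| ≤ ‖ξ‖ * (1 / ((n : ℝ) + 1)) := by
          refine (abs_real_inner_le_norm y ξ).trans ?_
          rw [mul_comm]
          gcongr
        rw [abs_mul, abs_of_nonneg (by positivity), mul_assoc (2 * Real.pi)]
        exact mul_le_mul_of_nonneg_left h9 (by positivity)
    · rw [integral_const_mul, integral_moll, mul_one]
  rw [tendsto_iff_norm_sub_tendsto_zero]
  refine squeeze_zero (fun _ => norm_nonneg _) hbound ?_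
  have := (tendsto_one_div_add_atTop_nhds_zero_nat (𝕜 := ℝ)).const_mul (2 * Real.pi * ‖ξ‖)
  rwa [mul_zero] at this

theorem tendsto_mollify {d : ℕ} (u : L2 d) : Tendsto (fun n => mollify d n u) atTop (𝓝 u) :=
  tendsto_mult (fun n => abs_mollSymbol_le n) tendsto_mollSymbol u

/-- The transform of a Schwartz function decays faster than ‖ξ‖^{-2}, while |ξ|^α ≤ 1 + |ξ|². Hence
mollification maps L² into the domain of the fractional Laplacian. -/
theorem exists_freq_mul_mollSymbol_le {d : ℕ} {α : ℝ} (h0 : 0 < α) (h2 : α ≤ 2) (n : ℕ) :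
    ∃ C, ∀ ξ : Space d, |freq α ξ * mollSymbol d n ξ| ≤ C := by
  obtain ⟨C, -, hC⟩ := (𝓕 (mollSchwartz d n)).decay 2 0
  refine ⟨1 + (2 * Real.pi) ^ 2 * C, fun ξ => ?_⟩
  have h3 := hC ξ
  rw [norm_iteratedFDeriv_zero] at h3
  have h4 := abs_mollSymbol_le n ξ
  have h5 : |mollSymbol d n ξ| ≤ ‖𝓕 (mollSchwartz d n) ξ‖ := Complex.abs_re_le_norm _
  rw [abs_mul, abs_of_nonneg (freq_nonneg α ξ)]
  have h6 := mul_le_mul_of_nonneg_right (freq_le_one_add_sq h0 h2 ξ)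
    (abs_nonneg (mollSymbol d n ξ))
  have h7 := mul_le_mul_of_nonneg_left h5 (sq_nonneg ‖ξ‖)
  have h8 : (2 * Real.pi) ^ 2 * (‖ξ‖ ^ 2 * |mollSymbol d n ξ|) ≤ (2 * Real.pi) ^ 2 * C := by
    gcongr
    linarith
  nlinarith

/-- The symbol of the fractional Laplacian of the mollification. -/
def fracMollSymbol (d : ℕ) {α : ℝ} (h0 : 0 < α) (h2 : α ≤ 2) (n : ℕ) : Symbol d where
  toFun ξ := freq α ξ * mollSymbol d n ξ
  measurable := (measurable_freq α).mul (mollSymbol d n).measurable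
  even ξ := by rw [freq_neg, (mollSymbol d n).even]
  bounded := exists_freq_mul_mollSymbol_le h0 h2 n

/-- Mollified functions lie in the domain of the fractional Laplacian. -/
theorem hasFracLap_mollify {d : ℕ} {α : ℝ} (h0 : 0 < α) (h2 : α ≤ 2) (n : ℕ) (u : L2 d) :
    HasFracLap α (mollify d n u) (mult (fracMollSymbol d h0 h2 n) u) := by
  unfold HasFracLap
  filter_upwards [hat_mult (fracMollSymbol d h0 h2 n) u, hat_mult (mollSymbol d n) u] with ξ h3 h4
  have h4' : hat d (mollify d n u) ξ = (mollSymbol d n ξ : ℂ) * hat d u ξ := h4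
  rw [h3, h4']
  simp only [fracMollSymbol]
  push_cast
  ring

theorem energy_mollify_le {d : ℕ} (α : ℝ) (n : ℕ) (u : L2 d) :
    energy α (mollify d n u) ≤ energy α u := by
  refine lintegral_mono_ae ?_
  filter_upwards [hat_mult (mollSymbol d n) u] with ξ h
  have h' : hat d (mollify d n u) ξ = (mollSymbol d n ξ : ℂ) * hat d u ξ := h
  rw [h', enorm_sq_complex, enorm_sq_complex]
  gcongr
  rw [norm_mul, Complex.norm_real, Real.norm_eq_abs]
  have := mul_le_mul_of_nonneg_right (abs_mollSymbol_le n ξ) (norm_nonneg (hat d u ξ))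
  rwa [one_mul] at this

/-- The smooth representative of the mollification of `f`. -/
def mollFun {d : ℕ} (n : ℕ) (f : L2 d) : Space d → ℝ :=
  convolution (moll d n) f (ContinuousLinearMap.lsmul ℝ ℝ) volume

section MollFun

variable {d : ℕ} (n : ℕ) (f : L2 d)

theorem locallyIntegrable_coeFn : LocallyIntegrable f (volume : Measure (Space d)) :=
  (Lp.memLp f).locallyIntegrable one_le_two

theorem contDiff_mollFun : ContDiff ℝ ∞ (mollFun n f) :=
  (hasCompactSupport_moll n).contDiff_convolution_left _ (contDiff_moll n)
    (locallyIntegrable_coeFn f)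

theorem mollFun_apply (x : Space d) : mollFun n f x = ∫ t, moll d n t * f (x - t) := rfl

theorem integrable_mollFun_integrand (x : Space d) :
    Integrable (fun t => moll d n t * f (x - t)) volume :=
  (hasCompactSupport_moll n).convolutionExists_left (ContinuousLinearMap.lsmul ℝ ℝ)
    (contDiff_moll n).continuous (locallyIntegrable_coeFn f) x

theorem ae_sub_left {p : Space d → Prop} (h : ∀ᵐ x, p x) (x : Space d) : ∀ᵐ t, p (x - t) :=
  (Measure.measurePreserving_sub_left volume x).quasiMeasurePreserving.ae h

theorem measurable_moll : Measurable (moll d n) := (contDiff_moll n).continuous.measurable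

theorem lintegral_moll : ∫⁻ x, ENNReal.ofReal (moll d n x) = 1 := by
  rw [← ofReal_integral_eq_lintegral_ofReal (integrable_moll n)
    (Eventually.of_forall (moll_nonneg n)), integral_moll, ENNReal.ofReal_one]

theorem fourier_toReal_moll (ξ : Space d) :
    𝓕 (fun x : Space d => ((ENNReal.ofReal (moll d n x)).toReal : ℂ)) ξ =
      (mollSymbol d n ξ : ℂ) := by
  simp_rw [ENNReal.toReal_ofReal (moll_nonneg n _)]
  exact fourier_moll_eq_ofReal n ξ

variable {f}

theorem ofReal_mollFun (hf : ∀ᵐ x, 0 ≤ f x) (x : Space d) :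
    ENNReal.ofReal (mollFun n f x) =
      ∫⁻ t, ENNReal.ofReal (moll d n t) * ENNReal.ofReal (f (x - t)) := by
  rw [mollFun_apply, ofReal_integral_eq_lintegral_ofReal (integrable_mollFun_integrand n f x)]
  · exact lintegral_congr fun t => by rw [ENNReal.ofReal_mul (moll_nonneg n t)]
  · filter_upwards [ae_sub_left hf x] with t ht
    exact mul_nonneg (moll_nonneg n t) ht

theorem mollFun_nonneg (hf : ∀ᵐ x, 0 ≤ f x) (x : Space d) : 0 ≤ mollFun n f x := by
  rw [mollFun_apply]
  refine integral_nonneg_of_ae ?_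
  filter_upwards [ae_sub_left hf x] with t ht
  exact mul_nonneg (moll_nonneg n t) ht

theorem mollFun_le_one (hf : ∀ᵐ x, f x ≤ 1) (x : Space d) : mollFun n f x ≤ 1 := by
  rw [mollFun_apply, ← integral_moll (d := d) n]
  refine integral_mono_ae (integrable_mollFun_integrand n f x) (integrable_moll n) ?_
  filter_upwards [ae_sub_left hf x] with t ht
  have := mul_le_mul_of_nonneg_left ht (moll_nonneg n t)
  rwa [mul_one] at this

theorem mollFun_eq_const {c : ℝ} {x : Space d}
    (h : ∀ᵐ y, dist y x < 1 / ((n : ℝ) + 1) → f y = c) : mollFun n f x = c := by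
  have e : ∀ᵐ t, moll d n t * f (x - t) = moll d n t * c := by
    filter_upwards [ae_sub_left h x] with t ht
    rcases le_or_gt (1 / ((n : ℝ) + 1)) ‖t‖ with h1 | h1
    · rw [moll_eq_zero n h1, zero_mul, zero_mul]
    · rw [ht]
      rwa [dist_eq_norm, sub_sub_cancel_left, norm_neg]
  rw [mollFun_apply, integral_congr_ae e, integral_mul_const, integral_moll, one_mul]

/-- Identifies the multiplier with the pointwise convolution. Nonnegativity of f enters because
convolution with a density was identified only for [0, ∞]-valued integrals. -/
theorem mollify_ae_eq (hf : ∀ᵐ x, 0 ≤ f x) : mollify d n f =ᵐ[volume] mollFun n f := by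
  have hk : Measurable fun x : Space d => ENNReal.ofReal (moll d n x) :=
    (measurable_moll n).ennreal_ofReal
  have h1 := lintegral_kernel_ae_eq_mult hk (lintegral_moll n) (fourier_toReal_moll n) hf
  have h2 := mult_nonneg_of_kernel hk (lintegral_moll n) (fourier_toReal_moll n) hf
  filter_upwards [h1, h2] with x h3 h4
  rw [← ofReal_mollFun n hf] at h3
  exact ((ENNReal.ofReal_eq_ofReal_iff (mollFun_nonneg n hf x) h4).mp h3).symm

theorem tsupport_mollFun_subset {S : Set (Space d)} (hS : ∀ᵐ x, x ∉ S → f x = 0) :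
    tsupport (mollFun n f) ⊆ Metric.cthickening (1 / ((n : ℝ) + 1)) S := by
  refine closure_minimal (fun x hx => ?_) Metric.isClosed_cthickening
  by_contra h
  refine hx (mollFun_eq_const n ?_)
  filter_upwards [hS] with y hy hd
  refine hy fun hyS => h ?_
  exact Metric.mem_cthickening_of_dist_le x y _ S hyS (by rw [dist_comm]; exact hd.le)

end MollFun

/-- Mollifications of functions with compact support are test functions. -/
theorem mollify_mem_testFunctions {d : ℕ} {S N : Set (Space d)} {n : ℕ} (hS : IsCompact S)
    (hN : Metric.cthickening (1 / ((n : ℝ) + 1)) S ⊆ N) {f : L2 d} (hf : ∀ᵐ x, 0 ≤ f x)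
    (hfS : ∀ᵐ x, x ∉ S → f x = 0) : mollify d n f ∈ testFunctions d N := by
  have hsub := tsupport_mollFun_subset n hfS
  exact ⟨mollFun n f, contDiff_mollFun n f,
    hS.cthickening.of_isClosed_subset (isClosed_tsupport _) hsub, hsub.trans hN,
    mollify_ae_eq n hf⟩

theorem eventually_cthickening_subset {d : ℕ} {S N : Set (Space d)} (hS : IsCompact S)
    (hN : IsOpen N) (hSN : S ⊆ N) :
    ∀ᶠ n : ℕ in atTop, Metric.cthickening (1 / ((n : ℝ) + 1)) S ⊆ N := by
  obtain ⟨δ, hδ, hδN⟩ := hS.exists_cthickening_subset_open hN hSN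
  have h1 : ∀ᶠ n : ℕ in atTop, 1 / ((n : ℝ) + 1) < δ :=
    (tendsto_one_div_add_atTop_nhds_zero_nat (𝕜 := ℝ)).eventually (gt_mem_nhds hδ)
  filter_upwards [h1] with n hn
  exact (Metric.cthickening_mono hn.le S).trans hδN

/-! ### Bessel potentials -/

section Bessel

variable {d : ℕ} {s : ℝ}

variable (d) in
/-- The symbol `(1 + |ξ|²)^{-s/2}` of the Bessel potential. -/
def besselSymbol (hs : 0 < s) : Symbol d where
  toFun ξ := (1 + (2 * Real.pi * ‖ξ‖) ^ 2) ^ (-s / 2)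
  measurable := by fun_prop
  even ξ := by rw [norm_neg]
  bounded := ⟨1, fun ξ => by
    rw [abs_of_nonneg (by positivity)]
    exact Real.rpow_le_one_of_one_le_of_nonpos (by nlinarith [sq_nonneg (2 * Real.pi * ‖ξ‖)])
      (by linarith)⟩

theorem besselSymbol_pos (hs : 0 < s) (ξ : Space d) : 0 < besselSymbol d hs ξ := by
  simp only [besselSymbol]
  positivity

theorem besselSymbol_le_one (hs : 0 < s) (ξ : Space d) : besselSymbol d hs ξ ≤ 1 :=
  Real.rpow_le_one_of_one_le_of_nonpos (by nlinarith [sq_nonneg (2 * Real.pi * ‖ξ‖)])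
    (by linarith)

theorem besselSymbol_half_sq {α : ℝ} (h0 : 0 < α) (ξ : Space d) :
    (besselSymbol d (half_pos h0) ξ) ^ 2 = ((1 + (2 * Real.pi * ‖ξ‖) ^ 2) ^ (α / 2))⁻¹ := by
  have hp : 0 < 1 + (2 * Real.pi * ‖ξ‖) ^ 2 := by positivity
  simp only [besselSymbol]
  rw [← Real.rpow_natCast, ← Real.rpow_mul hp.le, ← Real.rpow_neg hp.le]
  congr 1
  push_cast
  ring

theorem freq_eq (α : ℝ) (ξ : Space d) : freq α ξ = ((2 * Real.pi * ‖ξ‖) ^ 2) ^ (α / 2) := by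
  rw [freq, ← Real.rpow_natCast, ← Real.rpow_mul (by positivity)]
  congr 1
  push_cast
  ring

theorem measurable_besselKernel (d : ℕ) (s : ℝ) : Measurable (besselKernel d s) :=
  Measurable.lintegral_prod_right' (measurable_besselIntegrand d s).ennreal_ofReal

theorem besselPotential_eq (f : L2 d) (x : Space d) : besselPotential d s f x =
    ∫⁻ z, besselKernel d s z * ENNReal.ofReal (f (x - z)) :=
  lintegral_mul_compSub_comm _ _ x

theorem besselPotential_ae_eq (hs : 0 < s) {f : L2 d} (hf : ∀ᵐ x, 0 ≤ f x) :
    besselPotential d s f =ᵐ[volume] fun x => ENNReal.ofReal (mult (besselSymbol d hs) f x) := by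
  have := lintegral_kernel_ae_eq_mult (m := besselSymbol d hs) (measurable_besselKernel d s)
    (lintegral_besselKernel d hs) (fourier_besselKernel d hs) hf
  simp_rw [← besselPotential_eq] at this
  exact this

theorem mult_besselSymbol_nonneg (hs : 0 < s) {f : L2 d} (hf : ∀ᵐ x, 0 ≤ f x) :
    ∀ᵐ x, 0 ≤ mult (besselSymbol d hs) f x :=
  mult_nonneg_of_kernel (measurable_besselKernel d s) (lintegral_besselKernel d hs)
    (fourier_besselKernel d hs) hf

/-- Fatou's lemma in the time variable. The kernel can be infinite at the origin, so lower
semicontinuity is the right notion. -/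
theorem besselKernel_le_liminf {x : Space d} {u : ℕ → Space d} (hu : Tendsto u atTop (𝓝 x)) :
    besselKernel d s x ≤ liminf (fun n => besselKernel d s (u n)) atTop := by
  have hm : ∀ y : Space d, Measurable fun t : ℝ =>
      ENNReal.ofReal (gammaWeight s t * gaussKernel d t y) := fun y =>
    ((measurable_besselIntegrand d s).comp
      (measurable_const.prodMk measurable_id : Measurable fun t : ℝ => (y, t))).ennreal_ofReal
  refine le_trans ?_ (lintegral_liminf_le fun n => hm (u n))
  refine lintegral_mono fun t => ?_
  refine (Tendsto.liminf_eq ?_).ge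
  refine ENNReal.tendsto_ofReal ?_
  have : Continuous fun y : Space d => gammaWeight s t * gaussKernel d t y := by
    unfold gaussKernel
    fun_prop
  exact (this.tendsto x).comp hu

theorem besselPotential_le_liminf (f : L2 d) {x : Space d} {u : ℕ → Space d}
    (hu : Tendsto u atTop (𝓝 x)) :
    besselPotential d s f x ≤ liminf (fun n => besselPotential d s f (u n)) atTop := by
  have hF : Measurable fun x => ENNReal.ofReal (f x) := (measurable_coeFn f).ennreal_ofReal
  refine le_trans ?_ (lintegral_liminf_le fun n =>
    ((measurable_besselKernel d s).comp (measurable_const.sub measurable_id)).mul hF)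
  refine lintegral_mono fun y => ?_
  have h1 : besselKernel d s (x - y) ≤ liminf (fun n => besselKernel d s (u n - y)) atTop :=
    besselKernel_le_liminf (hu.sub_const y)
  calc besselKernel d s (x - y) * ENNReal.ofReal (f y)
      ≤ liminf (fun n => besselKernel d s (u n - y)) atTop * ENNReal.ofReal (f y) := by gcongr
    _ ≤ liminf (fun n => besselKernel d s (u n - y) * ENNReal.ofReal (f y)) atTop := by
        rw [mul_comm]
        simp_rw [mul_comm (besselKernel d s _)]
        exact (ENNReal.liminf_const_mul_of_ne_top ENNReal.ofReal_ne_top).ge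

/-- An admissible function for the capacity has potential at least 1 only on the set itself. Lower
semicontinuity extends the bound, with a smaller constant, to a neighbourhood. -/
theorem isOpen_lt_besselPotential (f : L2 d) (c : ℝ≥0∞) :
    IsOpen {x | c < besselPotential d s f x} := by
  rw [← isClosed_compl_iff]
  refine IsSeqClosed.isClosed fun u x hu hx => ?_
  simp only [Set.mem_compl_iff, Set.mem_ofPred_eq, not_lt] at hu ⊢
  refine (besselPotential_le_liminf f hx).trans ?_
  exact liminf_le_of_le (h := fun b hb => by
    obtain ⟨k, hk⟩ := hb.exists
    exact hk.trans (hu _))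

/-- Mollification commutes with the Bessel potential, at every point. -/
theorem besselPotential_mollify (n : ℕ) {f : L2 d} (hf : ∀ᵐ x, 0 ≤ f x) (x : Space d) :
    besselPotential d s (mollify d n f) x =
      ∫⁻ z, ENNReal.ofReal (moll d n z) * besselPotential d s f (x - z) := by
  have hF : Measurable fun x => ENNReal.ofReal (f x) := (measurable_coeFn f).ennreal_ofReal
  have hM : Measurable fun x : Space d => ENNReal.ofReal (moll d n x) :=
    (measurable_moll n).ennreal_ofReal
  have hk := measurable_besselKernel d s
  calc besselPotential d s (mollify d n f) x
      = ∫⁻ y, ∫⁻ z, ENNReal.ofReal (moll d n z) *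
          (besselKernel d s (x - y) * ENNReal.ofReal (f (y - z))) := by
        refine lintegral_congr_ae ?_
        filter_upwards [mollify_ae_eq n hf] with y hy
        rw [hy, ofReal_mollFun n hf, ← lintegral_const_mul'']
        · refine lintegral_congr fun z => ?_
          ring
        · exact (hM.mul (hF.comp (measurable_const.sub measurable_id))).aemeasurable
    _ = ∫⁻ z, ENNReal.ofReal (moll d n z) *
          ∫⁻ y, besselKernel d s (x - y) * ENNReal.ofReal (f (y - z)) := by
        rw [lintegral_lintegral_swap]
        · exact lintegral_congr fun z => lintegral_const_mul' _ _ ENNReal.ofReal_ne_top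
        · exact ((hM.comp measurable_snd).mul ((hk.comp (measurable_const.sub measurable_fst)).mul
            (hF.comp (measurable_fst.sub measurable_snd)))).aemeasurable
    _ = _ := by
        refine lintegral_congr fun z => ?_
        congr 1
        rw [besselPotential, ← lintegral_sub_right_eq_self
          (fun y => besselKernel d s (x - z - y) * ENNReal.ofReal (f y)) z]
        simp only [sub_sub_sub_cancel_right]

end Bessel

/-- |ξ|^α ≤ (1 + |ξ|²)^{α/2}. -/
theorem energy_mult_besselSymbol_le {d : ℕ} {α : ℝ} (h0 : 0 < α) (f : L2 d) :
    energy α (mult (besselSymbol d (half_pos h0)) f) ≤ ‖f‖ₑ ^ 2 := by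
  rw [enorm_sq_eq_lintegral_hat]
  refine lintegral_mono_ae ?_
  filter_upwards [hat_mult (besselSymbol d (half_pos h0)) f] with ξ h
  rw [h, enorm_sq_complex, enorm_sq_complex, ← ENNReal.ofReal_mul (freq_nonneg _ _)]
  refine ENNReal.ofReal_le_ofReal ?_
  rw [norm_mul, Complex.norm_real, Real.norm_eq_abs, mul_pow, sq_abs, ← mul_assoc]
  refine mul_le_of_le_one_left (sq_nonneg _) ?_
  rw [besselSymbol_half_sq h0, freq_eq, ← div_eq_mul_inv, div_le_one (by positivity)]
  gcongr
  linarith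

/-! ### Truncations, cutoff functions and test functions -/

theorem exists_clamp {d : ℕ} (u : L2 d) : ∃ v : L2 d, v =ᵐ[volume] fun x => clamp (u x) := by
  have : MemLp (fun x => clamp (u x)) 2 (volume : Measure (Space d)) := by
    refine (Lp.memLp u).of_le (continuous_clamp.comp_aestronglyMeasurable
      (Lp.aestronglyMeasurable u)) (Eventually.of_forall fun x => abs_clamp_le _)
  exact ⟨this.toLp, this.coeFn_toLp⟩

theorem norm_le_of_ae_le {d : ℕ} {u v : L2 d} (h : ∀ᵐ x, |v x| ≤ |u x|) : ‖v‖ ≤ ‖u‖ :=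
  Lp.norm_le_norm_of_ae_le h

/-- The products of square integrable functions with bounded functions. -/
theorem exists_mul_bounded {d : ℕ} (u : L2 d) {g : Space d → ℝ} (hg : Measurable g) {M : ℝ}
    (hM : ∀ x, |g x| ≤ M) : ∃ v : L2 d, v =ᵐ[volume] fun x => u x * g x := by
  have : MemLp (fun x => u x * g x) 2 (volume : Measure (Space d)) := by
    refine MemLp.of_le_mul (c := M) (Lp.memLp u)
      ((Lp.aestronglyMeasurable u).mul hg.aestronglyMeasurable) (Eventually.of_forall fun x => ?_)
    rw [norm_mul, mul_comm]
    exact mul_le_mul_of_nonneg_right (hM x) (norm_nonneg _)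
  exact ⟨this.toLp, this.coeFn_toLp⟩

/-- The Lipschitz bound serves for small y and boundedness for large y, giving the weight min(1,
‖y‖²) controlled by `IsLevyApprox.exists_moment_bound`. -/
theorem sq_sub_le_of_lipschitz {d : ℕ} {g : Space d → ℝ} {C : NNReal} (hC : LipschitzWith C g)
    {D : ℝ} (hD : ∀ x, |g x| ≤ D) (x y : Space d) :
    (g x - g (x - y)) ^ 2 ≤ ((C : ℝ) ^ 2 + (2 * D) ^ 2) * min 1 (‖y‖ ^ 2) := by
  have h1 : |g x - g (x - y)| ≤ C * ‖y‖ := by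
    have := hC.dist_le_mul x (x - y)
    rwa [Real.dist_eq, dist_eq_norm, sub_sub_cancel] at this
  have h2 : |g x - g (x - y)| ≤ 2 * D := by
    have := abs_sub (g x) (g (x - y))
    linarith [hD x, hD (x - y)]
  rw [← sq_abs]
  have h3 := pow_le_pow_left₀ (abs_nonneg _) h1 2
  have h4 := pow_le_pow_left₀ (abs_nonneg _) h2 2
  rcases le_total 1 (‖y‖ ^ 2) with h | h
  · rw [min_eq_left h]
    nlinarith [sq_nonneg (C : ℝ)]
  · rw [min_eq_right h]
    nlinarith [sq_nonneg (2 * D), mul_nonneg (sq_nonneg (2 * D)) (sq_nonneg ‖y‖)]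

/-- Cutoff functions at infinity with a uniform Lipschitz bound. -/
theorem exists_cutoff_at_infinity (d : ℕ) : ∃ q : ℝ, 0 ≤ q ∧ ∀ n : ℕ, ∃ χ : Space d → ℝ,
    ContDiff ℝ ∞ χ ∧ HasCompactSupport χ ∧ (∀ x, 0 ≤ χ x ∧ χ x ≤ 1) ∧
    (∀ x, ‖x‖ ≤ n → χ x = 1) ∧ ∀ x y, (χ x - χ (x - y)) ^ 2 ≤ q * min 1 (‖y‖ ^ 2) := by
  let b : ContDiffBump (0 : Space d) := ⟨1, 2, one_pos, one_lt_two⟩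
  obtain ⟨C, hC⟩ := ContDiff.lipschitzWith_of_hasCompactSupport (𝕂 := ℝ) (n := ∞)
    b.hasCompactSupport b.contDiff (by simp)
  refine ⟨(C : ℝ) ^ 2 + (2 * 1) ^ 2, by positivity, fun n => ?_⟩
  have hn : (0 : ℝ) < (n : ℝ) + 1 := by positivity
  have hn1 : ((n : ℝ) + 1)⁻¹ ≤ 1 := inv_le_one_of_one_le₀ (by linarith [n.cast_nonneg (α := ℝ)])
  -- Dilation by 1/(n + 1) ≤ 1 does not increase the Lipschitz constant, so one q serves all n; n +
  -- 1 in place of n admits n = 0.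
  have hL : LipschitzWith C fun x : Space d => b (((n : ℝ) + 1)⁻¹ • x) := by
    refine LipschitzWith.of_dist_le_mul fun x y => (hC.dist_le_mul _ _).trans ?_
    rw [dist_smul₀, Real.norm_of_nonneg (by positivity)]
    gcongr
    exact mul_le_of_le_one_left dist_nonneg hn1
  refine ⟨fun x => b (((n : ℝ) + 1)⁻¹ • x), b.contDiff.comp (contDiff_const_smul _), ?_,
    fun x => ⟨b.nonneg, b.le_one⟩, fun x hx => ?_, fun x y => ?_⟩
  · exact b.hasCompactSupport.comp_smul (inv_ne_zero hn.ne')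
  · refine b.one_of_mem_closedBall ?_
    rw [mem_closedBall_zero_iff, norm_smul, Real.norm_of_nonneg (by positivity),
      inv_mul_le_iff₀ hn]
    change ‖x‖ ≤ ((n : ℝ) + 1) * 1
    linarith
  · exact sq_sub_le_of_lipschitz hL (fun x => by rw [abs_of_nonneg b.nonneg]; exact b.le_one) x y

theorem exists_sq_sub_le_of_contDiff {d : ℕ} {g : Space d → ℝ} (hg : ContDiff ℝ ∞ g)
    (hgc : HasCompactSupport g) : ∃ M q : ℝ, 0 ≤ q ∧ (∀ x, |g x| ≤ M) ∧
      ∀ x y, (g x - g (x - y)) ^ 2 ≤ q * min 1 (‖y‖ ^ 2) := by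
  obtain ⟨C, hC⟩ := ContDiff.lipschitzWith_of_hasCompactSupport (𝕂 := ℝ) hgc hg (by simp)
  obtain ⟨M, hM⟩ := hgc.exists_bound_of_continuous hg.continuous
  exact ⟨M, (C : ℝ) ^ 2 + (2 * M) ^ 2, by positivity, hM, sq_sub_le_of_lipschitz hC hM⟩

theorem exists_mem_testFunctions {d : ℕ} {N : Set (Space d)} {φ : Space d → ℝ}
    (hφ : ContDiff ℝ ∞ φ) (hc : HasCompactSupport φ) (hN : tsupport φ ⊆ N) :
    ∃ u ∈ testFunctions d N, u =ᵐ[volume] φ := by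
  have : MemLp φ 2 (volume : Measure (Space d)) := hφ.continuous.memLp_of_hasCompactSupport hc
  exact ⟨this.toLp, ⟨φ, hφ, hc, hN, this.coeFn_toLp⟩, this.coeFn_toLp⟩

theorem exists_hasFracLap_of_mem_testFunctions {d : ℕ} {α : ℝ} (h0 : 0 < α) (h2 : α ≤ 2)
    {N : Set (Space d)} {u : L2 d} (hu : u ∈ testFunctions d N) : ∃ z, HasFracLap α u z := by
  have h := fracLaplacianOn_domain d α h0 h2 N
  rw [fracLaplacianOn, LinearPMap.domRestrict_domain, inf_eq_left] at h
  exact ⟨fracLaplacian d α ⟨u, h hu⟩, mem_fracLaplacian_graph_iff.mp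
    (LinearPMap.mem_graph _ ⟨u, h hu⟩)⟩

theorem mem_neg_fracLaplacianOn_graph_iff {d : ℕ} {α : ℝ} {N : Set (Space d)} {u z : L2 d} :
    (u, -z) ∈ (-fracLaplacianOn d α N).graph ↔ u ∈ testFunctions d N ∧ HasFracLap α u z := by
  rw [← mem_fracLaplacian_graph_iff, LinearPMap.mem_graph_iff, LinearPMap.mem_graph_iff]
  constructor
  · rintro ⟨⟨x, hx⟩, h1, h2⟩
    simp only at h1
    subst h1
    rw [LinearPMap.neg_apply, neg_inj] at h2
    exact ⟨hx.1, ⟨x, hx.2⟩, rfl, h2⟩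
  · rintro ⟨hu, ⟨x, hx⟩, h1, h2⟩
    simp only at h1
    subst h1
    refine ⟨⟨x, hu, hx⟩, rfl, ?_⟩
    rw [LinearPMap.neg_apply, neg_inj]
    exact h2

/-- Test functions off a closed null set are dense in `L²`. -/
theorem dense_testFunctions {d : ℕ} {K : Set (Space d)} (hK : IsClosed K) (h0 : volume K = 0) :
    Dense (testFunctions d Kᶜ : Set (L2 d)) := by
  rw [Submodule.dense_iff_topologicalClosure_eq_top, Submodule.topologicalClosure_eq_top_iff,
    Submodule.eq_bot_iff]
  intro u hu
  rw [Submodule.mem_orthogonal] at hu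
  have h1 := hK.isOpen_compl.ae_eq_zero_of_integral_contDiff_smul_eq_zero
    (f := u) (μ := volume) ((locallyIntegrable_coeFn u).locallyIntegrableOn _) ?_
  · apply Lp.ext
    filter_upwards [h1, measure_eq_zero_iff_ae_notMem.mp h0,
      Lp.coeFn_zero ℝ 2 (volume : Measure (Space d))] with x h2 h3 h4
    rw [h4, h2 h3]
    rfl
  · intro g hg hgc hgN
    obtain ⟨v, hv, hvg⟩ := exists_mem_testFunctions hg hgc hgN
    rw [← hu v hv, L2.inner_def]
    refine integral_congr_ae ?_
    filter_upwards [hvg] with x hx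
    rw [hx, real_inner_eq_mul, smul_eq_mul]

/-- On a set of capacity zero there are smooth functions equal to `1` near the set, of
arbitrarily small energy. -/
theorem exists_small_cutoff {d : ℕ} {α : ℝ} {κ : ℕ → Measure (Space d)}
    (h : IsLevyApprox d α κ) (h0 : 0 < α) {K : Set (Space d)} (hK : IsCompact K)
    (hcap : besselCapacity d (α / 2) K = 0) {ε : ℝ} (hε : 0 < ε) :
    ∃ (W : Space d → ℝ) (w : L2 d) (U : Set (Space d)), ContDiff ℝ ∞ W ∧
      (∀ x, 0 ≤ W x ∧ W x ≤ 1) ∧ IsOpen U ∧ K ⊆ U ∧ (∀ x ∈ U, W x = 1) ∧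
      w =ᵐ[volume] W ∧ ‖w‖ ≤ ε ∧ energy α w ≤ ENNReal.ofReal (ε ^ 2) := by
  have hs := half_pos h0
  have hlt : besselCapacity d (α / 2) K < ENNReal.ofReal ((ε / 2) ^ 2) := by
    rw [hcap]
    exact ENNReal.ofReal_pos.mpr (by positivity)
  rw [besselCapacity, iInf_lt_iff] at hlt
  obtain ⟨f, hf⟩ := hlt
  rw [iInf_lt_iff] at hf
  obtain ⟨⟨hf0, hfK⟩, hfε⟩ := hf
  have hfn : ‖f‖ ≤ ε / 2 := by
    have := (ENNReal.ofReal_lt_ofReal_iff_of_nonneg (sq_nonneg _)).mp hfε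
    exact (lt_of_pow_lt_pow_left₀ 2 (by positivity) this).le
  have hfa : ∀ᵐ x, 0 ≤ f x := by
    filter_upwards [(Lp.coeFn_nonneg f).mpr hf0] with x hx
    exact hx
  set b := mult (besselSymbol d hs) f
  -- The potential b exceeds 1/2 on an open neighbourhood of K. Doubling before truncating gives
  -- exactly 1 there; the doubling is why f was taken with norm at most ε/2.
  obtain ⟨w₀, hw₀⟩ := exists_clamp ((2 : ℝ) • b)
  have hw0 : ∀ᵐ x, 0 ≤ w₀ x := by
    filter_upwards [hw₀] with x hx
    rw [hx]
    exact (clamp_mem _).1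
  have hw1 : ∀ᵐ x, w₀ x ≤ 1 := by
    filter_upwards [hw₀] with x hx
    rw [hx]
    exact (clamp_mem _).2
  set V := {x | ENNReal.ofReal (1 / 2) < besselPotential d (α / 2) f x}
  have hV : IsOpen V := isOpen_lt_besselPotential f _
  have hKV : K ⊆ V := fun x hx => lt_of_lt_of_le
    (by rw [← ENNReal.ofReal_one]; exact (ENNReal.ofReal_lt_ofReal_iff one_pos).mpr (by norm_num))
    (hfK x hx)
  have hwV : ∀ᵐ x, x ∈ V → w₀ x = 1 := by
    filter_upwards [hw₀, besselPotential_ae_eq hs hfa, Lp.coeFn_smul (2 : ℝ) b]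
      with x h1 h2 h3 hxV
    have h4 : ENNReal.ofReal (1 / 2) < ENNReal.ofReal (b x) := h2 ▸ hxV
    have h5 := (ENNReal.ofReal_lt_ofReal_iff_of_nonneg (by norm_num)).mp h4
    rw [h1, h3, Pi.smul_apply, smul_eq_mul, clamp, min_eq_right (by linarith),
      max_eq_left zero_le_one]
  obtain ⟨δ, hδ, hδV⟩ := hK.exists_cthickening_subset_open hV hKV
  -- Mollifying at a scale below δ/2 keeps the value 1 on the δ/2-neighbourhood of K.
  obtain ⟨n, hn⟩ := exists_nat_one_div_lt (half_pos hδ)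
  refine ⟨mollFun n w₀, mollify d n w₀, Metric.thickening (δ / 2) K, contDiff_mollFun n w₀,
    fun x => ⟨mollFun_nonneg n hw0 x, mollFun_le_one n hw1 x⟩, Metric.isOpen_thickening,
    Metric.self_subset_thickening (half_pos hδ) K, fun x hx => ?_, mollify_ae_eq n hw0, ?_, ?_⟩
  · refine mollFun_eq_const n ?_
    filter_upwards [hwV] with y hy hyx
    refine hy (hδV ?_)
    obtain ⟨z, hz, hxz⟩ := Metric.mem_thickening_iff.mp hx
    refine Metric.mem_cthickening_of_dist_le y z δ K hz ?_
    linarith [dist_triangle y x z]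
  · refine (norm_mollify_le n w₀).trans ?_
    have h1 : ‖w₀‖ ≤ ‖(2 : ℝ) • b‖ := norm_le_of_ae_le (by
      filter_upwards [hw₀] with x hx
      rw [hx]
      exact abs_clamp_le _)
    have h2 : ‖b‖ ≤ 1 * ‖f‖ := norm_mult_le _ (fun ξ => by
      rw [abs_of_pos (besselSymbol_pos hs ξ)]
      exact besselSymbol_le_one hs ξ) f
    rw [norm_smul, Real.norm_of_nonneg zero_le_two] at h1
    linarith
  · calc energy α (mollify d n w₀) ≤ energy α w₀ := energy_mollify_le α n w₀
      _ ≤ energy α ((2 : ℝ) • b) := energy_clamp_le h hw₀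
      _ ≤ ENNReal.ofReal (2 ^ 2) * ‖f‖ₑ ^ 2 := by
        rw [energy_smul]
        gcongr
        exact energy_mult_besselSymbol_le h0 f
      _ ≤ ENNReal.ofReal (ε ^ 2) := by
        rw [← ofReal_norm, ← ENNReal.ofReal_pow (norm_nonneg _),
          ← ENNReal.ofReal_mul (by positivity)]
        refine ENNReal.ofReal_le_ofReal ?_
        nlinarith [norm_nonneg f]

/-! ### The resolvent of the fractional Laplacian -/

/-- The symbol `(1 + |ξ|^α)⁻¹` of the resolvent. -/
def resSymbol (d : ℕ) (α : ℝ) : Symbol d where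
  toFun ξ := (1 + freq α ξ)⁻¹
  measurable := ((measurable_freq α).const_add 1).inv
  even ξ := by rw [freq_neg]
  bounded := ⟨1, fun ξ => by
    have := freq_nonneg α ξ
    rw [abs_of_nonneg (by positivity)]
    exact inv_le_one_of_one_le₀ (by linarith)⟩

/-- Rewrites the unbounded relation as an identity for a bounded operator, which yields closedness
and linearity at once. -/
theorem hasFracLap_iff_mult_resSymbol {d : ℕ} {α : ℝ} {u z : L2 d} :
    HasFracLap α u z ↔ mult (resSymbol d α) (u + z) = u := by
  have hne : ∀ ξ : Space d, (1 + (freq α ξ : ℂ)) ≠ 0 := fun ξ => by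
    have := freq_nonneg α ξ
    exact_mod_cast (by positivity : (1 + freq α ξ) ≠ 0)
  have hr : ∀ ξ : Space d, (resSymbol d α ξ : ℂ) = (1 + (freq α ξ : ℂ))⁻¹ := fun ξ => by
    simp only [resSymbol]
    push_cast
    rfl
  constructor
  · intro h
    refine mult_eq_of_hat _ ?_
    filter_upwards [h, hat_add_ae d u z] with ξ h1 h2
    rw [h2, h1, hr, ← one_add_mul, inv_mul_cancel_left₀ (hne ξ)]
  · intro h
    unfold HasFracLap
    filter_upwards [hat_mult (resSymbol d α) (u + z), hat_add_ae d u z] with ξ h1 h2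
    rw [h, h2, hr, eq_inv_mul_iff_mul_eq₀ (hne ξ)] at h1
    linear_combination -h1

theorem hasFracLap_of_tendsto {d : ℕ} {α : ℝ} {u z : ℕ → L2 d} {v y : L2 d}
    (hu : Tendsto u atTop (𝓝 v)) (hz : Tendsto z atTop (𝓝 y))
    (h : ∀ n, HasFracLap α (u n) (z n)) : HasFracLap α v y := by
  rw [hasFracLap_iff_mult_resSymbol]
  have h1 := ((mult (resSymbol d α)).continuous.tendsto (v + y)).comp (hu.add hz)
  refine tendsto_nhds_unique (h1.congr fun n => ?_) hu
  exact hasFracLap_iff_mult_resSymbol.mp (h n)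

theorem HasFracLap.sub {d : ℕ} {α : ℝ} {u z v y : L2 d} (h : HasFracLap α u z)
    (h' : HasFracLap α v y) : HasFracLap α (u - v) (z - y) := by
  rw [hasFracLap_iff_mult_resSymbol] at h h' ⊢
  rw [sub_add_sub_comm, map_sub, h, h']

/-- Dominated convergence in `L²`. -/
theorem tendsto_of_dominated {d : ℕ} {b : ℕ → L2 d} {u g : L2 d}
    (hb : ∀ k, ∀ᵐ x, |b k x - u x| ≤ |g x|)
    (hl : ∀ᵐ x, Tendsto (fun k => b k x) atTop (𝓝 (u x))) : Tendsto b atTop (𝓝 u) := by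
  rw [Lp.tendsto_Lp_iff_tendsto_eLpNorm']
  have key : Tendsto (fun k => ∫⁻ x, ‖b k x - u x‖ₑ ^ 2) atTop (𝓝 0) := by
    have hz : (0 : ℝ≥0∞) = ∫⁻ _ : Space d, 0 := by simp
    rw [hz]
    refine tendsto_lintegral_of_dominated_convergence' (fun x => ‖g x‖ₑ ^ 2) ?_ ?_ ?_ ?_
    · intro k
      exact ((Lp.aestronglyMeasurable (b k)).sub (Lp.aestronglyMeasurable u)).enorm.pow_const 2
    · intro k
      filter_upwards [hb k] with x hx
      gcongr
      rw [enorm_le_iff_norm_le]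
      exact hx
    · rw [← enorm_sq_eq_lintegral]
      simp
    · filter_upwards [hl] with x hx
      have h1 : Tendsto (fun k => b k x - u x) atTop (𝓝 0) := by
        simpa using hx.sub_const (u x)
      have := ENNReal.Tendsto.pow (n := 2) h1.enorm
      simpa using this
  have h3 := key.ennrpow_const (1 / 2)
  rw [ENNReal.zero_rpow_of_pos (by norm_num)] at h3
  refine h3.congr fun k => ?_
  rw [eLpNorm_eq_lintegral_rpow_enorm_toReal two_ne_zero ENNReal.ofNat_ne_top]
  simp only [ENNReal.toReal_ofNat, ENNReal.rpow_ofNat, Pi.sub_apply]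

/-- Cutting off at infinity converges to the identity. -/
theorem tendsto_mul_cutoff {d : ℕ} {χ : ℕ → Space d → ℝ} (h01 : ∀ n x, 0 ≤ χ n x ∧ χ n x ≤ 1)
    (h1 : ∀ (n : ℕ) x, ‖x‖ ≤ n → χ n x = 1) {u : L2 d} {b : ℕ → L2 d}
    (hb : ∀ n, b n =ᵐ[volume] fun x => u x * χ n x) : Tendsto b atTop (𝓝 u) := by
  refine tendsto_of_dominated (g := u) (fun k => ?_) ?_
  · filter_upwards [hb k] with x hx
    rw [hx, ← mul_sub_one, abs_mul]
    refine mul_le_of_le_one_right (abs_nonneg _) ?_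
    rw [abs_le]
    constructor <;> linarith [h01 k x]
  · filter_upwards [ae_all_iff.mpr hb] with x hx
    refine tendsto_const_nhds.congr' ?_
    filter_upwards [eventually_ge_atTop ⌈‖x‖⌉₊] with n hn
    rw [hx, h1 n x ((Nat.le_ceil _).trans (by exact_mod_cast hn)), mul_one]

theorem abs_le_one_of_mem {a : ℝ} (h : 0 ≤ a ∧ a ≤ 1) : |a| ≤ 1 :=
  abs_le.mpr ⟨by linarith [h.1], h.2⟩

/-- An element orthogonal to all nonnegative compactly supported functions vanishes. -/
theorem eq_zero_of_inner_eq_zero {d : ℕ} {D : L2 d}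
    (h : ∀ (v : L2 d) (S : Set (Space d)), IsCompact S → (∀ᵐ x, 0 ≤ v x) →
      (∀ᵐ x, x ∉ S → v x = 0) → inner ℝ D v = 0) : D = 0 := by
  obtain ⟨q, -, hχ⟩ := exists_cutoff_at_infinity d
  choose χ hχs hχc hχ01 hχ1 hχq using hχ
  have key : ∀ w : L2 d, (∀ᵐ x, 0 ≤ w x) → inner ℝ D w = 0 := by
    intro w hw
    have hex : ∀ n, ∃ b : L2 d, b =ᵐ[volume] fun x => w x * χ n x := fun n =>
      exists_mul_bounded w (hχs n).continuous.measurable fun x => abs_le_one_of_mem (hχ01 n x)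
    choose b hb using hex
    have hl := (tendsto_mul_cutoff hχ01 hχ1 hb)
    refine tendsto_nhds_unique ((tendsto_const_nhds (x := D)).inner hl)
      (tendsto_const_nhds.congr fun n => ?_)
    refine (h (b n) (tsupport (χ n)) (hχc n) ?_ ?_).symm
    · filter_upwards [hb n, hw] with x h1 h2
      rw [h1]
      exact mul_nonneg h2 (hχ01 n x).1
    · filter_upwards [hb n] with x h1 hx
      rw [h1, image_eq_zero_of_notMem_tsupport hx, mul_zero]
  have h1 := ae_nonneg_of_inner_nonneg fun w hw => (key w hw).ge
  have h2 := ae_nonneg_of_inner_nonneg (g := -D) fun w hw => by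
    rw [inner_neg_left, key w hw, neg_zero]
  apply Lp.ext
  filter_upwards [h1, h2, Lp.coeFn_neg D, Lp.coeFn_zero ℝ 2 (volume : Measure (Space d))]
    with x h1 h2 h3 h4
  rw [h3, Pi.neg_apply] at h2
  rw [h4, Pi.zero_apply]
  exact le_antisymm (by linarith) h1

/-! ### Uniqueness of bounded weak solutions -/

section Weak

variable {d : ℕ} {α : ℝ} {κ : ℕ → Measure (Space d)} {N : Set (Space d)} {u f : L2 d}

/-- The energy of `u φ` for a bounded weak solution `u` of `u + (-Δ)^{α/2} u = f` in `N`. -/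
theorem energy_mul_le_of_weak (h : IsLevyApprox d α κ) (h0 : 0 < α) (h2 : α ≤ 2) {Q : ℝ≥0∞}
    (hQ : ∀ n, ∫⁻ y, ENNReal.ofReal (min 1 (‖y‖ ^ 2)) ∂(κ n) ≤ Q) (hN : IsOpen N)
    (hu : ∀ᵐ x, 0 ≤ u x ∧ u x ≤ 1)
    (hw : ∀ φ ∈ testFunctions d N, ∀ z, HasFracLap α φ z → inner ℝ u (φ + z) = inner ℝ f φ)
    {χ W φ : Space d → ℝ} {w : L2 d} (hφs : ContDiff ℝ ∞ φ) (hφc : HasCompactSupport φ)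
    (hφN : tsupport φ ⊆ N) (hχ : ∀ x, 0 ≤ χ x ∧ χ x ≤ 1) (hW : ∀ x, 0 ≤ W x ∧ W x ≤ 1)
    {q : ℝ} (hq : 0 ≤ q) (hχq : ∀ x y, (χ x - χ (x - y)) ^ 2 ≤ q * min 1 (‖y‖ ^ 2))
    (hφ : ∀ x, φ x = χ x * (1 - W x)) (hwW : w =ᵐ[volume] W)
    {a : L2 d} (ha : a =ᵐ[volume] fun x => u x * φ x) :
    energy α a ≤ ENNReal.ofReal (‖f - u‖ * ‖u‖) +
      (2 * energy α w + ENNReal.ofReal q * ‖u‖ₑ ^ 2 * Q) := by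
  have hφ01 : ∀ x, |φ x| ≤ 1 := fun x => by
    rw [hφ, abs_mul]
    exact mul_le_one₀ (abs_le_one_of_mem (hχ x)) (abs_nonneg _)
      (abs_le_one_of_mem ⟨by linarith [hW x], by linarith [hW x]⟩)
  have hφm := hφs.continuous.measurable
  have hφ2 : ∀ x, |φ x ^ 2| ≤ 1 := fun x => by
    rw [abs_pow]
    exact pow_le_one₀ (abs_nonneg _) (hφ01 x)
  have hu0 : ∀ᵐ x, 0 ≤ u x := hu.mono fun x hx => hx.1
  have hu1 : ∀ᵐ x, u x ≤ 1 := hu.mono fun x hx => hx.2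
  -- The natural test function uφ² is not smooth, and u is not known to have finite energy. Both are
  -- regularized: with uₙ the mollification of u, work with uₙφ and uₙφ² and let n → ∞ by lower
  -- semicontinuity of the energy.
  have hex1 : ∀ n, ∃ b : L2 d, b =ᵐ[volume] fun x => mollify d n u x * φ x := fun n =>
    exists_mul_bounded _ hφm hφ01
  have hex2 : ∀ n, ∃ b : L2 d, b =ᵐ[volume] fun x => mollify d n u x * φ x ^ 2 := fun n =>
    exists_mul_bounded _ (hφm.pow_const 2) hφ2
  choose b hb using hex1
  choose ψ hψ using hex2
  have hbt : Tendsto b atTop (𝓝 a) := by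
    have ht := tendsto_mollify u
    rw [tendsto_iff_norm_sub_tendsto_zero] at ht ⊢
    refine squeeze_zero (fun _ => norm_nonneg _) (fun n => norm_le_of_ae_le ?_) ht
    filter_upwards [hb n, ha, Lp.coeFn_sub (b n) a, Lp.coeFn_sub (mollify d n u) u]
      with x h1 h2 h3 h4
    rw [h3, h4, Pi.sub_apply, Pi.sub_apply, h1, h2, ← sub_mul, abs_mul]
    exact mul_le_of_le_one_right (abs_nonneg _) (hφ01 x)
  obtain ⟨n₀, hn₀⟩ := (eventually_cthickening_subset hφc hN hφN).exists_forall_of_atTop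
  refine energy_le_of_tendsto ((tendsto_add_atTop_iff_nat n₀).mpr hbt) fun k => ?_
  set n := k + n₀
  have hn := hn₀ n (Nat.le_add_left _ _)
  have hmF := mollify_ae_eq n hu0
  have hψ0 : ∀ᵐ x, 0 ≤ ψ n x := by
    filter_upwards [hψ n, hmF] with x h1 h2
    rw [h1, h2]
    exact mul_nonneg (mollFun_nonneg n hu0 x) (sq_nonneg _)
  have hψS : ∀ᵐ x, x ∉ tsupport φ → ψ n x = 0 := by
    filter_upwards [hψ n] with x h1 hx
    rw [h1, image_eq_zero_of_notMem_tsupport hx]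
    ring
  have hψT : ψ n ∈ testFunctions d N := by
    refine ⟨fun x => mollFun n u x * φ x ^ 2, (contDiff_mollFun n u).mul (hφs.pow 2), ?_, ?_, ?_⟩
    · refine HasCompactSupport.mul_left (f := mollFun n u) ?_
      exact hφc.comp_left (g := fun t => t ^ 2) (by simp)
    · refine (tsupport_mul_subset_right.trans ?_).trans hφN
      refine closure_mono fun x hx => ?_
      exact fun h0 => hx (by simp [h0])
    · filter_upwards [hψ n, hmF] with x h1 h2
      rw [h1, h2]
  obtain ⟨y, hy⟩ := exists_hasFracLap_of_mem_testFunctions h0 h2 hψT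
  have hz := hasFracLap_mollify h0 h2 n u
  have hψn : ‖ψ n‖ ≤ ‖u‖ := by
    refine (norm_le_of_ae_le ?_).trans (norm_mollify_le n u)
    filter_upwards [hψ n] with x h1
    rw [h1, abs_mul]
    exact mul_le_of_le_one_right (abs_nonneg _) (hφ2 x)
  have hv01 : ∀ᵐ x, 0 ≤ mollify d n u x ∧ mollify d n u x ≤ 1 := by
    filter_upwards [hmF] with x h1
    rw [h1]
    exact ⟨mollFun_nonneg n hu0 x, mollFun_le_one n hu1 x⟩
  have hw01 : ∀ᵐ x, 0 ≤ w x ∧ w x ≤ 1 := by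
    filter_upwards [hwW] with x h1
    rw [h1]
    exact hW x
  have hφw : ∀ᵐ x, φ x = χ x * (1 - w x) := by
    filter_upwards [hwW] with x h1
    rw [h1, hφ]
  -- The operator and the mollifier are moved onto uₙφ². Its mollification is still a test function
  -- in N, so the weak equation for u applies and the bound does not depend on n.
  have hin : inner ℝ (mult (fracMollSymbol d h0 h2 n) u) (ψ n) ≤ ‖f - u‖ * ‖u‖ := by
    have h1 : inner ℝ (mult (fracMollSymbol d h0 h2 n) u) (ψ n) =
        inner ℝ (f - u) (mollify d n (ψ n)) := by
      have h3 := hw _ (mollify_mem_testFunctions hφc hn hψ0 hψS) _ (hy.mult (mollSymbol d n))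
      rw [hz.inner_comm hy, mollify, inner_mult_left, inner_sub_left]
      rw [inner_add_right] at h3
      simp only [mollify] at h3
      linarith
    rw [h1]
    refine (real_inner_le_norm _ _).trans ?_
    gcongr
    exact (norm_mollify_le n _).trans hψn
  have hmain := energy_mul_cutoff_le h hQ hχ hq hχq hv01 hw01 hφw (hb n) (hψ n)
  -- Polarization trades the energy of (uₙ + uₙφ²)/2 for that of (uₙ - uₙφ²)/2 plus the inner
  -- product just estimated. The latter energy occurs on both sides and is finite, so it cancels.
  obtain ⟨hpol, hfin⟩ := hz.energy_add_eq hy.energy_ne_top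
  have hle : energy α (b n) + energy α ((1 / 2 : ℝ) • (mollify d n u - ψ n)) ≤
      (ENNReal.ofReal (‖f - u‖ * ‖u‖) +
        (2 * energy α w + ENNReal.ofReal q * ‖u‖ₑ ^ 2 * Q)) +
        energy α ((1 / 2 : ℝ) • (mollify d n u - ψ n)) := by
    refine hmain.trans ?_
    have e1 : ENNReal.ofReal (inner ℝ (mult (fracMollSymbol d h0 h2 n) u) (ψ n)) ≤
        ENNReal.ofReal (‖f - u‖ * ‖u‖) := ENNReal.ofReal_le_ofReal hin
    have e2 : ‖mollify d n u‖ₑ ≤ ‖u‖ₑ := enorm_le_iff_norm_le.mpr (norm_mollify_le n u)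
    calc _ ≤ (energy α ((1 / 2 : ℝ) • (mollify d n u - ψ n)) +
          ENNReal.ofReal (‖f - u‖ * ‖u‖)) +
          (2 * energy α w + ENNReal.ofReal q * ‖u‖ₑ ^ 2 * Q) := by
          gcongr
          exact hpol.trans (by gcongr)
      _ = _ := by ring
  exact (ENNReal.add_le_add_iff_right hfin).mp hle

/-- A bounded weak solution off a compact set of capacity zero is a global solution. -/
theorem hasFracLap_of_weak (h0 : 0 < α) (h2 : α ≤ 2) {K : Set (Space d)} (hK : IsCompact K)
    (hcap : besselCapacity d (α / 2) K = 0) (hu : ∀ᵐ x, 0 ≤ u x ∧ u x ≤ 1)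
    (hw : ∀ φ ∈ testFunctions d Kᶜ, ∀ z, HasFracLap α φ z →
      inner ℝ u (φ + z) = inner ℝ f φ) : HasFracLap α u (f - u) := by
  obtain ⟨κ, h⟩ := exists_isLevyApprox d h0 h2
  obtain ⟨Q, hQ', hQ⟩ := h.exists_moment_bound h0 h2
  obtain ⟨q, hq, hχ⟩ := exists_cutoff_at_infinity d
  choose χ hχs hχc hχ01 hχ1 hχq using hχ
  have hcut := fun k : ℕ => exists_small_cutoff h h0 hK hcap (ε := 1 / ((k : ℝ) + 1))
    Nat.one_div_pos_of_nat
  choose W w U hWs hW01 hUo hKU hWU hwW hwn hwE using hcut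
  have hε1 : ∀ k : ℕ, 1 / ((k : ℝ) + 1) ≤ 1 := fun k => by
    rw [div_le_one (by positivity)]
    linarith [k.cast_nonneg (α := ℝ)]
  have hεt := tendsto_one_div_add_atTop_nhds_zero_nat (𝕜 := ℝ)
  -- smooth functions times `1 - W k` are test functions off `K`
  have hsupp : ∀ (k : ℕ) (g : Space d → ℝ), tsupport (fun x => g x * (1 - W k x)) ⊆ Kᶜ := by
    intro k g
    have : tsupport (fun x => g x * (1 - W k x)) ⊆ (U k)ᶜ := by
      refine closure_minimal (fun x hx hxU => hx ?_) (hUo k).isClosed_compl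
      simp [hWU k x hxU]
    exact this.trans (Set.compl_subset_compl.mpr (hKU k))
  have hsm : ∀ (k : ℕ) {g : Space d → ℝ}, ContDiff ℝ ∞ g →
      ContDiff ℝ ∞ (fun x => g x * (1 - W k x)) := fun k g hg =>
    hg.mul (contDiff_const.sub (hWs k))
  have hcs : ∀ (k : ℕ) {g : Space d → ℝ}, HasCompactSupport g →
      HasCompactSupport (fun x => g x * (1 - W k x)) := fun k g hg => hg.mul_right
  have hwk1 : ∀ k, energy α (w k) ≤ 1 := fun k => (hwE k).trans (by
    rw [← ENNReal.ofReal_one]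
    exact ENNReal.ofReal_le_ofReal (pow_le_one₀ (by positivity) (hε1 k)))
  have hwt : Tendsto (fun k => ‖w k‖) atTop (𝓝 0) :=
    squeeze_zero (fun _ => norm_nonneg _) hwn hεt
  have hwEt : Tendsto (fun k => energy α (w k)) atTop (𝓝 0) := by
    refine tendsto_of_tendsto_of_tendsto_of_le_of_le tendsto_const_nhds ?_
      (fun k => zero_le) hwE
    have := ENNReal.tendsto_ofReal (hεt.pow 2)
    simpa using this
  -- finiteness of the energy
  have hEu : energy α u ≠ ⊤ := by
    have hW1 : ∀ k x, |1 - W k x| ≤ 1 := fun k x =>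
      abs_le_one_of_mem ⟨by linarith [hW01 k x], by linarith [hW01 k x]⟩
    have hex1 : ∀ k, ∃ b : L2 d, b =ᵐ[volume] fun x => u x * χ k x := fun k =>
      exists_mul_bounded u (hχs k).continuous.measurable fun x => abs_le_one_of_mem (hχ01 k x)
    have hex2 : ∀ k, ∃ a : L2 d, a =ᵐ[volume] fun x => u x * (χ k x * (1 - W k x)) := fun k =>
      exists_mul_bounded u (M := 1) (hsm k (hχs k)).continuous.measurable fun x => by
        rw [abs_mul]
        exact mul_le_one₀ (abs_le_one_of_mem (hχ01 k x)) (abs_nonneg _) (hW1 k x)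
    choose b hb using hex1
    choose a ha using hex2
    have hbt := tendsto_mul_cutoff hχ01 hχ1 hb
    have hat : Tendsto a atTop (𝓝 u) := by
      have hab : Tendsto (fun k => a k - b k) atTop (𝓝 0) := by
        rw [tendsto_zero_iff_norm_tendsto_zero]
        refine squeeze_zero (fun _ => norm_nonneg _) (fun k => norm_le_of_ae_le ?_) hwt
        filter_upwards [ha k, hb k, Lp.coeFn_sub (a k) (b k), hwW k, hu] with x h1 h2 h3 h4 h5
        have e : (a k - b k : L2 d) x = -(u x * χ k x * w k x) := by
          rw [h3, Pi.sub_apply, h1, h2, h4]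
          ring
        rw [e, abs_neg, abs_mul, abs_mul]
        exact mul_le_of_le_one_left (abs_nonneg _) (mul_le_one₀ (abs_le_one_of_mem h5)
          (abs_nonneg _) (abs_le_one_of_mem (hχ01 k x)))
      have := hab.add hbt
      simpa using this
    -- The bound is independent of k: the cutoffs at infinity share the constant q, and the cutoffs
    -- near K have energy at most 1.
    have hbd : ∀ k, energy α (a k) ≤ ENNReal.ofReal (‖f - u‖ * ‖u‖) +
        (2 * 1 + ENNReal.ofReal q * ‖u‖ₑ ^ 2 * Q) := fun k => by
      refine (energy_mul_le_of_weak h h0 h2 hQ hK.isClosed.isOpen_compl hu hw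
        (hsm k (hχs k)) (hcs k (hχc k)) (hsupp k (χ k)) (hχ01 k) (hW01 k) hq (hχq k)
        (fun x => rfl) (hwW k) (ha k)).trans ?_
      gcongr
      exact hwk1 k
    refine ne_top_of_le_ne_top ?_ (energy_le_of_tendsto hat hbd)
    refine ENNReal.add_ne_top.mpr ⟨ENNReal.ofReal_ne_top, ENNReal.add_ne_top.mpr ⟨by simp, ?_⟩⟩
    exact ENNReal.mul_ne_top (ENNReal.mul_ne_top ENNReal.ofReal_ne_top (by simp)) hQ'
  -- the weak equation holds on the whole space
  have hglob : ∀ g ∈ testFunctions d Set.univ, ∀ y, HasFracLap α g y →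
      inner ℝ u (g + y) = inner ℝ f g := by
    rintro g ⟨G, hG, hGc, -, hgG⟩ y hy
    obtain ⟨M, q', hq', hM, hGq⟩ := exists_sq_sub_le_of_contDiff hG hGc
    have hex : ∀ k, ∃ p : L2 d, p =ᵐ[volume] fun x => w k x * G x := fun k =>
      exists_mul_bounded (w k) hG.continuous.measurable hM
    choose p hp using hex
    have hpG : ∀ k, g - p k =ᵐ[volume] fun x => G x * (1 - W k x) := fun k => by
      filter_upwards [hp k, hgG, hwW k, Lp.coeFn_sub g (p k)] with x h1 h2 h3 h4
      rw [h4, Pi.sub_apply, h1, h2, h3]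
      ring
    have hT : ∀ k, g - p k ∈ testFunctions d Kᶜ := fun k =>
      ⟨_, hsm k hG, hcs k hGc, hsupp k G, hpG k⟩
    choose z hz using fun k => exists_hasFracLap_of_mem_testFunctions h0 h2 (hT k)
    have hpz : ∀ k, HasFracLap α (p k) (y - z k) := fun k => by
      have := hy.sub (hz k)
      rwa [sub_sub_cancel] at this
    have hM0 : 0 ≤ M := (abs_nonneg _).trans (hM 0)
    have hpn : Tendsto p atTop (𝓝 0) := by
      rw [tendsto_zero_iff_norm_tendsto_zero]
      have hMw : Tendsto (fun k => M * ‖w k‖) atTop (𝓝 0) := by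
        simpa using hwt.const_mul M
      refine squeeze_zero (fun _ => norm_nonneg _) (fun k => ?_) hMw
      refine Lp.norm_le_mul_norm_of_ae_le_mul ?_
      filter_upwards [hp k] with x hx
      rw [hx, norm_mul, mul_comm]
      exact mul_le_mul_of_nonneg_right (hM x) (norm_nonneg _)
    have hpE : Tendsto (fun k => energy α (p k)) atTop (𝓝 0) := by
      have hub : ∀ k, energy α (p k) ≤ ENNReal.ofReal (2 * M ^ 2) * energy α (w k) +
          ENNReal.ofReal q' * ‖w k‖ₑ ^ 2 * Q := fun k =>
        energy_mul_le h hQ hM hq' hGq ((hp k).trans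
          (Eventually.of_forall fun x => mul_comm _ _))
      refine tendsto_of_tendsto_of_tendsto_of_le_of_le tendsto_const_nhds ?_
        (fun k => zero_le) hub
      have e1 := ENNReal.Tendsto.const_mul (a := ENNReal.ofReal (2 * M ^ 2)) hwEt
        (Or.inr ENNReal.ofReal_ne_top)
      have e0 : Tendsto (fun k => ‖w k‖ₑ) atTop (𝓝 0) := by
        have := ENNReal.tendsto_ofReal hwt
        simpa using this
      have e2 := ENNReal.Tendsto.mul_const (b := Q) (ENNReal.Tendsto.const_mul
        (a := ENNReal.ofReal q') (ENNReal.Tendsto.pow (n := 2) e0)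
        (Or.inr ENNReal.ofReal_ne_top)) (Or.inr hQ')
      have := e1.add e2
      simpa using this
    -- This inner product is the mutual energy of u and gw, w = `w k`. The Cauchy–Schwarz inequality
    -- makes it vanish in the limit; finiteness of the energy of u is essential here.
    have hinz : Tendsto (fun k => inner ℝ u (y - z k)) atTop (𝓝 0) := by
      have hsq : Tendsto (fun k => ENNReal.ofReal ((inner ℝ u (y - z k)) ^ 2)) atTop (𝓝 0) := by
        refine tendsto_of_tendsto_of_tendsto_of_le_of_le tendsto_const_nhds ?_
          (fun k => zero_le) (fun k => (hpz k).inner_sq_le hEu)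
        have := ENNReal.Tendsto.const_mul (a := energy α u) hpE (Or.inr hEu)
        simpa using this
      have hsq2 := (ENNReal.tendsto_toReal ENNReal.zero_ne_top).comp hsq
      simp only [Function.comp_def, ENNReal.toReal_ofReal (sq_nonneg _), ENNReal.toReal_zero]
        at hsq2
      have := hsq2.sqrt
      simp only [Real.sqrt_sq_eq_abs, Real.sqrt_zero] at this
      exact (tendsto_zero_iff_abs_tendsto_zero _).mpr this
    have hlim : Tendsto (fun k => inner ℝ (u - f) (p k) + inner ℝ u (y - z k)) atTop (𝓝 0) := by
      have := ((tendsto_const_nhds (x := u - f)).inner hpn).add hinz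
      simpa using this
    have hconst : ∀ k, inner ℝ (u - f) (p k) + inner ℝ u (y - z k) =
        inner ℝ u (g + y) - inner ℝ f g := fun k => by
      have h1 := hw _ (hT k) _ (hz k)
      simp only [inner_sub_left, inner_sub_right, inner_add_right] at h1 ⊢
      linarith
    simp_rw [hconst] at hlim
    exact sub_eq_zero.mp (tendsto_nhds_unique tendsto_const_nhds hlim)
  -- conclusion by mollification
  have hmol : ∀ n, HasFracLap α (mollify d n u) (mollify d n (f - u)) := by
    intro n
    have hz := hasFracLap_mollify h0 h2 n u
    -- Mollifications of nonnegative compactly supported v are global test functions; moving the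
    -- mollifier back to u makes the difference orthogonal to every such v.
    have hD : mult (fracMollSymbol d h0 h2 n) u - mollify d n (f - u) = 0 := by
      refine eq_zero_of_inner_eq_zero fun v S hS hv hvS => ?_
      have hT := mollify_mem_testFunctions (n := n) hS (Set.subset_univ _) hv hvS
      have h3 := hglob _ hT _ (hasFracLap_mollify h0 h2 n v)
      rw [inner_sub_left, inner_mult_left, mollify, inner_mult_left, inner_sub_left]
      rw [inner_add_right] at h3
      simp only [mollify] at h3
      linarith
    rwa [sub_eq_zero.mp hD] at hz
  exact hasFracLap_of_tendsto (tendsto_mollify u) (tendsto_mollify (f - u)) hmol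

end Weak

/-! ### Strong convergence from a dense set -/

section Dense

variable {E : Type*} [NormedAddCommGroup E] [NormedSpace ℝ E]

/-- Uniformly bounded operators that converge on a dense set converge everywhere. -/
theorem cauchySeq_apply_of_dense {T : ℕ → E →L[ℝ] E} (hT : ∀ n x, ‖T n x‖ ≤ ‖x‖) {S : Set E}
    (hS : Dense S) (h : ∀ x ∈ S, CauchySeq fun n => T n x) (x : E) : CauchySeq fun n => T n x := by
  rw [Metric.cauchySeq_iff']
  intro ε hε
  obtain ⟨y, hyS, hy⟩ := Metric.dense_iff.mp hS x (ε / 3) (by positivity)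
  obtain ⟨N, hN⟩ := Metric.cauchySeq_iff'.mp (h y hy) (ε / 3) (by positivity)
  refine ⟨N, fun n hn => ?_⟩
  have h1 := hN n hn
  rw [Metric.mem_ball, dist_eq_norm] at hyS
  rw [dist_eq_norm] at h1 ⊢
  have e : T n x - T N x = (T n y - T N y) - T n (y - x) + T N (y - x) := by
    simp only [map_sub]
    abel
  rw [e]
  calc _ ≤ ‖T n y - T N y‖ + ‖T n (y - x)‖ + ‖T N (y - x)‖ :=
        (norm_add_le _ _).trans (by gcongr; exact norm_sub_le _ _)
    _ < ε := by linarith [hT n (y - x), hT N (y - x)]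

/-- Uniformly bounded operators that converge to `0` on a dense set converge to `0` everywhere. -/
theorem tendsto_zero_of_dense {F ι : Type*} [NormedAddCommGroup F] [NormedSpace ℝ F]
    {l : Filter ι} {T : ι → E →L[ℝ] F} {M : ℝ}
    (hT : ∀ᶠ i in l, ∀ x, ‖T i x‖ ≤ M * ‖x‖) {S : Set E}
    (hS : Dense S) (h : ∀ x ∈ S, Tendsto (fun i => T i x) l (𝓝 0)) (x : E) :
    Tendsto (fun i => T i x) l (𝓝 0) := by
  have hM : ∀ᶠ i in l, ∀ x, ‖T i x‖ ≤ (|M| + 1) * ‖x‖ := hT.mono fun i hi x =>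
    (hi x).trans (by gcongr; linarith [le_abs_self M])
  rw [Metric.tendsto_nhds]
  intro ε hε
  obtain ⟨y, hyS, hy⟩ := Metric.dense_iff.mp hS x (ε / (2 * (|M| + 1))) (by positivity)
  filter_upwards [Metric.tendsto_nhds.mp (h y hy) (ε / 2) (by positivity), hM] with i h1 h2
  rw [Metric.mem_ball, dist_comm, dist_eq_norm] at hyS
  rw [dist_zero_right] at h1 ⊢
  have e : T i x = T i y + T i (x - y) := by
    rw [map_sub]
    abel
  rw [e]
  have h3 : (|M| + 1) * ‖x - y‖ < ε / 2 := by
    rw [lt_div_iff₀ (by positivity)] at hyS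
    linarith
  calc _ ≤ ‖T i y‖ + ‖T i (x - y)‖ := norm_add_le _ _
    _ < ε := by linarith [h2 (x - y)]

end Dense

/-! ### Exponentials of bounded operators -/

section Exponential

variable {E : Type*} [NormedAddCommGroup E] [NormedSpace ℝ E] [CompleteSpace E]

theorem exp_add_of_commute_real {A B : E →L[ℝ] E} (h : Commute A B) :
    NormedSpace.exp (A + B) = NormedSpace.exp A * NormedSpace.exp B :=
  NormedSpace.exp_add_of_commute_of_mem_ball (𝕂 := ℝ) h
    ((NormedSpace.expSeries_radius_eq_top ℝ (E →L[ℝ] E)).symm ▸ edist_lt_top _ _)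
    ((NormedSpace.expSeries_radius_eq_top ℝ (E →L[ℝ] E)).symm ▸ edist_lt_top _ _)

/-- The identity is central. The exponential thereby becomes the average of the powers of J under
the Poisson distribution with mean s. -/
theorem exp_smul_sub_one (J : E →L[ℝ] E) (s : ℝ) :
    NormedSpace.exp (s • (J - 1)) = Real.exp (-s) • NormedSpace.exp (s • J) := by
  have e : s • (J - 1) = algebraMap ℝ (E →L[ℝ] E) (-s) + s • J := by
    rw [Algebra.algebraMap_eq_smul_one, smul_sub, neg_smul]
    abel
  rw [e, exp_add_of_commute_real (Algebra.commute_algebraMap_left _ _), ← NormedSpace.algebraMap_exp_comm,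
    ← Real.exp_eq_exp_ℝ, Algebra.algebraMap_eq_smul_one, smul_mul_assoc, one_mul]

/-- `exp (s (J - 1))` maps every closed convex set that contains `0` and is invariant under `J`
into itself. -/
theorem exp_smul_sub_one_mem {J : E →L[ℝ] E} {C : Set E} (hC : IsClosed C) (hconv : Convex ℝ C)
    (h0 : 0 ∈ C) (hJ : ∀ x ∈ C, J x ∈ C) {s : ℝ} (hs : 0 ≤ s) {x : E} (hx : x ∈ C) :
    NormedSpace.exp (s • (J - 1)) x ∈ C := by
  have hpow : ∀ k : ℕ, (J ^ k) x ∈ C := fun k => by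
    induction k with
    | zero => simpa using hx
    | succ k ih =>
      rw [pow_succ', mul_apply_eq_comp]
      exact hJ _ ih
  have hsum := (NormedSpace.exp_series_hasSum_exp' (𝕂 := ℝ) (s • J))
  have hsum2 : HasSum (fun n : ℕ => Real.exp (-s) • ((n.factorial : ℝ)⁻¹ • (s • J) ^ n) x)
      (NormedSpace.exp (s • (J - 1)) x) := by
    rw [exp_smul_sub_one]
    exact (hsum.mapL (ContinuousLinearMap.apply ℝ E x)).const_smul (Real.exp (-s))
  refine hC.mem_of_tendsto hsum2.tendsto_sum_nat (Eventually.of_forall fun m => ?_)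
  -- Poisson weights. Partial sums have total mass at most 1, and the missing mass is placed at 0 ∈
  -- C; the empty sum, whose mass is zero, is treated separately.
  set w : ℕ → ℝ := fun k => Real.exp (-s) * (s ^ k / (k.factorial : ℝ)) with hw
  have hw0 : ∀ k, 0 ≤ w k := fun k => by positivity
  have hterm : ∀ n : ℕ, Real.exp (-s) • ((n.factorial : ℝ)⁻¹ • (s • J) ^ n) x =
      w n • (J ^ n) x := fun n => by
    rw [smul_pow, smul_apply, smul_apply, smul_smul,
      smul_smul]
    congr 1
    simp only [hw]
    ring
  simp_rw [hterm]
  have hle : ∑ k ∈ Finset.range m, w k ≤ 1 := by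
    have := Real.sum_le_exp_of_nonneg hs m
    rw [← Finset.mul_sum]
    calc _ ≤ Real.exp (-s) * Real.exp s := by gcongr
      _ = 1 := by rw [← Real.exp_add, neg_add_cancel, Real.exp_zero]
  rcases (Finset.sum_nonneg fun k _ => hw0 k : 0 ≤ ∑ k ∈ Finset.range m, w k).eq_or_lt with h | h
  · have hz := (Finset.sum_eq_zero_iff_of_nonneg fun k _ => hw0 k).mp h.symm
    rw [Finset.sum_eq_zero fun k hk => by rw [hz k hk, zero_smul]]
    exact h0
  · have := hconv.smul_mem_of_zero_mem h0 (hconv.centerMass_mem (t := Finset.range m)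
      (fun k _ => hw0 k) h fun k _ => hpow k) ⟨h.le, hle⟩
    rwa [Finset.centerMass, smul_smul, mul_inv_cancel₀ h.ne', one_smul] at this

theorem norm_exp_smul_sub_one_le {J : E →L[ℝ] E} (hJ : ∀ x, ‖J x‖ ≤ ‖x‖) {s : ℝ} (hs : 0 ≤ s)
    (x : E) : ‖NormedSpace.exp (s • (J - 1)) x‖ ≤ ‖x‖ := by
  have := exp_smul_sub_one_mem (C := Metric.closedBall (0 : E) ‖x‖) Metric.isClosed_closedBall
    (convex_closedBall _ _) (by simp) (J := J)
    (fun y hy => by simpa using (hJ y).trans (by simpa using hy)) hs (x := x) (by simp)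
  simpa using this

theorem hasDerivAt_exp_apply (A : E →L[ℝ] E) (x : E) (t : ℝ) :
    HasDerivAt (fun s : ℝ => NormedSpace.exp (s • A) x) (NormedSpace.exp (t • A) (A x)) t :=
  (hasDerivAt_exp_smul_const A t).clm_apply (hasDerivAt_const t x) |>.congr_deriv (by simp)

/-- Duhamel's formula: s ↦ e^{sA} e^{(t-s)B} x interpolates between the two terms and has derivative
e^{sA} e^{(t-s)B} (A - B)x, by commutation. -/
theorem norm_exp_sub_exp_le {A B : E →L[ℝ] E} (hAB : Commute A B)
    (hA : ∀ s : ℝ, 0 ≤ s → ∀ x, ‖NormedSpace.exp (s • A) x‖ ≤ ‖x‖)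
    (hB : ∀ s : ℝ, 0 ≤ s → ∀ x, ‖NormedSpace.exp (s • B) x‖ ≤ ‖x‖) {t : ℝ} (ht : 0 ≤ t) (x : E) :
    ‖NormedSpace.exp (t • A) x - NormedSpace.exp (t • B) x‖ ≤ t * ‖(A - B) x‖ := by
  have hd : ∀ s ∈ Set.Icc (0 : ℝ) t, HasDerivWithinAt
      (fun s : ℝ => (NormedSpace.exp (s • A) * NormedSpace.exp ((t - s) • B)) x)
      (NormedSpace.exp (s • A) (NormedSpace.exp ((t - s) • B) ((A - B) x))) (Set.Icc 0 t) s := by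
    intro s _
    have h1 := hasDerivAt_exp_smul_const A s
    have h2 : HasDerivAt (fun s : ℝ => NormedSpace.exp ((t - s) • B))
        ((-1 : ℝ) • (NormedSpace.exp ((t - s) • B) * B)) s :=
      (hasDerivAt_exp_smul_const B (t - s)).scomp s ((hasDerivAt_id s).const_sub t)
    have h3 := (h1.mul h2).clm_apply (hasDerivAt_const s x)
    refine (h3.congr_deriv ?_).hasDerivWithinAt
    have hc : Commute A (NormedSpace.exp ((t - s) • B)) := (hAB.smul_right _).exp_right
    have e : NormedSpace.exp (s • A) * A * NormedSpace.exp ((t - s) • B) =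
        NormedSpace.exp (s • A) * NormedSpace.exp ((t - s) • B) * A := by
      rw [mul_assoc, hc.eq, mul_assoc]
    rw [e]
    simp [mul_assoc, sub_eq_add_neg]
  have := Convex.norm_image_sub_le_of_norm_hasDerivWithin_le (C := ‖(A - B) x‖) hd
    (fun s hs => (hA s hs.1 _).trans (hB (t - s) (by linarith [hs.2]) _)) (convex_Icc 0 t)
    (Set.left_mem_Icc.mpr ht) (Set.right_mem_Icc.mpr ht)
  simpa [abs_of_nonneg ht, mul_comm] using this

theorem norm_exp_sub_id_le {A : E →L[ℝ] E}
    (hA : ∀ s : ℝ, 0 ≤ s → ∀ x, ‖NormedSpace.exp (s • A) x‖ ≤ ‖x‖) {t : ℝ} (ht : 0 ≤ t) (x : E) :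
    ‖NormedSpace.exp (t • A) x - x‖ ≤ t * ‖A x‖ := by
  have := norm_exp_sub_exp_le (Commute.zero_right A) hA (by simp [NormedSpace.exp_zero]) ht x
  simpa [NormedSpace.exp_zero] using this

theorem norm_exp_sub_id_sub_smul_le {A : E →L[ℝ] E}
    (hA : ∀ s : ℝ, 0 ≤ s → ∀ x, ‖NormedSpace.exp (s • A) x‖ ≤ ‖x‖) {t : ℝ} (ht : 0 ≤ t) (x : E) :
    ‖NormedSpace.exp (t • A) x - x - t • A x‖ ≤ t ^ 2 * ‖A (A x)‖ := by
  have hd : ∀ s ∈ Set.Icc (0 : ℝ) t, HasDerivWithinAt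
      (fun s : ℝ => NormedSpace.exp (s • A) x - s • A x)
      (NormedSpace.exp (s • A) (A x) - A x) (Set.Icc 0 t) s := by
    intro s _
    have h1 := (hasDerivAt_exp_apply A x s).sub ((hasDerivAt_id s).smul_const (A x))
    rw [one_smul] at h1
    exact h1.hasDerivWithinAt
  have := Convex.norm_image_sub_le_of_norm_hasDerivWithin_le (C := t * ‖A (A x)‖) hd
    (fun s hs => (norm_exp_sub_id_le hA hs.1 _).trans (by gcongr; exact hs.2)) (convex_Icc 0 t)
    (Set.left_mem_Icc.mpr ht) (Set.right_mem_Icc.mpr ht)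
  simp only [zero_smul, NormedSpace.exp_zero, sub_zero, one_apply_eq_self,
    Real.norm_of_nonneg ht] at this
  rw [sub_right_comm]
  refine this.trans (le_of_eq (by ring))

end Exponential

/-! ### Self-adjoint operators with a prescribed resolvent -/

section HilleYosida

variable {H : Type*} [NormedAddCommGroup H] [InnerProductSpace ℝ H]

/-- `G = (1 - A)⁻¹` for a self-adjoint operator `A ≤ 0`. -/
structure IsSymmResolvent (G : H →L[ℝ] H) : Prop where
  symm : ∀ x y, inner ℝ (G x) y = inner ℝ x (G y)
  norm_sq_le : ∀ x, ‖G x‖ ^ 2 ≤ inner ℝ (G x) x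
  inj : ∀ x, G x = 0 → x = 0

/-- The operator `1 - G⁻¹`. -/
def genOf (G : H →L[ℝ] H) : H →ₗ.[ℝ] H :=
  (LinearMap.range ((G : H →ₗ[ℝ] H).prod ((G : H →ₗ[ℝ] H) - LinearMap.id))).toLinearPMap

variable {G : H →L[ℝ] H}

/-- Injectivity of G makes the set of pairs (Gx, Gx - x) a graph. All later work uses the bounded
equation G(u - v) = u. -/
theorem IsSymmResolvent.mem_genOf_graph_iff (hG : IsSymmResolvent G) {u v : H} :
    (u, v) ∈ (genOf G).graph ↔ G (u - v) = u := by
  rw [genOf, Submodule.toLinearPMap_graph_eq]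
  · constructor
    · rintro ⟨x, hx⟩
      obtain ⟨rfl, rfl⟩ := Prod.mk.inj hx
      simp
    · intro h
      refine ⟨u - v, Prod.ext h ?_⟩
      change G (u - v) - (u - v) = v
      rw [h, sub_sub_cancel]
  · rintro _ ⟨x, rfl⟩ hx
    have : x = 0 := hG.inj x hx
    simp [this]

/-- The equation for the resolvent at larger parameters has at most one solution. -/
theorem IsSymmResolvent.eq_of_eq (hG : IsSymmResolvent G) {n : ℝ} (hn : 0 ≤ n) {a y y' : H}
    (h : y = G (a - n • y)) (h' : y' = G (a - n • y')) : y = y' := by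
  have h1 : y - y' = -(n • G (y - y')) := by
    nth_rw 1 [h, h']
    simp only [map_sub, map_smul]
    module
  have h2 : ‖y - y'‖ ^ 2 = -(n * inner ℝ (G (y - y')) (y - y')) := by
    rw [← real_inner_self_eq_norm_sq]
    nth_rw 1 [h1]
    rw [inner_neg_left, real_inner_smul_left]
  have h3 := (sq_nonneg _).trans (hG.norm_sq_le (y - y'))
  have h4 : ‖y - y'‖ ^ 2 ≤ 0 := by
    rw [h2]
    linarith [mul_nonneg hn h3]
  exact sub_eq_zero.mp (norm_eq_zero.mp (pow_eq_zero_iff two_ne_zero |>.mp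
    (le_antisymm h4 (sq_nonneg _))))

/-- A sequence of resolvents as in `IsSymmResolvent.exists_yosida`. -/
def IsYosida (G : H →L[ℝ] H) (J : ℕ → H →L[ℝ] H) : Prop :=
  ∀ (n : ℕ) (x : H), J n x = G (((n : ℝ) + 1) • x - (n : ℝ) • J n x)

/-- The Yosida approximation of `1 - G⁻¹`. -/
def yosida (J : ℕ → H →L[ℝ] H) (n : ℕ) : H →L[ℝ] H := ((n : ℝ) + 1) • (J n - 1)

variable {J : ℕ → H →L[ℝ] H}

/-- The bound ‖Gy‖² ≤ ⟨Gy, y⟩ at y = (n + 1)x - nJₙx rearranges to ‖Jₙx‖² ≤ ⟨Jₙx, x⟩. -/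
theorem IsYosida.norm_le (hG : IsSymmResolvent G) (hJ : IsYosida G J) (n : ℕ) (x : H) :
    ‖J n x‖ ≤ ‖x‖ := by
  have h := hG.norm_sq_le (((n : ℝ) + 1) • x - (n : ℝ) • J n x)
  rw [← hJ n x, inner_sub_right, real_inner_smul_right, real_inner_smul_right,
    real_inner_self_eq_norm_sq] at h
  have hn : (0 : ℝ) < (n : ℝ) + 1 := by positivity
  have h2 : ‖J n x‖ * ‖J n x‖ ≤ ‖x‖ * ‖J n x‖ := by
    have := real_inner_le_norm (J n x) x
    nlinarith
  rcases (norm_nonneg (J n x)).eq_or_lt with h3 | h3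
  · rw [← h3]
    exact norm_nonneg x
  · exact le_of_mul_le_mul_right h2 h3

/-- Both sides solve the same resolvent equation, whose solution is unique. -/
theorem IsYosida.comm_apply (hG : IsSymmResolvent G) (hJ : IsYosida G J) {T : H →L[ℝ] H}
    (hT : ∀ x, T (G x) = G (T x)) (n : ℕ) (x : H) : J n (T x) = T (J n x) := by
  refine hG.eq_of_eq n.cast_nonneg (hJ n (T x)) ?_
  nth_rw 1 [hJ n x]
  rw [hT]
  simp only [map_sub, map_smul]

theorem IsYosida.inner_comm (hG : IsSymmResolvent G) (hJ : IsYosida G J) (n : ℕ) (x y : H) :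
    inner ℝ (J n x) y = inner ℝ x (J n y) := by
  have h1 := hG.symm (((n : ℝ) + 1) • x - (n : ℝ) • J n x) (((n : ℝ) + 1) • y - (n : ℝ) • J n y)
  rw [← hJ n x, ← hJ n y] at h1
  simp only [inner_sub_left, inner_sub_right, real_inner_smul_left, real_inner_smul_right] at h1
  have hn : (n : ℝ) + 1 ≠ 0 := by positivity
  refine mul_left_cancel₀ hn ?_
  linarith

/-- With A = 1 - G⁻¹ this says Aₙu = JₙAu for u = Gx in the domain, the identity through which Aₙ
approximates A. -/
theorem IsYosida.yosida_apply (hG : IsSymmResolvent G) (hJ : IsYosida G J) (n : ℕ) (x : H) :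
    yosida J n (G x) = J n (G x - x) := by
  have h1 := hJ n x
  rw [map_sub, map_smul, map_smul, ← hJ.comm_apply hG (fun _ => rfl) n x] at h1
  have h2 : ((n : ℝ) + 1) • G x = J n x + (n : ℝ) • J n (G x) := eq_add_of_sub_eq h1.symm
  simp only [yosida, smul_apply, sub_apply, one_apply_eq_self, smul_sub, map_sub, h2]
  module

theorem yosida_exp (J : ℕ → H →L[ℝ] H) (n : ℕ) (t : ℝ) :
    NormedSpace.exp (t • yosida J n) =
      NormedSpace.exp ((t * ((n : ℝ) + 1)) • (J n - 1)) := by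
  rw [yosida, smul_smul]

theorem IsYosida.commute (hG : IsSymmResolvent G) (hJ : IsYosida G J) (n m : ℕ) :
    Commute (yosida J n) (yosida J m) := by
  have h : Commute (J n) (J m) := ContinuousLinearMap.ext fun x =>
    hJ.comm_apply hG (fun y => hJ.comm_apply hG (fun _ => rfl) m y) n x
  have h1 : Commute (J n - 1) (J m - 1) :=
    (h.sub_left (Commute.one_left _)).sub_right (Commute.one_right _)
  exact (h1.smul_left _).smul_right _

variable [CompleteSpace H]

theorem IsSymmResolvent.denseRange (hG : IsSymmResolvent G) : DenseRange G := by
  have : (LinearMap.range (G : H →ₗ[ℝ] H)).topologicalClosure = ⊤ := by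
    rw [Submodule.topologicalClosure_eq_top_iff, Submodule.eq_bot_iff]
    intro x hx
    refine hG.inj x (ext_inner_left ℝ fun y => ?_)
    rw [← hG.symm, inner_zero_right]
    exact (Submodule.mem_orthogonal _ _).mp hx _ ⟨y, rfl⟩
  have h := Submodule.dense_iff_topologicalClosure_eq_top.mpr this
  rwa [LinearMap.coe_range] at h

/-- A pair (u, v) lies in the graph of the adjoint iff ⟨Gx - x, u⟩ = ⟨Gx, v⟩ for all x, which by
symmetry of G is G(u - v) = u again. -/
theorem IsSymmResolvent.isSelfAdjoint (hG : IsSymmResolvent G) : IsSelfAdjoint (genOf G) := by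
  have hd : Dense ((genOf G).domain : Set H) := by
    refine hG.denseRange.mono ?_
    rintro _ ⟨x, rfl⟩
    exact LinearPMap.mem_domain_of_mem_graph (y := G x - x)
      (hG.mem_genOf_graph_iff.mpr (by simp))
  rw [LinearPMap.isSelfAdjoint_def]
  refine LinearPMap.eq_of_eq_graph ?_
  rw [LinearPMap.adjoint_graph_eq_graph_adjoint hd]
  ext ⟨u, v⟩
  rw [Submodule.mem_adjoint_iff, hG.mem_genOf_graph_iff]
  constructor
  · intro h
    refine ext_inner_left ℝ fun x => ?_
    have := h (G x) (G x - x) (hG.mem_genOf_graph_iff.mpr (by simp))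
    simp only [inner_sub_left, hG.symm] at this
    rw [map_sub, inner_sub_right]
    linarith
  · intro h a b hab
    rw [hG.mem_genOf_graph_iff] at hab
    have h1 : inner ℝ (u - v) (G (a - b)) = inner ℝ u (a - b) := by rw [← hG.symm, h]
    rw [hab] at h1
    simp only [inner_sub_left, inner_sub_right] at h1
    linarith [real_inner_comm a u, real_inner_comm b u, real_inner_comm a v, real_inner_comm b v]

/-- The resolvents `λ (λ - A)⁻¹` at the integers `λ = n + 1`. -/
theorem IsSymmResolvent.exists_yosida (hG : IsSymmResolvent G) (n : ℕ) :
    ∃ J : H →L[ℝ] H, ∀ x, J x = G (((n : ℝ) + 1) • x - (n : ℝ) • J x) := by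
  -- Since G ≥ 0, the operator 1 + nG is coercive, hence invertible, and J = (n + 1) G (1 + nG)⁻¹.
  have hu : IsUnit (1 + (n : ℝ) • G) := by
    refine ContinuousLinearMap.isUnit_of_forall_le_norm_inner_map _ (c := 1) one_pos fun x => ?_
    refine le_trans ?_ (le_abs_self _)
    have h3 := (sq_nonneg _).trans (hG.norm_sq_le x)
    simp only [NNReal.coe_one, mul_one, add_apply, one_apply_eq_self, smul_apply, inner_add_left,
      real_inner_smul_left, real_inner_self_eq_norm_sq]
    nlinarith [mul_nonneg n.cast_nonneg h3]
  obtain ⟨S, hS⟩ := hu.exists_right_inv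
  have hS' : ∀ x, S x + (n : ℝ) • G (S x) = x := fun x => congrArg (fun T : H →L[ℝ] H => T x) hS
  refine ⟨((n : ℝ) + 1) • (G * S), fun x => ?_⟩
  simp only [smul_apply, mul_apply_eq_comp]
  rw [← map_smul]
  congr 1
  nth_rw 2 [← hS' x]
  simp only [map_smul]
  module

/-- On the range of G the difference Jₙ - 1 is 1/(n + 1) times a bounded vector, and the range is
dense. -/
theorem IsYosida.tendsto (hG : IsSymmResolvent G) (hJ : IsYosida G J) (x : H) :
    Tendsto (fun n => J n x) atTop (𝓝 x) := by
  have h : Tendsto (fun n => (J n - 1) x) atTop (𝓝 0) := by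
    refine tendsto_zero_of_dense (M := 2) (Eventually.of_forall fun n x => ?_) hG.denseRange ?_ x
    · rw [sub_apply, one_apply_eq_self]
      refine (norm_sub_le _ _).trans ?_
      linarith [hJ.norm_le hG n x]
    · rintro _ ⟨z, rfl⟩
      have hz : ∀ n : ℕ, (J n - 1) (G z) = (1 / ((n : ℝ) + 1)) • J n (G z - z) := fun n => by
        rw [← hJ.yosida_apply hG, yosida, smul_apply, smul_smul, one_div,
          inv_mul_cancel₀ (by positivity), one_smul]
      rw [tendsto_zero_iff_norm_tendsto_zero]
      have hl : Tendsto (fun n : ℕ => 1 / ((n : ℝ) + 1) * ‖G z - z‖) atTop (𝓝 0) := by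
        simpa using (tendsto_one_div_add_atTop_nhds_zero_nat (𝕜 := ℝ)).mul_const ‖G z - z‖
      refine squeeze_zero (fun _ => norm_nonneg _) (fun n => ?_) hl
      rw [hz, norm_smul, Real.norm_of_nonneg (by positivity)]
      gcongr
      exact hJ.norm_le hG n _
  have := h.add_const x
  simpa using this

theorem IsYosida.norm_exp_le (hG : IsSymmResolvent G) (hJ : IsYosida G J) (n : ℕ) {t : ℝ}
    (ht : 0 ≤ t) (x : H) : ‖NormedSpace.exp (t • yosida J n) x‖ ≤ ‖x‖ := by
  rw [yosida_exp]
  exact norm_exp_smul_sub_one_le (hJ.norm_le hG n) (by positivity) x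

/-- On the range of G the Duhamel bound is t‖(Jₙ - J_N)(Gz - z)‖, small because Jₙ converges
strongly; contractivity extends this to all x. -/
theorem IsYosida.cauchySeq_exp (hG : IsSymmResolvent G) (hJ : IsYosida G J) {t : ℝ} (ht : 0 ≤ t)
    (x : H) : CauchySeq fun n => NormedSpace.exp (t • yosida J n) x := by
  refine cauchySeq_apply_of_dense (fun n => hJ.norm_exp_le hG n ht) hG.denseRange ?_ x
  rintro _ ⟨z, rfl⟩
  have hc := (hJ.tendsto hG (G z - z)).cauchySeq
  rw [Metric.cauchySeq_iff'] at hc ⊢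
  intro ε hε
  obtain ⟨N, hN⟩ := hc (ε / (t + 1)) (by positivity)
  refine ⟨N, fun n hn => ?_⟩
  have h1 := hN n hn
  rw [dist_eq_norm, lt_div_iff₀ (by positivity)] at h1
  rw [dist_eq_norm]
  refine (norm_exp_sub_exp_le (hJ.commute hG n N) (fun s hs => hJ.norm_exp_le hG n hs)
    (fun s hs => hJ.norm_exp_le hG N hs) ht _).trans_lt ?_
  rw [sub_apply, hJ.yosida_apply hG, hJ.yosida_apply hG]
  nlinarith [norm_nonneg (J n (G z - z) - J N (G z - z))]

theorem IsYosida.exp_inner_comm (hG : IsSymmResolvent G) (hJ : IsYosida G J) (n : ℕ) (t : ℝ)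
    (x y : H) : inner ℝ (NormedSpace.exp (t • yosida J n) x) y =
      inner ℝ x (NormedSpace.exp (t • yosida J n) y) := by
  have h : IsSelfAdjoint (t • yosida J n) := by
    refine ContinuousLinearMap.isSelfAdjoint_iff_isSymmetric.mpr fun x y => ?_
    have := hJ.inner_comm hG n x y
    simp only [ContinuousLinearMap.coe_coe, yosida, smul_apply, sub_apply, one_apply_eq_self,
      real_inner_smul_left, real_inner_smul_right, inner_sub_left, inner_sub_right, this]
  exact ContinuousLinearMap.isSelfAdjoint_iff_isSymmetric.mp h.exp x y

/-- The Hille-Yosida theorem for `1 - G⁻¹`, together with invariance of closed convex sets. -/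
theorem IsSymmResolvent.exists_semigroup (hG : IsSymmResolvent G) : ∃ P : ℝ → H →L[ℝ] H,
    P 0 = ContinuousLinearMap.id ℝ H ∧
    (∀ s t, 0 ≤ s → 0 ≤ t → P (s + t) = (P s).comp (P t)) ∧
    (∀ t, 0 ≤ t → ‖P t‖ ≤ 1) ∧
    (∀ u, Tendsto (fun t => P t u) (𝓝[>] 0) (𝓝 u)) ∧
    (∀ t, 0 ≤ t → ∀ u v, inner ℝ (P t u) v = inner ℝ u (P t v)) ∧
    (∀ u v, (u, v) ∈ (genOf G).graph ↔
      Tendsto (fun t : ℝ => t⁻¹ • (P t u - u)) (𝓝[>] 0) (𝓝 v)) ∧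
    ∀ C : Set H, IsClosed C → Convex ℝ C → 0 ∈ C →
      (∀ (n : ℕ), ∀ f ∈ C, ∀ u, u = G (((n : ℝ) + 1) • f - (n : ℝ) • u) → u ∈ C) →
      ∀ t, 0 ≤ t → ∀ u ∈ C, P t u ∈ C := by
  choose J hJ using hG.exists_yosida
  replace hJ : IsYosida G J := hJ
  -- Negative times are sent to 0, where the exponentials are trivial; only t ≥ 0 matters.
  have hlim : ∀ t : ℝ, ∀ x, ∃ y,
      Tendsto (fun n => NormedSpace.exp (max t 0 • yosida J n) x) atTop (𝓝 y) := fun t x =>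
    cauchySeq_tendsto_of_complete (hJ.cauchySeq_exp hG (le_max_right t 0) x)
  choose F hF using hlim
  let P : ℝ → H →L[ℝ] H := fun t => continuousLinearMapOfTendsto
    (fun n => NormedSpace.exp (max t 0 • yosida J n)) (tendsto_pi_nhds.mpr (hF t))
  have hP : ∀ t, 0 ≤ t → ∀ x,
      Tendsto (fun n => NormedSpace.exp (t • yosida J n) x) atTop (𝓝 (P t x)) := fun t ht x => by
    have := hF t x
    rwa [max_eq_left ht] at this
  have hn : ∀ t, 0 ≤ t → ∀ x, ‖P t x‖ ≤ ‖x‖ := fun t ht x =>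
    le_of_tendsto (hP t ht x).norm (Eventually.of_forall fun n => hJ.norm_exp_le hG n ht x)
  have hsym : ∀ t, 0 ≤ t → ∀ u v, inner ℝ (P t u) v = inner ℝ u (P t v) := fun t ht u v =>
    tendsto_nhds_unique ((hP t ht u).inner tendsto_const_nhds)
      ((tendsto_const_nhds.inner (hP t ht v)).congr fun n => (hJ.exp_inner_comm hG n t u v).symm)
  have hd1 : ∀ t, 0 ≤ t → ∀ z, ‖P t (G z) - G z‖ ≤ t * ‖G z - z‖ := fun t ht z => by
    refine le_of_tendsto ((hP t ht (G z)).sub_const (G z)).norm (Eventually.of_forall fun n => ?_)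
    refine (norm_exp_sub_id_le (fun s hs => hJ.norm_exp_le hG n hs) ht _).trans ?_
    rw [hJ.yosida_apply hG]
    gcongr
    exact hJ.norm_le hG n _
  have hd2 : ∀ t, 0 ≤ t → ∀ z, ‖P t (G (G z)) - G (G z) - t • (G (G z) - G z)‖ ≤
      t ^ 2 * ‖G (G z - z) - (G z - z)‖ := fun t ht z => by
    have hl : Tendsto (fun n => yosida J n (G (G z))) atTop (𝓝 (G (G z) - G z)) :=
      (hJ.tendsto hG _).congr fun n => (hJ.yosida_apply hG n _).symm
    refine le_of_tendsto (((hP t ht (G (G z))).sub_const (G (G z))).sub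
      (hl.const_smul t)).norm (Eventually.of_forall fun n => ?_)
    refine (norm_exp_sub_id_sub_smul_le (fun s hs => hJ.norm_exp_le hG n hs) ht _).trans ?_
    have e : yosida J n (yosida J n (G (G z))) = J n (J n (G (G z - z) - (G z - z))) := by
      rw [hJ.yosida_apply hG n (G z), ← map_sub, hJ.comm_apply hG (fun _ => rfl),
        hJ.yosida_apply hG, ← hJ.comm_apply hG (T := G) (fun _ => rfl) n (G z - z), ← map_sub]
    rw [e]
    gcongr
    exact (hJ.norm_le hG n _).trans (hJ.norm_le hG n _)
  have hpos : ∀ᶠ t : ℝ in 𝓝[>] 0, 0 < t := eventually_mem_nhdsWithin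
  have ht0 : Tendsto (fun t : ℝ => t) (𝓝[>] 0) (𝓝 0) := tendsto_nhdsWithin_of_tendsto_nhds tendsto_id
  -- Second-order estimates give the derivative on the range of G². The difference quotients
  -- composed with G are uniformly bounded by the first-order estimate, so density extends the limit
  -- to the range of G.
  have hgen : ∀ f, Tendsto (fun t : ℝ => t⁻¹ • (P t (G f) - G f)) (𝓝[>] 0) (𝓝 (G f - f)) := by
    intro f
    have h := tendsto_zero_of_dense (l := 𝓝[>] (0 : ℝ))
      (T := fun t => t⁻¹ • (P t - 1) * G - (G - 1)) (M := 2 * ‖G - 1‖) ?_ hG.denseRange ?_ f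
    · have := h.add_const (G f - f)
      simpa using this
    · filter_upwards [hpos] with t ht x
      have e : ((t⁻¹ • (P t - 1) * G - (G - 1) : H →L[ℝ] H)) x =
          t⁻¹ • (P t (G x) - G x) - (G - 1) x := rfl
      rw [e]
      refine (norm_sub_le _ _).trans ?_
      have h1 : ‖t⁻¹ • (P t (G x) - G x)‖ ≤ ‖(G - 1) x‖ := by
        rw [norm_smul, Real.norm_of_nonneg (by positivity), inv_mul_le_iff₀ ht]
        exact hd1 t ht.le x
      linarith [(G - 1).le_opNorm x]
    · rintro _ ⟨z, rfl⟩
      rw [tendsto_zero_iff_norm_tendsto_zero]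
      have hl : Tendsto (fun t : ℝ => t * ‖G (G z - z) - (G z - z)‖) (𝓝[>] 0) (𝓝 0) := by
        simpa using ht0.mul_const ‖G (G z - z) - (G z - z)‖
      refine squeeze_zero' (Eventually.of_forall fun _ => norm_nonneg _) ?_ hl
      filter_upwards [hpos] with t ht
      have e : ((t⁻¹ • (P t - 1) * G - (G - 1) : H →L[ℝ] H)) (G z) =
          t⁻¹ • (P t (G (G z)) - G (G z) - t • (G (G z) - G z)) := by
        rw [smul_sub _ (P t (G (G z)) - G (G z)), smul_smul, inv_mul_cancel₀ ht.ne', one_smul]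
        rfl
      rw [e, norm_smul, Real.norm_of_nonneg (by positivity), inv_mul_le_iff₀ ht]
      refine (hd2 t ht.le z).trans (le_of_eq (by ring))
  refine ⟨P, ?_, ?_, ?_, ?_, hsym, ?_, ?_⟩
  · ext x
    refine tendsto_nhds_unique (hP 0 le_rfl x) ?_
    simp [NormedSpace.exp_zero]
  · intro s t hs ht
    ext x
    refine tendsto_nhds_unique (hP (s + t) (add_nonneg hs ht) x) ?_
    have h1 : ∀ n, NormedSpace.exp ((s + t) • yosida J n) x =
        NormedSpace.exp (s • yosida J n) (NormedSpace.exp (t • yosida J n) x - P t x) +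
          NormedSpace.exp (s • yosida J n) (P t x) := fun n => by
      rw [← map_add, sub_add_cancel, add_smul,
        exp_add_of_commute_real (((Commute.refl _).smul_left s).smul_right t)]
      rfl
    simp_rw [h1]
    have h2 : Tendsto (fun n => NormedSpace.exp (s • yosida J n)
        (NormedSpace.exp (t • yosida J n) x - P t x)) atTop (𝓝 0) := by
      rw [tendsto_zero_iff_norm_tendsto_zero]
      exact squeeze_zero (fun _ => norm_nonneg _) (fun n => hJ.norm_exp_le hG n hs _)
        (tendsto_iff_norm_sub_tendsto_zero.mp (hP t ht x))
    have := h2.add (hP s hs (P t x))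
    rwa [zero_add] at this
  · intro t ht
    exact ContinuousLinearMap.opNorm_le_bound _ zero_le_one fun x => by
      simpa using hn t ht x
  · intro u
    have h := tendsto_zero_of_dense (l := 𝓝[>] (0 : ℝ))
      (T := fun t => P t - 1) (M := 2) ?_ hG.denseRange ?_ u
    · have := h.add_const u
      simpa using this
    · filter_upwards [hpos] with t ht x
      rw [sub_apply, one_apply_eq_self]
      refine (norm_sub_le _ _).trans ?_
      linarith [hn t ht.le x]
    · rintro _ ⟨z, rfl⟩
      rw [tendsto_zero_iff_norm_tendsto_zero]
      have hl : Tendsto (fun t : ℝ => t * ‖G z - z‖) (𝓝[>] 0) (𝓝 0) := by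
        simpa using ht0.mul_const ‖G z - z‖
      refine squeeze_zero' (Eventually.of_forall fun _ => norm_nonneg _) ?_ hl
      filter_upwards [hpos] with t ht
      exact hd1 t ht.le z
  · intro u v
    rw [hG.mem_genOf_graph_iff]
    constructor
    · intro h
      have := hgen (u - v)
      rwa [h, sub_sub_cancel] at this
    · intro h
      -- If the difference quotients of u converge to v, symmetry of the semigroup gives ⟨v, Gf⟩ =
      -- ⟨u, Gf - f⟩ for all f, that is, G(u - v) = u: the generator is no larger than `genOf G`.
      refine ext_inner_right (𝕜 := ℝ) fun f => ?_
      have h1 := h.inner (𝕜 := ℝ) (tendsto_const_nhds (x := G f))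
      have h2 := (tendsto_const_nhds (x := u)).inner (𝕜 := ℝ) (hgen f)
      have h3 : inner ℝ v (G f) = inner ℝ u (G f - f) := by
        refine tendsto_nhds_unique h1 (h2.congr' ?_)
        filter_upwards [hpos] with t ht
        rw [real_inner_smul_left, real_inner_smul_right, inner_sub_left, inner_sub_right,
          hsym t ht.le]
      rw [hG.symm, inner_sub_left, h3, inner_sub_right]
      ring
  · intro C hC hconv h0 hCG t ht u hu
    refine hC.mem_of_tendsto (hP t ht u) (Eventually.of_forall fun n => ?_)
    rw [yosida_exp]
    exact exp_smul_sub_one_mem hC hconv h0 (fun f hf => hCG n f hf _ (hJ n f)) (by positivity) hu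

end HilleYosida

/-! ### Markov property of the semigroup from that of the resolvents -/

section MarkovResolvent

variable {X : Type*} [MeasurableSpace X] {μ : Measure X}

theorem isClosed_unitInterval : IsClosed {u : Lp ℝ 2 μ | ∀ᵐ x ∂μ, 0 ≤ u x ∧ u x ≤ 1} := by
  refine IsSeqClosed.isClosed fun u v hu hv => ?_
  obtain ⟨n, -, hn⟩ := (tendstoInMeasure_of_tendsto_Lp hv).exists_seq_tendsto_ae
  have h : ∀ᵐ x ∂μ, ∀ k, 0 ≤ u k x ∧ u k x ≤ 1 := ae_all_iff.mpr hu
  filter_upwards [hn, h] with x h1 h2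
  exact isClosed_Icc.mem_of_tendsto h1 (Eventually.of_forall fun k => h2 (n k))

theorem convex_unitInterval : Convex ℝ {u : Lp ℝ 2 μ | ∀ᵐ x ∂μ, 0 ≤ u x ∧ u x ≤ 1} := by
  intro u hu v hv a b ha hb hab
  filter_upwards [hu, hv, Lp.coeFn_add (a • u) (b • v), Lp.coeFn_smul a u, Lp.coeFn_smul b v]
    with x h1 h2 h3 h4 h5
  rw [h3, Pi.add_apply, h4, h5]
  exact (convex_Icc (0 : ℝ) 1) h1 h2 ha hb hab

theorem zero_mem_unitInterval : (0 : Lp ℝ 2 μ) ∈ {u : Lp ℝ 2 μ | ∀ᵐ x ∂μ, 0 ≤ u x ∧ u x ≤ 1} := by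
  filter_upwards [Lp.coeFn_zero ℝ 2 μ] with x hx
  rw [hx]
  simp

/-- If the resolvents of `1 - G⁻¹` are Markov operators, then it generates a Markov semigroup. -/
theorem IsSymmResolvent.exists_isMarkovSemigroup {G : Lp ℝ 2 μ →L[ℝ] Lp ℝ 2 μ}
    (hG : IsSymmResolvent G)
    (hM : ∀ (n : ℕ) (f : Lp ℝ 2 μ), (∀ᵐ x ∂μ, 0 ≤ f x ∧ f x ≤ 1) → ∀ u : Lp ℝ 2 μ,
      u = G (((n : ℝ) + 1) • f - (n : ℝ) • u) → ∀ᵐ x ∂μ, 0 ≤ u x ∧ u x ≤ 1) :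
    ∃ P, IsMarkovSemigroup P ∧ IsGenerator P (genOf G) := by
  obtain ⟨P, h0, hadd, hcontr, hcont, hsymm, hgen, hinv⟩ := hG.exists_semigroup
  exact ⟨P, ⟨h0, hadd, hcontr, hcont, hsymm,
    hinv _ isClosed_unitInterval convex_unitInterval zero_mem_unitInterval hM⟩, hgen⟩

end MarkovResolvent

/-! ### Resolvents of self-adjoint generators -/

section Dissipative

variable {H : Type*} [NormedAddCommGroup H] [InnerProductSpace ℝ H] [CompleteSpace H]
  {A : H →ₗ.[ℝ] H}

theorem mem_graph_iff_of_isSelfAdjoint (hA : IsSelfAdjoint A) {u v : H} :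
    (u, v) ∈ A.graph ↔ ∀ a b, (a, b) ∈ A.graph → inner ℝ b u - inner ℝ a v = 0 := by
  have h := LinearPMap.adjoint_graph_eq_graph_adjoint hA.dense_domain
  rw [LinearPMap.isSelfAdjoint_def.mp hA] at h
  nth_rw 1 [h]
  rw [Submodule.mem_adjoint_iff]

/-- If `A ≤ 0` is self-adjoint, then `1 - A` is onto. -/
theorem exists_mem_graph_of_isSelfAdjoint (hA : IsSelfAdjoint A)
    (hneg : ∀ u v, (u, v) ∈ A.graph → inner ℝ v u ≤ 0) (f : H) : ∃ u, (u, u - f) ∈ A.graph := by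
  let T : A.graph →L[ℝ] H :=
    (ContinuousLinearMap.fst ℝ H H - ContinuousLinearMap.snd ℝ H H).comp A.graph.subtypeL
  have hT : ∀ p : A.graph, T p = p.1.1 - p.1.2 := fun p => rfl
  -- As A ≤ 0, the map 1 - A is bounded below on the complete space `A.graph`, so its range is
  -- closed.
  have hbound : ∀ p : A.graph, ‖p‖ ≤ 2 * ‖T p‖ := by
    rintro ⟨⟨u, v⟩, hp⟩
    rw [hT]
    have h1 := hneg u v hp
    have h2 : ‖u‖ ≤ ‖u - v‖ := by
      have h3 : ‖u‖ * ‖u‖ ≤ ‖u - v‖ * ‖u‖ := by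
        refine le_trans ?_ (real_inner_le_norm (u - v) u)
        rw [inner_sub_left, real_inner_self_eq_norm_mul_norm]
        linarith
      rcases (norm_nonneg u).eq_or_lt with h4 | h4
      · rw [← h4]
        exact norm_nonneg _
      · exact le_of_mul_le_mul_right h3 h4
    have h3 : ‖v‖ ≤ ‖u‖ + ‖u - v‖ := by
      have := norm_sub_le u (u - v)
      rwa [sub_sub_cancel] at this
    change max ‖u‖ ‖v‖ ≤ _
    exact max_le (by linarith [norm_nonneg (u - v)]) (by linarith)
  have : CompleteSpace A.graph := (hA.isClosed : IsClosed (A.graph : Set (H × H))).completeSpace_coe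
  have hanti : AntilipschitzWith 2 T := ContinuousLinearMap.antilipschitz_of_bound T hbound
  have hcl : IsClosed (LinearMap.range (T : A.graph →ₗ[ℝ] H) : Set H) := by
    rw [LinearMap.coe_range]
    exact hanti.isClosed_range T.uniformContinuous
  have htop : LinearMap.range (T : A.graph →ₗ[ℝ] H) = ⊤ := by
    rw [← hcl.submodule_topologicalClosure_eq, Submodule.topologicalClosure_eq_top_iff,
      Submodule.eq_bot_iff]
    intro w hw
    -- A vector w orthogonal to the range satisfies A*w = w, and A* = A; since A ≤ 0, it vanishes.
    have hww : (w, w) ∈ A.graph := by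
      rw [mem_graph_iff_of_isSelfAdjoint hA]
      intro a b hab
      have := (Submodule.mem_orthogonal _ _).mp hw _ ⟨⟨(a, b), hab⟩, rfl⟩
      have e : T ⟨(a, b), hab⟩ = a - b := rfl
      rw [ContinuousLinearMap.coe_coe, e, inner_sub_left] at this
      linarith
    have := hneg w w hww
    exact inner_self_eq_zero.mp (le_antisymm this real_inner_self_nonneg)
  obtain ⟨⟨⟨u, v⟩, hp⟩, hf⟩ := LinearMap.range_eq_top.mp htop f
  have hf' : u - v = f := hf
  exact ⟨u, by rwa [← hf', sub_sub_cancel]⟩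

end Dissipative

/-! ### Resolvents of Markov generators and uniqueness for sets of zero capacity -/

section MarkovGenerator

variable {d : ℕ}

theorem inner_nonneg_of_ae {u v : L2 d} (h : ∀ᵐ x, 0 ≤ u x * v x) : 0 ≤ inner ℝ u v := by
  rw [L2.inner_def]
  refine integral_nonneg_of_ae ?_
  filter_upwards [h] with x hx
  rwa [Pi.zero_apply, real_inner_eq_mul]

/-- `clamp u` is the projection of `u` to the functions with values in `[0, 1]`. -/
theorem inner_sub_clamp_nonpos {f u v : L2 d} (hf : ∀ᵐ x, 0 ≤ f x ∧ f x ≤ 1)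
    (hv : v =ᵐ[volume] fun x => clamp (u x)) : inner ℝ (f - v) (u - v) ≤ 0 := by
  rw [← neg_nonneg, ← inner_neg_left, neg_sub]
  refine inner_nonneg_of_ae ?_
  filter_upwards [hf, hv, Lp.coeFn_sub v f, Lp.coeFn_sub u v] with x h1 h2 h3 h4
  rw [h3, h4, Pi.sub_apply, Pi.sub_apply, h2, clamp]
  rcases le_total (u x) 1 with h | h
  · rw [min_eq_left h]
    rcases le_total (u x) 0 with h' | h'
    · rw [max_eq_right h']
      nlinarith
    · rw [max_eq_left h']
      simp
  · rw [min_eq_right h, max_eq_left zero_le_one]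
    nlinarith

theorem ae_mem_of_eq_clamp {u v : L2 d} (hv : v =ᵐ[volume] fun x => clamp (u x)) :
    ∀ᵐ x, 0 ≤ v x ∧ v x ≤ 1 := by
  filter_upwards [hv] with x hx
  rw [hx]
  exact clamp_mem _

variable {P : ℝ → L2 d →L[ℝ] L2 d} {A : L2 d →ₗ.[ℝ] L2 d}

theorem IsMarkovSemigroup.norm_apply_le (hP : IsMarkovSemigroup P) {t : ℝ} (ht : 0 ≤ t)
    (u : L2 d) : ‖P t u‖ ≤ ‖u‖ := by
  have := (P t).le_of_opNorm_le (hP.contraction t ht) u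
  rwa [one_mul] at this

theorem IsMarkovSemigroup.inner_sub_nonneg (hP : IsMarkovSemigroup P) {t : ℝ} (ht : 0 ≤ t)
    (u : L2 d) : 0 ≤ inner ℝ (u - P t u) u := by
  have h1 := real_inner_le_norm (P t u) u
  have h2 := mul_le_mul_of_nonneg_right (hP.norm_apply_le ht u) (norm_nonneg u)
  rw [inner_sub_left, real_inner_self_eq_norm_mul_norm]
  linarith

/-- Split (1 - P)u into (1 - P)(u - v), nonnegative against u - v as P is a contraction, and v - Pv.
Since Pv takes values in [0, 1] and v is the projection of u onto such functions, the latter is also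
nonnegative against u - v. -/
theorem IsMarkovSemigroup.inner_sub_clamp_nonneg (hP : IsMarkovSemigroup P) {t : ℝ} (ht : 0 ≤ t)
    {u v : L2 d} (hv : v =ᵐ[volume] fun x => clamp (u x)) : 0 ≤ inner ℝ (u - P t u) (u - v) := by
  have h1 := hP.inner_sub_nonneg ht (u - v)
  have h2 := inner_sub_clamp_nonpos (hP.markov t ht v (ae_mem_of_eq_clamp hv)) hv
  have e : u - P t u = ((u - v) - P t (u - v)) - (P t v - v) := by
    rw [map_sub]
    abel
  rw [e, inner_sub_left]
  linarith

theorem inner_graph_nonneg (hA : IsGenerator P A) {u v w : L2 d} (h : (u, v) ∈ A.graph)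
    (hw : ∀ t, 0 ≤ t → 0 ≤ inner ℝ (u - P t u) w) : inner ℝ v w ≤ 0 := by
  have hl := ((hA u v).mp h).inner (𝕜 := ℝ) (tendsto_const_nhds (x := w))
  refine le_of_tendsto hl ?_
  filter_upwards [eventually_mem_nhdsWithin] with t ht
  have h1 := hw t (le_of_lt ht)
  rw [← neg_sub (P t u) u, inner_neg_left] at h1
  rw [real_inner_smul_left]
  exact mul_nonpos_of_nonneg_of_nonpos (inv_nonneg.mpr (le_of_lt ht)) (by linarith)

/-- The resolvent of a Markov generator is a Markov operator. -/
theorem IsMarkovSemigroup.resolvent_mem (hP : IsMarkovSemigroup P) (hA : IsGenerator P A)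
    {u f : L2 d} (hf : ∀ᵐ x, 0 ≤ f x ∧ f x ≤ 1) (h : (u, u - f) ∈ A.graph) :
    ∀ᵐ x, 0 ≤ u x ∧ u x ≤ 1 := by
  obtain ⟨v, hv⟩ := exists_clamp u
  have h1 := inner_graph_nonneg hA h fun t ht => hP.inner_sub_clamp_nonneg ht hv
  have h2 := inner_sub_clamp_nonpos hf hv
  -- Here u - f = Au is nonpositive against u - v by the generator inequality, and f - v by the
  -- projection property.
  have h3 : inner ℝ (u - v) (u - v) ≤ 0 := by
    have e : u - v = (u - f) + (f - v) := by abel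
    nth_rw 1 [e]
    rw [inner_add_left]
    linarith
  have h4 : u = v := sub_eq_zero.mp (inner_self_eq_zero.mp (le_antisymm h3 real_inner_self_nonneg))
  rw [h4]
  exact ae_mem_of_eq_clamp hv

/-- The functions with values in `[0, 1]` span a dense subspace. -/
theorem eq_zero_of_inner_unitInterval {w : L2 d}
    (h : ∀ f : L2 d, (∀ᵐ x, 0 ≤ f x ∧ f x ≤ 1) → inner ℝ w f = 0) : w = 0 := by
  have key : ∀ w : L2 d, (∀ f : L2 d, (∀ᵐ x, 0 ≤ f x ∧ f x ≤ 1) → inner ℝ w f = 0) →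
      ∀ᵐ x, w x ≤ 0 := by
    intro w h
    obtain ⟨v, hv⟩ := exists_clamp w
    -- The truncation v of w is itself admissible, so ⟨w, v⟩ = 0; the projection inequality against
    -- 0 gives ‖v‖² ≤ ⟨v, w⟩.
    have h1 : inner ℝ v v ≤ 0 := by
      have h2 := inner_sub_clamp_nonpos (f := 0) (v := v) (u := w) zero_mem_unitInterval hv
      rw [zero_sub, inner_neg_left, inner_sub_right, real_inner_comm w v,
        h v (ae_mem_of_eq_clamp hv)] at h2
      linarith
    have h2 : v = 0 := inner_self_eq_zero.mp (le_antisymm h1 real_inner_self_nonneg)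
    filter_upwards [hv, h2 ▸ Lp.coeFn_zero ℝ 2 (volume : Measure (Space d))] with x h3 h4
    rw [h4, Pi.zero_apply, clamp] at h3
    by_contra! h5
    have : 0 < min (w x) 1 := lt_min h5 one_pos
    linarith [le_max_left (min (w x) 1) 0]
  have h1 := key w h
  have h2 := key (-w) fun f hf => by rw [inner_neg_left, h f hf, neg_zero]
  apply Lp.ext
  filter_upwards [h1, h2, Lp.coeFn_neg w, Lp.coeFn_zero ℝ 2 (volume : Measure (Space d))]
    with x h1 h2 h3 h4
  rw [h3, Pi.neg_apply] at h2
  rw [h4, Pi.zero_apply]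
  exact le_antisymm h1 (by linarith)

/-- If `K` has zero capacity, then the fractional Laplacian is the only Markov extension of its
restriction to the test functions off `K`. -/
theorem mem_graph_iff_of_isMarkov {α : ℝ} (h0 : 0 < α) (h2 : α ≤ 2) {K : Set (Space d)}
    (hK : IsCompact K) (hcap : besselCapacity d (α / 2) K = 0)
    (hle : -fracLaplacianOn d α Kᶜ ≤ A) (hA : IsSelfAdjoint A) (hP : IsMarkovSemigroup P)
    (hPA : IsGenerator P A) {u v : L2 d} :
    (u, v) ∈ A.graph ↔ mult (resSymbol d α) (u - v) = u := by
  set R := mult (resSymbol d α)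
  have hneg : ∀ u v, (u, v) ∈ A.graph → inner ℝ v u ≤ 0 := fun u v h =>
    inner_graph_nonneg hPA h fun t ht => hP.inner_sub_nonneg ht u
  have hC : ∀ f : L2 d, (∀ᵐ x, 0 ≤ f x ∧ f x ≤ 1) → (R f, R f - f) ∈ A.graph := by
    intro f hf
    obtain ⟨u, hu⟩ := exists_mem_graph_of_isSelfAdjoint hA hneg f
    have hw : HasFracLap α u (f - u) := by
      refine hasFracLap_of_weak h0 h2 hK hcap (hP.resolvent_mem hPA hf hu) fun φ hφ z hz => ?_
      have h1 := LinearPMap.le_graph_of_le hle (mem_neg_fracLaplacianOn_graph_iff.mpr ⟨hφ, hz⟩)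
      have h3 := (mem_graph_iff_of_isSelfAdjoint hA).mp h1 _ _ hu
      rw [inner_sub_left, inner_neg_right] at h3
      rw [inner_add_right]
      linarith
    rw [hasFracLap_iff_mult_resSymbol, add_sub_cancel] at hw
    rwa [hw]
  -- The vectors on which R agrees with (1 - A)⁻¹ form a closed subspace, which contains all
  -- functions with values in [0, 1].
  let S : Submodule ℝ (L2 d) := A.graph.comap
    (((R : L2 d →ₗ[ℝ] L2 d)).prod ((R : L2 d →ₗ[ℝ] L2 d) - LinearMap.id))
  have hS : ∀ f, f ∈ S ↔ (R f, R f - f) ∈ A.graph := fun f => Iff.rfl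
  have hScl : IsClosed (S : Set (L2 d)) :=
    (hA.isClosed : IsClosed (A.graph : Set (L2 d × L2 d))).preimage
      (f := fun f => (R f, R f - f)) (by fun_prop)
  have hStop : S = ⊤ := by
    rw [← hScl.submodule_topologicalClosure_eq, Submodule.topologicalClosure_eq_top_iff,
      Submodule.eq_bot_iff]
    intro w hw
    refine eq_zero_of_inner_unitInterval fun f hf => ?_
    rw [real_inner_comm]
    exact (Submodule.mem_orthogonal _ _).mp hw f ((hS f).mpr (hC f hf))
  have hall : ∀ f, (R f, R f - f) ∈ A.graph := fun f => (hS f).mp (hStop ▸ Submodule.mem_top)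
  constructor
  · intro h
    have h1 := A.graph.sub_mem h (hall (u - v))
    -- Subtraction leaves a pair (w, w) in the graph with w = u - R(u - v), and A ≤ 0 forces w = 0.
    have h3 : v - (R (u - v) - (u - v)) = u - R (u - v) := by abel
    rw [Prod.mk_sub_mk, h3] at h1
    exact (sub_eq_zero.mp (inner_self_eq_zero.mp
      (le_antisymm (hneg _ _ h1) real_inner_self_nonneg))).symm
  · intro h
    have := hall (u - v)
    rwa [h, sub_sub_cancel] at this

end MarkovGenerator

/-! ### Quadratic forms -/

section Form

variable {d : ℕ} {α : ℝ}

/-- The symbol `(1 + |ξ|^α)^(-1/2)`. -/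
def formSymbol (d : ℕ) (α : ℝ) : Symbol d where
  toFun ξ := (Real.sqrt (1 + freq α ξ))⁻¹
  measurable := ((measurable_freq α).const_add 1).sqrt.inv
  even ξ := by rw [freq_neg]
  bounded := ⟨1, fun ξ => by
    have := freq_nonneg α ξ
    rw [abs_of_nonneg (by positivity)]
    exact inv_le_one_of_one_le₀ (Real.one_le_sqrt.mpr (by linarith))⟩

theorem formSymbol_pos (ξ : Space d) : 0 < formSymbol d α ξ := by
  have := freq_nonneg α ξ
  exact inv_pos.mpr (Real.sqrt_pos.mpr (by linarith))

theorem formSymbol_le_one (ξ : Space d) : formSymbol d α ξ ≤ 1 := by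
  have := freq_nonneg α ξ
  exact inv_le_one_of_one_le₀ (Real.one_le_sqrt.mpr (by linarith))

theorem formSymbol_sq (ξ : Space d) : (formSymbol d α ξ) ^ 2 * (1 + freq α ξ) = 1 := by
  have h := freq_nonneg α ξ
  have h1 : formSymbol d α ξ = (Real.sqrt (1 + freq α ξ))⁻¹ := rfl
  rw [h1, inv_pow, Real.sq_sqrt (by linarith), inv_mul_cancel₀ (by linarith)]

/-- The operator `(1 + (-Δ)^{α/2})^(-1/2)`, an isometry of `L²` onto the form domain. -/
def formMap (d : ℕ) (α : ℝ) : L2 d →L[ℝ] L2 d := mult (formSymbol d α)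

theorem formMap_injective : Function.Injective (formMap d α) :=
  mult_injective _ fun ξ => (formSymbol_pos ξ).ne'

theorem norm_formMap_le (g : L2 d) : ‖formMap d α g‖ ≤ ‖g‖ := by
  have := norm_mult_le (formSymbol d α) (C := 1)
    (fun ξ => by rw [abs_of_pos (formSymbol_pos ξ)]; exact formSymbol_le_one ξ) g
  rwa [one_mul] at this

theorem inner_formMap_left (f g : L2 d) : inner ℝ (formMap d α f) g = inner ℝ f (formMap d α g) :=
  inner_mult_left _ f g

theorem formMap_formMap (f : L2 d) : formMap d α (formMap d α f) = mult (resSymbol d α) f := by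
  refine (mult_eq_of_hat _ ?_).symm
  filter_upwards [hat_mult (formSymbol d α) (formMap d α f), hat_mult (formSymbol d α) f]
    with ξ h1 h2
  have h3 : formSymbol d α ξ * formSymbol d α ξ = resSymbol d α ξ := by
    have h := freq_nonneg α ξ
    have h4 : resSymbol d α ξ = (1 + freq α ξ)⁻¹ := rfl
    rw [h4]
    refine eq_inv_of_mul_eq_one_left ?_
    rw [← sq, formSymbol_sq]
  change hat d (mult (formSymbol d α) (formMap d α f)) ξ = _
  rw [h1]
  change _ * hat d (mult (formSymbol d α) f) ξ = _
  rw [h2, ← h3]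
  push_cast
  ring

theorem denseRange_formMap : DenseRange (formMap d α) := by
  have : (LinearMap.range (formMap d α : L2 d →ₗ[ℝ] L2 d)).topologicalClosure = ⊤ := by
    rw [Submodule.topologicalClosure_eq_top_iff, Submodule.eq_bot_iff]
    intro x hx
    refine formMap_injective (α := α) (ext_inner_left ℝ fun y => ?_)
    rw [← inner_formMap_left, map_zero, inner_zero_right]
    exact (Submodule.mem_orthogonal _ _).mp hx _ ⟨y, rfl⟩
  have h := Submodule.dense_iff_topologicalClosure_eq_top.mpr this
  rwa [LinearMap.coe_range] at h

/-- The form norm pulls back to the L² norm, so closures and projections in the form domain can be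
taken in L². -/
theorem enorm_sq_eq_form (g : L2 d) :
    ‖g‖ₑ ^ 2 = ‖formMap d α g‖ₑ ^ 2 + energy α (formMap d α g) := by
  rw [enorm_sq_eq_lintegral_hat, enorm_sq_eq_lintegral_hat, energy,
    ← lintegral_add_left' (measurable_hat_enorm _).aemeasurable]
  refine lintegral_congr_ae ?_
  filter_upwards [hat_mult (formSymbol d α) g] with ξ h1
  have h2 : hat d (formMap d α g) ξ = (formSymbol d α ξ : ℂ) * hat d g ξ := h1
  have h := freq_nonneg α ξ
  rw [h2, enorm_sq_complex, enorm_sq_complex, ← ENNReal.ofReal_mul h,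
    ← ENNReal.ofReal_add (by positivity) (by positivity), norm_mul, Complex.norm_real,
    Real.norm_eq_abs, mul_pow, sq_abs]
  congr 1
  linear_combination (-‖hat d g ξ‖ ^ 2) * formSymbol_sq (α := α) ξ

/-- Multiply the transform by √(1 + |ξ|^α). Thus `formMap` reaches every function of finite energy.
-/
theorem exists_formMap_eq {u : L2 d} (h : energy α u ≠ ⊤) : ∃ g, formMap d α g = u := by
  have hm : MemLp (fun ξ => ((Real.sqrt (1 + freq α ξ) : ℝ) : ℂ) * hat d u ξ) 2 volume := by
    rw [memLp_two_iff_integrable_sq_norm]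
    · have h1 : Integrable (fun ξ => ‖hat d u ξ‖ ^ 2 + freq α ξ * ‖hat d u ξ‖ ^ 2) :=
        ((memLp_two_iff_integrable_sq_norm (Lp.aestronglyMeasurable _)).mp
          (Lp.memLp (hat d u))).add (integrable_energy h).1
      refine h1.congr (Eventually.of_forall fun ξ => ?_)
      have h := freq_nonneg α ξ
      simp only [norm_mul, Complex.norm_real, Real.norm_eq_abs, mul_pow, sq_abs]
      rw [Real.sq_sqrt (by linarith)]
      ring
    · refine AEStronglyMeasurable.mul ?_ (Lp.aestronglyMeasurable _)
      exact (Complex.measurable_ofReal.comp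
        ((measurable_freq α).const_add 1).sqrt).aestronglyMeasurable
  obtain ⟨g, hg⟩ := exists_hat_eq_mul (fun ξ => by rw [freq_neg]) hm
  refine ⟨g, mult_eq_of_hat _ ?_⟩
  filter_upwards [hg] with ξ h1
  have h := freq_nonneg α ξ
  have h2 : formSymbol d α ξ * Real.sqrt (1 + freq α ξ) = 1 :=
    inv_mul_cancel₀ (Real.sqrt_pos.mpr (by linarith)).ne'
  rw [h1, ← mul_assoc, ← Complex.ofReal_mul, h2, Complex.ofReal_one, one_mul]

/-- The unit contraction operates on the form domain. -/
theorem exists_formMap_eq_clamp (h0 : 0 < α) (h2 : α ≤ 2) {g v : L2 d}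
    (hv : v =ᵐ[volume] fun x => clamp (formMap d α g x)) :
    ∃ g', formMap d α g' = v ∧ ‖g'‖ ^ 2 + ‖formMap d α g‖ ^ 2 ≤ ‖g‖ ^ 2 + ‖v‖ ^ 2 := by
  obtain ⟨κ, hκ⟩ := exists_isLevyApprox d h0 h2
  have hE := energy_clamp_le hκ hv
  have hg := enorm_sq_eq_form (α := α) g
  have hfin : energy α v ≠ ⊤ := by
    refine ne_top_of_le_ne_top (b := ‖g‖ₑ ^ 2) (by simp) (hE.trans ?_)
    rw [hg]
    exact le_add_self
  obtain ⟨g', rfl⟩ := exists_formMap_eq hfin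
  refine ⟨g', rfl, ?_⟩
  -- The energy of `formMap d α g` is ‖g‖² - ‖Tg‖²; its decrease under truncation is written without
  -- subtraction.
  have h1 : ‖g'‖ₑ ^ 2 + ‖formMap d α g‖ₑ ^ 2 ≤ ‖g‖ₑ ^ 2 + ‖formMap d α g'‖ₑ ^ 2 := by
    rw [hg, enorm_sq_eq_form (α := α) g']
    calc _ ≤ ‖formMap d α g'‖ₑ ^ 2 + energy α (formMap d α g) + ‖formMap d α g‖ₑ ^ 2 := by
          gcongr
      _ = _ := by ring
  simp only [← ofReal_norm] at h1
  rw [← ENNReal.ofReal_pow (norm_nonneg _), ← ENNReal.ofReal_pow (norm_nonneg _),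
    ← ENNReal.ofReal_pow (norm_nonneg _), ← ENNReal.ofReal_pow (norm_nonneg _),
    ← ENNReal.ofReal_add (by positivity) (by positivity),
    ← ENNReal.ofReal_add (by positivity) (by positivity)] at h1
  exact (ENNReal.ofReal_le_ofReal_iff (by positivity)).mp h1

/-- The resolvent of the operator whose form is that of `(-Δ)^{α/2}`, restricted to the image of
`M` under `formMap`. -/
def formRes (α : ℝ) (M : Submodule ℝ (L2 d)) [M.HasOrthogonalProjection] : L2 d →L[ℝ] L2 d :=
  (formMap d α).comp (M.starProjection.comp (formMap d α))

variable {M : Submodule ℝ (L2 d)} [M.HasOrthogonalProjection]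

theorem formRes_apply (x : L2 d) :
    formRes α M x = formMap d α (M.starProjection (formMap d α x)) := rfl

/-- With P the projection, ⟨TPTx, x⟩ = ‖PTx‖² ≥ ‖TPTx‖². If TPTx = 0 then Tx ⊥ M, that is, x ⊥ T(M),
and T(M) is dense. -/
theorem isSymmResolvent_formRes (hM : Dense (formMap d α '' (M : Set (L2 d)))) :
    IsSymmResolvent (formRes α M) where
  symm x y := by
    simp only [formRes_apply, inner_formMap_left, M.inner_starProjection_left_eq_right]
  norm_sq_le x := by
    rw [formRes_apply, inner_formMap_left]
    have h1 : inner ℝ (M.starProjection (formMap d α x)) (formMap d α x) =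
        ‖M.starProjection (formMap d α x)‖ ^ 2 := by
      have h2 : M.starProjection (M.starProjection (formMap d α x)) =
          M.starProjection (formMap d α x) :=
        M.starProjection_eq_self_iff.mpr (M.starProjection_apply_mem _)
      nth_rw 1 [← h2]
      rw [M.inner_starProjection_left_eq_right, real_inner_self_eq_norm_sq]
    rw [h1]
    gcongr
    exact norm_formMap_le _
  inj x hx := by
    rw [formRes_apply, ← map_zero (formMap d α)] at hx
    have h1 := M.starProjection_apply_eq_zero_iff.mp (formMap_injective hx)
    refine hM.eq_zero_of_inner_right (𝕜 := ℝ) ?_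
    rintro _ ⟨m, hm, rfl⟩
    rw [inner_formMap_left]
    exact (Submodule.mem_orthogonal _ _).mp h1 m hm

/-- If the unit contraction operates on the form domain given by `M`, then the associated
operator generates a Markov semigroup. -/
theorem exists_isMarkovSemigroup_formRes (h0 : 0 < α) (h2 : α ≤ 2)
    (hM : Dense (formMap d α '' (M : Set (L2 d))))
    (hclamp : ∀ g ∈ M, ∀ g', (formMap d α g' =ᵐ[volume] fun x => clamp (formMap d α g x)) →
      g' ∈ M) :
    ∃ P, IsMarkovSemigroup P ∧ IsGenerator P (genOf (formRes α M)) := by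
  refine (isSymmResolvent_formRes hM).exists_isMarkovSemigroup fun n f hf u hu => ?_
  set y : L2 d := ((n : ℝ) + 1) • f - (n : ℝ) • u with hy
  set g := M.starProjection (formMap d α y) with hg
  have hgM : g ∈ M := M.starProjection_apply_mem _
  have hug : u = formMap d α g := hu
  obtain ⟨v, hv⟩ := exists_clamp u
  rw [hug] at hv
  obtain ⟨g', hg', hle⟩ := exists_formMap_eq_clamp h0 h2 hv
  have hg'M : g' ∈ M := hclamp g hgM g' (hg' ▸ hv)
  rw [← hug] at hv hle
  -- The form equation for u tested with u - v, admissible because M is stable under truncation.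
  have h1 : inner ℝ g (g - g') = inner ℝ y (u - v) := by
    have h3 : M.starProjection (g - g') = g - g' :=
      M.starProjection_eq_self_iff.mpr (M.sub_mem hgM hg'M)
    rw [hg, M.inner_starProjection_left_eq_right, ← hg, h3, inner_formMap_left, map_sub, hg', hug]
  have h3 : inner ℝ y (u - v) = ((n : ℝ) + 1) * (inner ℝ (f - v) (u - v) - ‖u - v‖ ^ 2) +
      inner ℝ u (u - v) := by
    rw [← real_inner_self_eq_norm_sq, hy]
    simp only [inner_sub_left, real_inner_smul_left]
    ring
  have h4 := inner_sub_clamp_nonpos hf hv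
  have h5 : ‖u - v‖ ≤ ‖g - g'‖ := by
    have := norm_formMap_le (α := α) (g - g')
    rwa [map_sub, hg', ← hug] at this
  -- Used for (g, g') and (u, v), together with the decrease of energy, this gives ⟨g, g - g'⟩ ≥ ⟨u,
  -- u - v⟩. Hence ‖u - v‖² ≤ ⟨f - v, u - v⟩ ≤ 0.
  have h6 : ∀ a b : L2 d, 2 * inner ℝ a (a - b) = ‖a‖ ^ 2 - ‖b‖ ^ 2 + ‖a - b‖ ^ 2 := fun a b => by
    rw [norm_sub_sq_real, inner_sub_right, real_inner_self_eq_norm_sq]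
    ring
  have h7 := h6 g g'
  have h8 := h6 u v
  have h9 : ‖u - v‖ ^ 2 ≤ ‖g - g'‖ ^ 2 := by gcongr
  have h10 : ((n : ℝ) + 1) * (inner ℝ (f - v) (u - v) - ‖u - v‖ ^ 2) ≥ 0 := by linarith
  have h11 := nonneg_of_mul_nonneg_right h10 (by positivity)
  have h12 : ‖u - v‖ = 0 := pow_eq_zero_iff two_ne_zero |>.mp
    (le_antisymm (by linarith) (sq_nonneg _))
  rw [sub_eq_zero.mp (norm_eq_zero.mp h12)]
  exact ae_mem_of_eq_clamp hv

end Form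

/-! ### The minimal Markov extension -/

section Minimal

variable {d : ℕ} {α : ℝ} {N : Set (Space d)}

/-- The elements of `L²` that `formMap` sends to test functions. -/
def preTest (d : ℕ) (α : ℝ) (N : Set (Space d)) : Submodule ℝ (L2 d) :=
  (testFunctions d N).comap (formMap d α : L2 d →ₗ[ℝ] L2 d)

/-- The inverse image under `formMap` of the closure of the test functions in the form domain. -/
def minForm (d : ℕ) (α : ℝ) (N : Set (Space d)) : Submodule ℝ (L2 d) :=
  (preTest d α N).topologicalClosure

instance : CompleteSpace (minForm d α N) :=
  (preTest d α N).isClosed_topologicalClosure.completeSpace_coe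

theorem formMap_formMap_add {u z : L2 d} (h : HasFracLap α u z) :
    formMap d α (formMap d α (u + z)) = u := by
  rw [formMap_formMap]
  exact hasFracLap_iff_mult_resSymbol.mp h

theorem exists_mem_preTest (h0 : 0 < α) (h2 : α ≤ 2) {φ : L2 d} (hφ : φ ∈ testFunctions d N) :
    ∃ g ∈ preTest d α N, formMap d α g = φ := by
  obtain ⟨z, hz⟩ := exists_hasFracLap_of_mem_testFunctions h0 h2 hφ
  have h := formMap_formMap_add hz
  refine ⟨formMap d α (φ + z), ?_, h⟩
  change formMap d α (formMap d α (φ + z)) ∈ testFunctions d N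
  rwa [h]

theorem dense_formMap_minForm (h0 : 0 < α) (h2 : α ≤ 2) {K : Set (Space d)} (hK : IsClosed K)
    (hK0 : volume K = 0) : Dense (formMap d α '' (minForm d α Kᶜ : Set (L2 d))) := by
  refine (dense_testFunctions hK hK0).mono fun φ hφ => ?_
  obtain ⟨g, hg, rfl⟩ := exists_mem_preTest h0 h2 hφ
  exact ⟨g, (preTest d α Kᶜ).le_topologicalClosure hg, rfl⟩

/-- The unit contraction maps test functions into the closure of the test functions. -/
theorem mem_minForm_of_eq_clamp (hN : IsOpen N) {g g' : L2 d} (hg : g ∈ preTest d α N)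
    (hg' : formMap d α g' =ᵐ[volume] fun x => clamp (formMap d α g x)) : g' ∈ minForm d α N := by
  obtain ⟨ψ, -, hψc, hψN, hψ⟩ := hg
  have h01 := ae_mem_of_eq_clamp hg'
  have hS : ∀ᵐ x, x ∉ tsupport ψ → formMap d α g' x = 0 := by
    filter_upwards [hg', hψ] with x h1 h2 hx
    have h3 : formMap d α g x = ψ x := h2
    rw [h1, h3, image_eq_zero_of_notMem_tsupport hx, clamp_zero]
  -- The truncation of a test function need not be smooth, but its mollifications are test
  -- functions, and mollifying commutes with T, so they converge in the form norm.
  refine mem_closure_of_tendsto (tendsto_mollify g') ?_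
  filter_upwards [eventually_cthickening_subset hψc hN hψN] with n hn
  have h := mollify_mem_testFunctions hψc hn (h01.mono fun x hx => hx.1) hS
  change formMap d α (mollify d n g') ∈ testFunctions d N
  have e : formMap d α (mollify d n g') = mollify d n (formMap d α g') := mult_comm _ _ _
  rwa [e]

/-- `minForm` contains the limits of its bounded sequences whose images under `formMap` converge. -/
theorem mem_minForm_of_tendsto {g : ℕ → L2 d} {v : L2 d} {C : ℝ} (hg : ∀ n, g n ∈ minForm d α N)
    (hC : ∀ n, ‖g n‖ ≤ C)
    (h : Tendsto (fun n => formMap d α (g n)) atTop (𝓝 (formMap d α v))) : v ∈ minForm d α N := by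
  have hcl : (minForm d α N)ᗮᗮ = minForm d α N := by
    rw [Submodule.orthogonal_orthogonal_eq_closure]
    exact (preTest d α N).isClosed_topologicalClosure.submodule_topologicalClosure_eq
  rw [← hcl, Submodule.mem_orthogonal]
  intro w hw
  -- Boundedness and convergence against the dense range of T give weak convergence of `g n` to v; a
  -- closed subspace, being its own double orthogonal, is weakly closed.
  have hl := tendsto_zero_of_dense (l := atTop) (T := fun n => innerSL ℝ (g n - v))
    (M := C + ‖v‖) (Eventually.of_forall fun n x => ?_) (denseRange_formMap (α := α)) ?_ w
  · have h1 : ∀ n, innerSL ℝ (g n - v) w = -inner ℝ v w := fun n => by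
      rw [innerSL_apply_apply, inner_sub_left, (Submodule.mem_orthogonal _ _).mp hw _ (hg n),
        zero_sub]
    simp_rw [h1] at hl
    rw [real_inner_comm]
    exact neg_eq_zero.mp (tendsto_nhds_unique tendsto_const_nhds hl)
  · rw [innerSL_apply_apply]
    refine (norm_inner_le_norm _ _).trans ?_
    gcongr
    refine (norm_sub_le _ _).trans ?_
    gcongr
    exact hC n
  · rintro _ ⟨z, rfl⟩
    have h1 : ∀ n, innerSL ℝ (g n - v) (formMap d α z) =
        inner ℝ (formMap d α (g n) - formMap d α v) z := fun n => by
      rw [innerSL_apply_apply, ← map_sub, inner_formMap_left]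
    simp_rw [h1]
    have := (h.sub_const (formMap d α v)).inner (𝕜 := ℝ) (tendsto_const_nhds (x := z))
    simpa using this

/-- Continuity of truncation in the form norm is not needed. Truncated approximants stay bounded in
that norm and converge in L², which suffices by `mem_minForm_of_tendsto`. -/
theorem minForm_clamp (h0 : 0 < α) (h2 : α ≤ 2) (hN : IsOpen N) {g g' : L2 d}
    (hg : g ∈ minForm d α N)
    (hg' : formMap d α g' =ᵐ[volume] fun x => clamp (formMap d α g x)) : g' ∈ minForm d α N := by
  obtain ⟨k, hk, hkg⟩ := mem_closure_iff_seq_limit.mp hg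
  choose v hv using fun n => exists_clamp (formMap d α (k n))
  choose k' hk' hle using fun n => exists_formMap_eq_clamp h0 h2 (hv n)
  have hkb : ∀ n, ‖k' n‖ ≤ ‖k n‖ := fun n => by
    have h1 : ‖v n‖ ≤ ‖formMap d α (k n)‖ := norm_le_of_ae_le (by
      filter_upwards [hv n] with x hx
      rw [hx]
      exact abs_clamp_le _)
    have h3 : ‖v n‖ ^ 2 ≤ ‖formMap d α (k n)‖ ^ 2 := by gcongr
    exact (sq_le_sq₀ (norm_nonneg _) (norm_nonneg _)).mp (by linarith [hle n])
  obtain ⟨C, hC⟩ := hkg.norm.bddAbove_range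
  refine mem_minForm_of_tendsto (g := k') (C := C) (fun n => ?_)
    (fun n => (hkb n).trans (hC ⟨n, rfl⟩)) ?_
  · exact mem_minForm_of_eq_clamp hN (hk n) ((hk' n).symm ▸ hv n)
  · have ht := ((formMap d α).continuous.tendsto g).comp hkg
    rw [tendsto_iff_norm_sub_tendsto_zero] at ht ⊢
    refine squeeze_zero (fun _ => norm_nonneg _) (fun n => norm_le_of_ae_le ?_) ht
    have hkn := (hk' n).symm ▸ hv n
    filter_upwards [hkn, hg', Lp.coeFn_sub (formMap d α (k' n)) (formMap d α g'),
      Lp.coeFn_sub (formMap d α (k n)) (formMap d α g)] with x h1 h3 h4 h5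
    have e : ((formMap d α ∘ k) n - formMap d α g : L2 d) x =
        formMap d α (k n) x - formMap d α g x := h5
    rw [e, h4, Pi.sub_apply, h1, h3]
    exact abs_clamp_sub_le _ _

/-- A form resolvent extends the resolvent on the test functions. -/
theorem neg_fracLaplacianOn_le_genOf (M : Submodule ℝ (L2 d)) [M.HasOrthogonalProjection]
    (hM : Dense (formMap d α '' (M : Set (L2 d)))) (hN : preTest d α N ≤ M) :
    -fracLaplacianOn d α N ≤ genOf (formRes α M) := by
  refine LinearPMap.le_of_le_graph ?_
  rintro ⟨u, v⟩ h
  rw [← neg_neg v, mem_neg_fracLaplacianOn_graph_iff] at h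
  obtain ⟨hu, hz⟩ := h
  rw [(isSymmResolvent_formRes hM).mem_genOf_graph_iff, sub_eq_add_neg, formRes_apply]
  have h1 := formMap_formMap_add hz
  have h2 : formMap d α (u + -v) ∈ M := by
    refine hN ?_
    change formMap d α (formMap d α (u + -v)) ∈ testFunctions d N
    rwa [h1]
  rw [M.starProjection_eq_self_iff.mpr h2, h1]

end Minimal

/-! ### Zero capacity from density of the test functions -/

section Capacity

variable {d : ℕ} {α : ℝ} {K : Set (Space d)}

/-- Subadditivity of r ↦ r^{α/2}, valid since α ≤ 2, gives (1 + |ξ|²)^{α/2} ≤ 1 + |ξ|^α. -/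
theorem formSymbol_le_besselSymbol (h0 : 0 < α) (h2 : α ≤ 2) (ξ : Space d) :
    formSymbol d α ξ ≤ besselSymbol d (half_pos h0) ξ := by
  refine (sq_le_sq₀ (formSymbol_pos ξ).le (besselSymbol_pos _ ξ).le).mp ?_
  have h := freq_nonneg α ξ
  rw [besselSymbol_half_sq h0, eq_inv_of_mul_eq_one_left (formSymbol_sq (α := α) ξ)]
  refine inv_anti₀ (by positivity) ?_
  rw [freq_eq]
  refine (Real.rpow_add_le_add_rpow zero_le_one (sq_nonneg _) (by positivity)
    (by linarith)).trans ?_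
  rw [Real.one_rpow]

/-- The quotient of `formSymbol` by the symbol of the Bessel potential. -/
def ratioSymbol (d : ℕ) {α : ℝ} (h0 : 0 < α) (h2 : α ≤ 2) : Symbol d where
  toFun ξ := formSymbol d α ξ / besselSymbol d (half_pos h0) ξ
  measurable := (formSymbol d α).measurable.div (besselSymbol d (half_pos h0)).measurable
  even ξ := by rw [(formSymbol d α).even, (besselSymbol d (half_pos h0)).even]
  bounded := ⟨1, fun ξ => by
    rw [abs_of_nonneg (div_nonneg (formSymbol_pos ξ).le (besselSymbol_pos _ ξ).le)]
    exact div_le_one_of_le₀ (formSymbol_le_besselSymbol h0 h2 ξ) (besselSymbol_pos _ ξ).le⟩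

/-- Every element of the form domain is a Bessel potential. -/
theorem exists_besselSymbol_eq (h0 : 0 < α) (h2 : α ≤ 2) (g : L2 d) :
    ∃ f, mult (besselSymbol d (half_pos h0)) f = formMap d α g ∧ ‖f‖ ≤ ‖g‖ := by
  refine ⟨mult (ratioSymbol d h0 h2) g, mult_eq_of_hat _ ?_, ?_⟩
  · filter_upwards [hat_mult (ratioSymbol d h0 h2) g, hat_mult (formSymbol d α) g] with ξ h1 h3
    have h4 : hat d (formMap d α g) ξ = _ := h3
    have h5 : besselSymbol d (half_pos h0) ξ * ratioSymbol d h0 h2 ξ = formSymbol d α ξ :=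
      mul_div_cancel₀ _ (besselSymbol_pos _ ξ).ne'
    rw [h1, h4, ← mul_assoc, ← Complex.ofReal_mul, h5]
  · have := norm_mult_le (ratioSymbol d h0 h2) (C := 1) (fun ξ => by
      have h : ratioSymbol d h0 h2 ξ = formSymbol d α ξ / besselSymbol d (half_pos h0) ξ := rfl
      rw [h, abs_of_nonneg (div_nonneg (formSymbol_pos ξ).le (besselSymbol_pos _ ξ).le)]
      exact div_le_one_of_le₀ (formSymbol_le_besselSymbol h0 h2 ξ) (besselSymbol_pos _ ξ).le) g
    rwa [one_mul] at this

/-- A square integrable function whose Bessel potential is at least `1` a.e. near the compact set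
`K` bounds the capacity of `K`. -/
theorem besselCapacity_le {s : ℝ} (hs : 0 < s) (hK : IsCompact K) {U : Set (Space d)}
    (hU : IsOpen U) (hKU : K ⊆ U) {f : L2 d} (hf : ∀ᵐ x, x ∈ U → 1 ≤ mult (besselSymbol d hs) f x) :
    besselCapacity d s K ≤ ENNReal.ofReal (‖f‖ ^ 2) := by
  -- The capacity admits only nonnegative functions. Passing to the positive part does not increase
  -- the norm, and it does not decrease the potential, because the Bessel kernel is nonnegative.
  set p : L2 d := Lp.posPart f with hp
  have hpe : p =ᵐ[volume] fun x => max (f x) 0 := Lp.coeFn_posPart f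
  have hp0 : ∀ᵐ x, 0 ≤ p x := hpe.mono fun x hx => by
    rw [hx]
    exact le_max_right _ _
  have hpn : ‖p‖ ≤ ‖f‖ := norm_le_of_ae_le (hpe.mono fun x hx => by
    rw [hx, abs_of_nonneg (le_max_right _ _)]
    exact max_le (le_abs_self _) (abs_nonneg _))
  have hpU : ∀ᵐ x, x ∈ U → 1 ≤ besselPotential d s p x := by
    have h1 : ∀ᵐ x, 0 ≤ mult (besselSymbol d hs) (p - f) x := by
      refine mult_besselSymbol_nonneg hs ?_
      filter_upwards [hpe, Lp.coeFn_sub p f] with x h1 h2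
      rw [h2, Pi.sub_apply, h1]
      linarith [le_max_left (f x) 0]
    rw [map_sub] at h1
    filter_upwards [h1, hf, besselPotential_ae_eq hs hp0,
      Lp.coeFn_sub (mult (besselSymbol d hs) p) (mult (besselSymbol d hs) f)] with x h1 h2 h3 h4 hx
    rw [h4, Pi.sub_apply] at h1
    rw [h3, ← ENNReal.ofReal_one]
    exact ENNReal.ofReal_le_ofReal (by linarith [h2 hx])
  obtain ⟨n, hn⟩ := (eventually_cthickening_subset hK hU hKU).exists
  have hq : 0 ≤ mollify d n p := by
    rw [← Lp.coeFn_nonneg]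
    filter_upwards [mollify_ae_eq n hp0] with x hx
    rw [hx]
    exact mollFun_nonneg n hp0 x
  -- Mollifying p averages its potential over small balls inside U, which turns the bound a.e. on U
  -- into a bound at every point of K.
  have hq1 : ∀ x ∈ K, 1 ≤ besselPotential d s (mollify d n p) x := by
    intro x hx
    rw [besselPotential_mollify n hp0, ← lintegral_moll (d := d) n]
    refine lintegral_mono_ae ?_
    filter_upwards [(Measure.measurePreserving_sub_left volume x).quasiMeasurePreserving.ae hpU]
      with z hz
    rcases lt_or_ge ‖z‖ (1 / ((n : ℝ) + 1)) with h | h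
    · have hzU : x - z ∈ U := hn (Metric.mem_cthickening_of_dist_le (x - z) x _ K hx (by
        rw [dist_eq_norm, sub_sub_cancel_left, norm_neg]
        exact h.le))
      exact le_mul_of_one_le_right zero_le (hz hzU)
    · rw [moll_eq_zero n h, ENNReal.ofReal_zero]
      exact zero_le
  refine (iInf₂_le (mollify d n p) ⟨hq, hq1⟩).trans (ENNReal.ofReal_le_ofReal ?_)
  gcongr
  exact (norm_mollify_le n p).trans hpn

/-- If the test functions off `K` are dense in the form domain, then `K` has zero capacity. -/
theorem besselCapacity_eq_zero_of_minForm_eq_top (h0 : 0 < α) (h2 : α ≤ 2) (hK : IsCompact K)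
    (h : minForm d α Kᶜ = ⊤) : besselCapacity d (α / 2) K = 0 := by
  obtain ⟨χ, hχ, hχc, U, hU, hKU, hχU⟩ : ∃ χ : Space d → ℝ, ContDiff ℝ ∞ χ ∧
      HasCompactSupport χ ∧ ∃ U, IsOpen U ∧ K ⊆ U ∧ ∀ x ∈ U, χ x = 1 := by
    obtain ⟨q, -, hχ⟩ := exists_cutoff_at_infinity d
    obtain ⟨R, hR⟩ := hK.isBounded.subset_ball 0
    obtain ⟨n, hn⟩ := exists_nat_ge R
    obtain ⟨χ, hχs, hχc, -, hχ1, -⟩ := hχ n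
    exact ⟨χ, hχs, hχc, Metric.ball 0 R, Metric.isOpen_ball, hR, fun x hx =>
      hχ1 x ((mem_ball_zero_iff.mp hx).le.trans hn)⟩
  obtain ⟨c, hc, hcχ⟩ := exists_mem_testFunctions hχ hχc (Set.subset_univ _)
  obtain ⟨g, -, hg⟩ := exists_mem_preTest h0 h2 hc
  have hgm : g ∈ minForm d α Kᶜ := h ▸ Submodule.mem_top
  have key : ∀ ε : ℝ, 0 < ε → besselCapacity d (α / 2) K ≤ ENNReal.ofReal (ε ^ 2) := by
    intro ε hε
    -- The difference Tg - Tk = χ - φ equals 1 on a neighbourhood of K, and its form norm is ‖g - k‖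
    -- < ε.
    obtain ⟨k, ⟨φ, -, hφc, hφK, hφ⟩, hk⟩ := Metric.mem_closure_iff.mp hgm ε hε
    rw [dist_eq_norm] at hk
    obtain ⟨f, hf, hfn⟩ := exists_besselSymbol_eq h0 h2 (g - k)
    refine (besselCapacity_le (half_pos h0) hK (hU.inter (isClosed_tsupport φ).isOpen_compl)
      (Set.subset_inter hKU (Set.subset_compl_comm.mp hφK)) (f := f) ?_).trans
      (ENNReal.ofReal_le_ofReal (by gcongr; exact hfn.trans hk.le))
    rw [hf, map_sub, hg]
    filter_upwards [hcχ, hφ, Lp.coeFn_sub c (formMap d α k)] with x h1 h3 h4 hx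
    have h5 : formMap d α k x = φ x := h3
    rw [h4, Pi.sub_apply, h1, h5, hχU x hx.1, image_eq_zero_of_notMem_tsupport hx.2, sub_zero]
  have hl : Tendsto (fun n : ℕ => ENNReal.ofReal ((1 / ((n : ℝ) + 1)) ^ 2)) atTop (𝓝 0) := by
    simpa using ENNReal.tendsto_ofReal ((tendsto_one_div_add_atTop_nhds_zero_nat (𝕜 := ℝ)).pow 2)
  exact le_antisymm (ge_of_tendsto' hl fun n => key _ Nat.one_div_pos_of_nat) zero_le

end Capacity

end MarkovUniqueness

end

/-! ### Equivalence of Markov uniqueness and zero capacity -/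

theorem theorem3p1 (d : ℕ) (α : ℝ) (hα₀ : 0 < α) (hα₂ : α ≤ 2)
    (K : Set (EuclideanSpace ℝ (Fin d))) (hK : IsCompact K) (hK₀ : MeasureTheory.volume K = 0) :
    MarkovUniqueness.IsMarkovUnique (-MarkovUniqueness.fracLaplacianOn d α Kᶜ) ↔
      MarkovUniqueness.besselCapacity d (α / 2) K = 0 := by
  open MarkovUniqueness in
  have hd := dense_formMap_minForm hα₀ hα₂ hK.isClosed hK₀
  have hmin := neg_fracLaplacianOn_le_genOf (minForm d α Kᶜ) hd
    (preTest d α Kᶜ).le_topologicalClosure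
  have hex := exists_isMarkovSemigroup_formRes hα₀ hα₂ hd fun g hg g' =>
    minForm_clamp hα₀ hα₂ hK.isClosed.isOpen_compl hg
  constructor
  · intro hu
    have hdt : Dense (formMap d α '' ((⊤ : Submodule ℝ (L2 d)) : Set (L2 d))) := by
      rw [Submodule.top_coe, Set.image_univ]
      exact denseRange_formMap
    -- Uniqueness identifies the operators of the smallest and of the full form domain.
    have h1 := hu.unique ⟨hmin, (isSymmResolvent_formRes hd).isSelfAdjoint, hex⟩
      ⟨neg_fracLaplacianOn_le_genOf ⊤ hdt le_top, (isSymmResolvent_formRes hdt).isSelfAdjoint,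
        exists_isMarkovSemigroup_formRes hα₀ hα₂ hdt fun _ _ _ _ => Submodule.mem_top⟩
    refine besselCapacity_eq_zero_of_minForm_eq_top hα₀ hα₂ hK ?_
    -- Equality of the resolvents, T P T = T T, and injectivity of T give PTx = Tx. So the closed
    -- subspace `minForm` contains the dense range of T.
    have h2 : ∀ x, formMap d α x ∈ minForm d α Kᶜ := fun x => by
      have h3 : (formRes α ⊤ x, formRes α ⊤ x - x) ∈ (genOf (formRes α (⊤ : Submodule ℝ (L2 d)))).graph :=
        (isSymmResolvent_formRes hdt).mem_genOf_graph_iff.mpr (by rw [sub_sub_cancel])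
      rw [← h1, (isSymmResolvent_formRes hd).mem_genOf_graph_iff, sub_sub_cancel, formRes_apply,
        formRes_apply, Submodule.starProjection_top, ContinuousLinearMap.id_apply] at h3
      exact Submodule.starProjection_eq_self_iff.mp (formMap_injective h3)
    have h4 : Dense (minForm d α Kᶜ : Set (L2 d)) :=
      (denseRange_formMap (α := α)).mono (by rintro _ ⟨x, rfl⟩; exact h2 x)
    have h5 : IsClosed (minForm d α Kᶜ : Set (L2 d)) := (preTest d α Kᶜ).isClosed_topologicalClosure
    rw [← h5.submodule_topologicalClosure_eq]
    exact Submodule.dense_iff_topologicalClosure_eq_top.mp h4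
  · intro hcap
    refine ⟨_, ⟨hmin, (isSymmResolvent_formRes hd).isSelfAdjoint, hex⟩, ?_⟩
    rintro A ⟨hle, hA, P, hP, hPA⟩
    obtain ⟨P', hP', hPA'⟩ := hex
    refine LinearPMap.eq_of_eq_graph ?_
    ext ⟨u, v⟩
    -- Both A and the minimal extension have the graph of the negative fractional Laplacian.
    rw [mem_graph_iff_of_isMarkov hα₀ hα₂ hK hcap hle hA hP hPA,
      mem_graph_iff_of_isMarkov hα₀ hα₂ hK hcap hmin (isSymmResolvent_formRes hd).isSelfAdjoint
        hP' hPA']
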